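/- **Theorem.** Work over $\mathbf{ACA}_0$, the subsystem of second order arithmetic with the basic axioms for $0,1,+,\cdot,<$, the induction axiom for sets, and comprehension for arithmetical formulas (with parameters). Assume that every normal dilator has a well-founded fixed point. Then each instance $$\varphi(0)\wedge\forall n\,(\varphi(n)\rightarrow\varphi(n+1))\rightarrow\forall n\,\varphi(n)$$ of induction along the natural numbers holds, where $\varphi$ is a $\Pi^1_1$-formula, possibly with number and set parameters. In other words: if a (not necessarily $\omega$-) model of $\mathbf{ACA}_0$ satisfies the principle that every normal dilator has a well-founded fixed point, then it satisfies each of these instances. The notions are the following, all read within second order arithmetic, with finite sets and functions coded by natural numbers. * A *coded prae-dilator* consists of a functor $T$ from the category of the finite orders $n=\{0,\dots,n-1\}$ and strictly increasing functions to the category of linear orders (with fields contained in $\mathbb N$) and order embeddings, together with a natural transformation $\operatorname{supp}^T:T\Rightarrow[\cdot]^{<\omega}$ to the finite subset functor, such that each $\sigma\in T(n)$ lies in the range of $T(f)$, where $f:|\operatorname{supp}^T_n(\sigma)|\to n$ is the strictly increasing function with range $\operatorname{supp}^T_n(\sigma)$. * For a linear order $X$ (with field contained in $\mathbb N$), $D^T(X)$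 is the set of pairs $\langle a,\sigma\rangle$ with $a\subseteq X$ finite, $\sigma\in T(|a|)$ and $\operatorname{supp}^T_{|a|}(\sigma)=|a|$. It is ordered by $$\langle a,\sigma\rangle<\langle b,\tau\rangle\iff T(|\iota_a|)(\sigma)<_{T(|a\cup b|)}T(|\iota_b|)(\tau),$$ where $|\iota_a|:|a|\to|a\cup b|$ and $|\iota_b|:|b|\to|a\cup b|$ correspond to the inclusions $a,b\subseteq a\cup b$ via the increasing enumerations of $a$, $b$ and $a\cup b$ with respect to $X$. * $T$ is a *coded dilator* if $D^T(X)$ is well-founded for every well-order $X$ on a subset of $\mathbb N$. * A *normal dilator* is a coded dilator $T$ together with a natural family of order embeddings $\mu_n:n\to T(n)$ such that $\sigma<_{T(n)}\mu_n(m)\Leftrightarrow\operatorname{supp}^T_n(\sigma)\subseteq\{0,\dots,m-1\}$ holds for all $m<n$ and all $\sigma\in T(n)$. * A *fixed point* of $T$ consists of a linear order $X$ and an order embedding $\xi:D^T(X)\to X$; it is *well-founded* if $X$ is. -/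

import Mathlib

universe u

/-! ## The language of second order arithmetic and its structures -/

/-- Terms of the language of second order arithmetic; `var i` is the `i`-th number variable. -/
inductive L2Term : Type
  | var (i : ℕ) : L2Term
  | zero : L2Term
  | one : L2Term
  | add (s t : L2Term) : L2Term
  | mul (s t : L2Term) : L2Term

/-- Formulas of the two-sorted language of second order arithmetic. Number variables and set
variables are each indexed by `ℕ`. -/
inductive L2Formula : Type
  | eq (s t : L2Term) : L2Formula
  | lt (s t : L2Term) : L2Formula
  | mem (t : L2Term) (X : ℕ) : L2Formula
  | neg (φ : L2Formula) : L2Formula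
  | and (φ ψ : L2Formula) : L2Formula
  | or (φ ψ : L2Formula) : L2Formula
  | imp (φ ψ : L2Formula) : L2Formula
  | iff (φ ψ : L2Formula) : L2Formula
  | allNum (i : ℕ) (φ : L2Formula) : L2Formula
  | exNum (i : ℕ) (φ : L2Formula) : L2Formula
  | allSet (X : ℕ) (φ : L2Formula) : L2Formula
  | exSet (X : ℕ) (φ : L2Formula) : L2Formula

/-- A formula is arithmetical if it has no set quantifiers (free set variables are allowed). -/
def L2Formula.Arithmetical : L2Formula → Prop
  | eq _ _ => True
  | lt _ _ => True
  | mem _ _ => True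
  | neg φ => φ.Arithmetical
  | and φ ψ => φ.Arithmetical ∧ ψ.Arithmetical
  | or φ ψ => φ.Arithmetical ∧ ψ.Arithmetical
  | imp φ ψ => φ.Arithmetical ∧ ψ.Arithmetical
  | iff φ ψ => φ.Arithmetical ∧ ψ.Arithmetical
  | allNum _ φ => φ.Arithmetical
  | exNum _ φ => φ.Arithmetical
  | allSet _ _ => False
  | exSet _ _ => False

/-- A `Π¹₁`-formula is a universal set quantifier followed by an arithmetical formula. -/
def L2Formula.IsPi11 (φ : L2Formula) : Prop :=
  ∃ (X : ℕ) (θ : L2Formula), θ.Arithmetical ∧ φ = L2Formula.allSet X θ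

/-- A structure for the language of second order arithmetic: a first order part `Num`, which may be
nonstandard, and a collection `sets` of subsets of it, over which the set quantifiers range. -/
structure L2Structure : Type (u + 1) where
  Num : Type u
  zero : Num
  one : Num
  add : Num → Num → Num
  mul : Num → Num → Num
  lt : Num → Num → Prop
  sets : Set (Set Num)

namespace L2Structure

variable (M : L2Structure.{u})

instance : Zero M.Num := ⟨M.zero⟩
instance : One M.Num := ⟨M.one⟩
instance : Add M.Num := ⟨M.add⟩
instance : Mul M.Num := ⟨M.mul⟩
instance : LT M.Num := ⟨M.lt⟩

/-- The value of a term under an assignment of the number variables. -/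
def termVal (v : ℕ → M.Num) : L2Term → M.Num
  | .var i => v i
  | .zero => 0
  | .one => 1
  | .add s t => termVal v s + termVal v t
  | .mul s t => termVal v s * termVal v t

/-- Satisfaction of a formula under assignments `v` of the number variables and `V` of the set
variables. -/
def Sat : L2Formula → (ℕ → M.Num) → (ℕ → M.sets) → Prop
  | .eq s t, v, _ => M.termVal v s = M.termVal v t
  | .lt s t, v, _ => M.termVal v s < M.termVal v t
  | .mem t X, v, V => M.termVal v t ∈ (V X : Set M.Num)
  | .neg φ, v, V => ¬ Sat φ v V
  | .and φ ψ, v, V => Sat φ v V ∧ Sat ψ v V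
  | .or φ ψ, v, V => Sat φ v V ∨ Sat ψ v V
  | .imp φ ψ, v, V => Sat φ v V → Sat ψ v V
  | .iff φ ψ, v, V => Sat φ v V ↔ Sat ψ v V
  | .allNum i φ, v, V => ∀ a : M.Num, Sat φ (Function.update v i a) V
  | .exNum i φ, v, V => ∃ a : M.Num, Sat φ (Function.update v i a) V
  | .allSet X φ, v, V => ∀ A : M.sets, Sat φ v (Function.update V X A)
  | .exSet X φ, v, V => ∃ A : M.sets, Sat φ v (Function.update V X A)

/-- `M` is a model of `ACA₀`: the basic axioms, the induction axiom for sets, and comprehension for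
all arithmetical formulas with number and set parameters. -/
structure ModelsACA0 : Prop where
  succ_ne_zero : ∀ m : M.Num, m + 1 ≠ 0
  succ_inj : ∀ m n : M.Num, m + 1 = n + 1 → m = n
  add_zero : ∀ m : M.Num, m + 0 = m
  add_succ : ∀ m n : M.Num, m + (n + 1) = (m + n) + 1
  mul_zero : ∀ m : M.Num, m * 0 = 0
  mul_succ : ∀ m n : M.Num, m * (n + 1) = m * n + m
  not_lt_zero : ∀ m : M.Num, ¬ m < 0
  lt_succ : ∀ m n : M.Num, m < n + 1 ↔ m < n ∨ m = n
  induction : ∀ X ∈ M.sets, 0 ∈ X → (∀ n : M.Num, n ∈ X → n + 1 ∈ X) → ∀ n : M.Num, n ∈ X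
  comprehension : ∀ φ : L2Formula, φ.Arithmetical →
    ∀ (i : ℕ) (v : ℕ → M.Num) (V : ℕ → M.sets),
      {a : M.Num | M.Sat φ (Function.update v i a) V} ∈ M.sets

/-- `M` satisfies the instance of induction along the natural numbers for the formula `φ`, the number
variable `i` and all values of the remaining free variables of `φ`. -/
def SatisfiesInduction (φ : L2Formula) (i : ℕ) : Prop :=
  ∀ (v : ℕ → M.Num) (V : ℕ → M.sets),
    M.Sat φ (Function.update v i 0) V →
    (∀ n : M.Num, M.Sat φ (Function.update v i n) V → M.Sat φ (Function.update v i (n + 1)) V) →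
    ∀ n : M.Num, M.Sat φ (Function.update v i n) V

/-! ## Notions of second order arithmetic, interpreted in a structure

In everything below, quantifiers range over the numbers and the sets of `M` only, so that each notion
is the interpretation in `M` of a formula of second order arithmetic. -/

section

variable {M}

/-- The pairing function `(i + j)² + i`. -/
def pair (i j : M.Num) : M.Num := (i + j) * (i + j) + i

/-- `i` belongs to the finite set described by `c = (k, (m, n))`: we have `i < k`, and `m (i + 1) + 1`
divides `n`. -/
def Elem (i c : M.Num) : Prop :=
  ∃ k m n : M.Num, c = pair k (pair m n) ∧ i < k ∧ ∃ q : M.Num, n = (m * (i + 1) + 1) * q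

/-- `c` is the code of a finite set, i.e. the least number that describes it. -/
def IsFin (c : M.Num) : Prop :=
  ∀ d : M.Num, d < c → ¬ ∀ i : M.Num, Elem i c ↔ Elem i d

/-- `s` codes a finite sequence of length `l`, i.e. a function on `{0, …, l - 1}`, given by its
graph. -/
def IsSeq (s l : M.Num) : Prop :=
  IsFin s ∧ (∀ p : M.Num, Elem p s → ∃ i j : M.Num, i < l ∧ p = pair i j) ∧
    ∀ i : M.Num, i < l → ∃! j : M.Num, Elem (pair i j) s

/-- `j` is the entry of the sequence `s` at position `i`. -/
def Entry (s i j : M.Num) : Prop := Elem (pair i j) s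

/-- `f` codes a morphism from `m = {0, …, m - 1}` to `n = {0, …, n - 1}` in the category of natural
numbers: a strictly increasing function. -/
def IsMor (f m n : M.Num) : Prop :=
  IsSeq f m ∧ (∀ i j : M.Num, Entry f i j → j < n) ∧
    ∀ i i' j j' : M.Num, i < i' → Entry f i j → Entry f i' j' → j < j'

/-- `f` is (the code of) the identity on `n`. -/
def IsIdMor (f n : M.Num) : Prop :=
  IsMor f n n ∧ ∀ i : M.Num, i < n → Entry f i i

/-- The sequence `h` is the composition of `f` followed by `g`. -/
def IsComp (h f g : M.Num) : Prop :=
  ∀ i k : M.Num, Entry h i k ↔ ∃ j : M.Num, Entry f i j ∧ Entry g j k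

/-- The finite set `a` is the range of the sequence `f`. -/
def IsRange (a f : M.Num) : Prop :=
  ∀ j : M.Num, Elem j a ↔ ∃ i : M.Num, Entry f i j

/-- The relation `r` is a strict linear order on `A`. -/
def IsLinOrd (A : M.Num → Prop) (r : M.Num → M.Num → Prop) : Prop :=
  (∀ x, A x → ¬ r x x) ∧
  (∀ x y z, A x → A y → A z → r x y → r y z → r x z) ∧
  (∀ x y, A x → A y → r x y ∨ x = y ∨ r y x)

/-- The relation `r` is well-founded on `A` in the sense of `M`: every nonempty set of `M` that is
contained in `A` has an `r`-minimal element. -/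
def IsWellFounded (A : M.Num → Prop) (r : M.Num → M.Num → Prop) : Prop :=
  ∀ Y ∈ M.sets, (∃ y, y ∈ Y) → (∀ y ∈ Y, A y) → ∃ y ∈ Y, ∀ z ∈ Y, ¬ r z y

end

/-- A pair of sets of `M` that is meant to represent an order: a field, and a set of pairs. -/
structure PreOrd where
  field : Set M.Num
  rel : Set M.Num
  field_mem : field ∈ M.sets
  rel_mem : rel ∈ M.sets

namespace PreOrd

variable {M} (X : M.PreOrd)

def Mem (x : M.Num) : Prop := x ∈ X.field

def Lt (x y : M.Num) : Prop := pair x y ∈ X.rel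

def IsLinear : Prop := IsLinOrd X.Mem X.Lt

def IsWellOrder : Prop := X.IsLinear ∧ IsWellFounded X.Mem X.Lt

/-- `e` codes the increasing enumeration `en_a : |a| → a` of the finite set `a ⊆ X`, and `k = |a|`. -/
def IsEnum (e k a : M.Num) : Prop :=
  IsSeq e k ∧ IsRange a e ∧
    ∀ i i' x x' : M.Num, i < i' → Entry e i x → Entry e i' x' → X.Lt x x'

end PreOrd

/-- The sets of `M` that make up the data of a coded prae-dilator. Functions are given by their
graphs. -/
structure PraeDilatorData where
  /-- pairs `(n, σ)` with `σ ∈ T(n)` -/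
  fieldSet : Set M.Num
  /-- triples `(n, (σ, τ))` with `σ < τ` in `T(n)` -/
  ltSet : Set M.Num
  /-- tuples `((m, n), (f, (σ, τ)))` with `T(f)(σ) = τ` for `f : m → n` -/
  mapSet : Set M.Num
  /-- triples `(n, (σ, a))` with `supp_n(σ) = a` -/
  suppSet : Set M.Num
  fieldSet_mem : fieldSet ∈ M.sets
  ltSet_mem : ltSet ∈ M.sets
  mapSet_mem : mapSet ∈ M.sets
  suppSet_mem : suppSet ∈ M.sets

namespace PraeDilatorData

variable {M} (T : M.PraeDilatorData)

/-- `σ ∈ T(n)`. -/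
def Mem (n σ : M.Num) : Prop := pair n σ ∈ T.fieldSet

/-- `σ < τ` in `T(n)`. -/
def Lt (n σ τ : M.Num) : Prop := pair n (pair σ τ) ∈ T.ltSet

/-- `T(f)(σ) = τ`, for `f : m → n`. -/
def Map (m n f σ τ : M.Num) : Prop := pair (pair m n) (pair f (pair σ τ)) ∈ T.mapSet

/-- `supp_n(σ) = a`. -/
def Supp (n σ a : M.Num) : Prop := pair n (pair σ a) ∈ T.suppSet

/-- The data form a coded prae-dilator: a functor from the category of natural numbers to the
category of linear orders and embeddings, with a natural transformation to the finite subset functor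
that satisfies the support condition. -/
structure IsPraeDilator : Prop where
  linear : ∀ n, IsLinOrd (T.Mem n) (T.Lt n)
  map_fun : ∀ m n f, IsMor f m n → ∀ σ, T.Mem m σ → ∃! τ, T.Map m n f σ τ
  map_mem : ∀ m n f, IsMor f m n → ∀ σ τ, T.Mem m σ → T.Map m n f σ τ → T.Mem n τ
  map_lt : ∀ m n f, IsMor f m n → ∀ σ σ' τ τ', T.Mem m σ → T.Mem m σ' →
    T.Map m n f σ τ → T.Map m n f σ' τ' → T.Lt m σ σ' → T.Lt n τ τ'
  map_id : ∀ n f, IsIdMor f n → ∀ σ, T.Mem n σ → T.Map n n f σ σ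
  map_comp : ∀ k m n f g h, IsMor f k m → IsMor g m n → IsMor h k n → IsComp h f g →
    ∀ ρ σ τ, T.Mem k ρ → T.Map k m f ρ σ → T.Map m n g σ τ → T.Map k n h ρ τ
  supp_fun : ∀ n σ, T.Mem n σ → ∃! a, T.Supp n σ a
  supp_fin : ∀ n σ a, T.Mem n σ → T.Supp n σ a → IsFin a ∧ ∀ i, Elem i a → i < n
  supp_natural : ∀ m n f, IsMor f m n → ∀ σ τ a b, T.Mem m σ → T.Map m n f σ τ →
    T.Supp m σ a → T.Supp n τ b → ∀ j, Elem j b ↔ ∃ i, Elem i a ∧ Entry f i j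
  supp_range : ∀ n σ a, T.Mem n σ → T.Supp n σ a →
    ∃ k f ρ, IsMor f k n ∧ IsRange a f ∧ T.Mem k ρ ∧ T.Map k n f ρ σ

/-- `p` is an element `⟨a, σ⟩` of `D^T(X)`: a finite set `a ⊆ X` and some `σ ∈ T(|a|)` with
`supp_{|a|}(σ) = |a|`. -/
def DMem (X : M.PreOrd) (p : M.Num) : Prop :=
  ∃ a σ, p = pair a σ ∧ IsFin a ∧ (∀ x, Elem x a → X.Mem x) ∧
    ∃ e k, X.IsEnum e k a ∧ T.Mem k σ ∧ ∃ s, T.Supp k σ s ∧ ∀ i, Elem i s ↔ i < k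

/-- The order on `D^T(X)`: writing `p = ⟨a, σ⟩`, `q = ⟨b, τ⟩` and `c = a ∪ b`, we have
`T(f)(σ) < T(g)(τ)` in `T(|c|)`, where `f : |a| → |c|` and `g : |b| → |c|` are determined by
`en_c ∘ f = en_a` and `en_c ∘ g = en_b`. -/
def DLt (X : M.PreOrd) (p q : M.Num) : Prop :=
  ∃ a σ b τ, p = pair a σ ∧ q = pair b τ ∧
    ∃ c, IsFin c ∧ (∀ x, Elem x c ↔ Elem x a ∨ Elem x b) ∧
    ∃ ea ka eb kb ec kc, X.IsEnum ea ka a ∧ X.IsEnum eb kb b ∧ X.IsEnum ec kc c ∧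
    ∃ f g, IsMor f ka kc ∧ IsComp ea f ec ∧ IsMor g kb kc ∧ IsComp eb g ec ∧
    ∃ σ' τ', T.Map ka kc f σ σ' ∧ T.Map kb kc g τ τ' ∧ T.Lt kc σ' τ'

/-- `T` is a coded dilator: a coded prae-dilator such that `D^T(X)` is well-founded for every
well-order `X` (of `M`). -/
def IsDilator : Prop :=
  T.IsPraeDilator ∧ ∀ X : M.PreOrd, X.IsWellOrder → IsWellFounded (T.DMem X) (T.DLt X)

/-- The set `μ` of triples `(n, (m, σ))` with `μ_n(m) = σ` is a natural family of embeddings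
`μ_n : n → T(n)` such that `σ < μ_n(m)` in `T(n)` is equivalent to `supp_n(σ) ⊆ {0, …, m - 1}`. -/
structure IsNormal (μ : Set M.Num) : Prop where
  mu_fun : ∀ n m, m < n → ∃! σ, pair n (pair m σ) ∈ μ
  mu_mem : ∀ n m σ, m < n → pair n (pair m σ) ∈ μ → T.Mem n σ
  mu_lt : ∀ n m m' σ σ', m < m' → m' < n → pair n (pair m σ) ∈ μ → pair n (pair m' σ') ∈ μ →
    T.Lt n σ σ'
  mu_natural : ∀ m n f, IsMor f m n → ∀ i j σ τ, i < m → Entry f i j →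
    pair m (pair i σ) ∈ μ → pair n (pair j τ) ∈ μ → T.Map m n f σ τ
  normal : ∀ n m τ, m < n → pair n (pair m τ) ∈ μ → ∀ σ a, T.Mem n σ → T.Supp n σ a →
    (T.Lt n σ τ ↔ ∀ i, Elem i a → i < m)

/-- `X` and the set `ξ` of pairs form a fixed point of `T`: `X` is a linear order, and `ξ` is (the
graph of) an embedding of `D^T(X)` into `X`. -/
structure IsFixedPoint (X : M.PreOrd) (ξ : Set M.Num) : Prop where
  linear : X.IsLinear
  fun_ : ∀ p, T.DMem X p → ∃! x, pair p x ∈ ξ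
  mem : ∀ p x, T.DMem X p → pair p x ∈ ξ → X.Mem x
  lt : ∀ p q x y, T.DMem X p → T.DMem X q → pair p x ∈ ξ → pair q y ∈ ξ →
    T.DLt X p q → X.Lt x y

end PraeDilatorData

/-- `M` satisfies the principle that every (coded) normal dilator has a well-founded fixed point. -/
def NormalDilatorsHaveFixedPoints : Prop :=
  ∀ (T : M.PraeDilatorData), ∀ μ ∈ M.sets, T.IsDilator → T.IsNormal μ →
    ∃ X : M.PreOrd, ∃ ξ ∈ M.sets, T.IsFixedPoint X ξ ∧ IsWellFounded X.Mem X.Lt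

end L2Structure

/-! By the Kleene normal form, a Π¹₁-formula φ(n) says that a tree T_n, arithmetical uniformly in n,
has no infinite branch. After a shift of indices T_0 has only its root, and the premises of
induction say that T_{d+1} has no branch whenever T_d has none (`NoPath`). Since `NoPath` is Π¹₁,
the induction of ACA₀ does not apply to it. It does apply once absence of branches is witnessed by
rank functions into one well-order that are arithmetical uniformly in n. The fixed point supplies
this well-order.

The dilator sends a linear order L to a least element 0 together with the nodes (g, c, s). Here g ∈
L is a base point, c is an index, and s is a finite sequence of pairs (x_i, y_i) with all y_i ∈ L
below g. The x_i form a sequence in T_c. If c = d + 1, the y_i form a partial rank function for T_d,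
where the position i is read as the code of a sequence. Nodes are compared by g, then by c, then by
the Kleene-Brouwer order. As all elements of L that occur in a node are at most g, and as T_0 is
trivial, the nodes (g, 0, ⟨⟩) make the dilator normal (`tLt_bot_iff`).

Let L be a well-order. A nonempty set without minimal element yields an infinite branch over some
index (`Spec.wfOn_TLt`, by way of `exists_branch`). For index d + 1 this is an infinite branch of
T_{d+1} together with a full rank function of T_d into L. The rank function excludes branches of
T_d, so the induction step excludes those of T_{d+1}, a contradiction (`not_isBranch`). Hence the
premises of the induction make this a dilator.

Let ξ now be an embedding of the dilator over a well-founded L into L (`exists_collapse`). Given a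
rank function r_n of T_n with values below b_n, put r_{n+1}(s) = ξ(b_n, n + 1, ⟨(s_i, r_n(i)) : i <
|s|⟩) for s ∈ T_{n+1}. Proper extensions are smaller in the Kleene-Brouwer order, so r_{n+1} is a
rank function. The value at s depends on r_n only at arguments i < s, so the recursion runs on
finite tables and all r_n are arithmetical uniformly in n. Arithmetical induction then shows that
each r_n is a rank function (`RankBelow`), and no T_n has a branch because L is well-founded. -/

set_option linter.unusedSectionVars false

namespace L2Structure

variable {M : L2Structure.{u}}

/-! ## Arithmetical predicates and functions -/

/-- Prepend a value to an assignment. -/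
def cons (a : M.Num) (v : ℕ → M.Num) : ℕ → M.Num
  | 0 => a
  | i + 1 => v i

/-- Drop the first value of an assignment. -/
def tail (v : ℕ → M.Num) : ℕ → M.Num := fun i => v (i + 1)

/-- Predicates on assignments that are definable by arithmetical formulas with set parameters
from `M`. -/
inductive ArP (M : L2Structure.{u}) : ((ℕ → M.Num) → Prop) → Prop
  | eq (s t : L2Term) : ArP M (fun v => M.termVal v s = M.termVal v t)
  | lt (s t : L2Term) : ArP M (fun v => M.termVal v s < M.termVal v t)
  | mem (t : L2Term) (A : M.sets) : ArP M (fun v => M.termVal v t ∈ (A : Set M.Num))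
  | neg {P} : ArP M P → ArP M (fun v => ¬ P v)
  | and {P Q} : ArP M P → ArP M Q → ArP M (fun v => P v ∧ Q v)
  | ex {P} : ArP M P → ArP M (fun v => ∃ a, P (cons a v))

/-- Renaming of the variables of a term. -/
def renameTerm (ρ : ℕ → ℕ) : L2Term → L2Term
  | .var i => .var (ρ i)
  | .zero => .zero
  | .one => .one
  | .add s t => .add (renameTerm ρ s) (renameTerm ρ t)
  | .mul s t => .mul (renameTerm ρ s) (renameTerm ρ t)

theorem termVal_renameTerm (ρ : ℕ → ℕ) (v : ℕ → M.Num) (t : L2Term) :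
    M.termVal v (renameTerm ρ t) = M.termVal (fun i => v (ρ i)) t := by
  induction t with
  | var i => rfl
  | zero => rfl
  | one => rfl
  | add s t hs ht => simp only [renameTerm, termVal, hs, ht]
  | mul s t hs ht => simp only [renameTerm, termVal, hs, ht]

theorem exists_termVal_congr (t : L2Term) :
    ∃ N, ∀ v w : ℕ → M.Num, (∀ i < N, v i = w i) → M.termVal v t = M.termVal w t := by
  induction t with
  | var i => exact ⟨i + 1, fun v w h => h i (Nat.lt_succ_self i)⟩
  | zero => exact ⟨0, fun _ _ _ => rfl⟩
  | one => exact ⟨0, fun _ _ _ => rfl⟩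
  | add s t hs ht =>
    obtain ⟨a, ha⟩ := hs
    obtain ⟨b, hb⟩ := ht
    refine ⟨max a b, fun v w h => ?_⟩
    simp only [termVal]
    rw [ha v w fun i hi => h i (lt_max_of_lt_left hi),
      hb v w fun i hi => h i (lt_max_of_lt_right hi)]
  | mul s t hs ht =>
    obtain ⟨a, ha⟩ := hs
    obtain ⟨b, hb⟩ := ht
    refine ⟨max a b, fun v w h => ?_⟩
    simp only [termVal]
    rw [ha v w fun i hi => h i (lt_max_of_lt_left hi),
      hb v w fun i hi => h i (lt_max_of_lt_right hi)]

theorem ArP.congr {P Q : (ℕ → M.Num) → Prop} (hP : ArP M P) (h : ∀ v, Q v ↔ P v) : ArP M Q := by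
  have : Q = P := funext fun v => propext (h v)
  rwa [this]

/-- The lift of a renaming past a bound variable. -/
def liftRen (ρ : ℕ → ℕ) : ℕ → ℕ
  | 0 => 0
  | i + 1 => ρ i + 1

theorem ArP.rename {P : (ℕ → M.Num) → Prop} (hP : ArP M P) :
    ∀ ρ : ℕ → ℕ, ArP M (fun v => P (fun i => v (ρ i))) := by
  induction hP with
  | eq s t =>
    intro ρ
    refine (ArP.eq (renameTerm ρ s) (renameTerm ρ t)).congr fun v => ?_
    rw [termVal_renameTerm, termVal_renameTerm]
  | lt s t =>
    intro ρ
    refine (ArP.lt (renameTerm ρ s) (renameTerm ρ t)).congr fun v => ?_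
    rw [termVal_renameTerm, termVal_renameTerm]
  | mem t A =>
    intro ρ
    refine (ArP.mem (renameTerm ρ t) A).congr fun v => ?_
    rw [termVal_renameTerm]
  | neg _ ih => exact fun ρ => (ih ρ).neg
  | and _ _ ih ih' => exact fun ρ => (ih ρ).and (ih' ρ)
  | @ex P _ ih =>
    intro ρ
    refine (ih (liftRen ρ)).ex.congr fun v => exists_congr fun a => ?_
    have : (fun i => cons a v (liftRen ρ i)) = cons a (fun i => v (ρ i)) := by
      funext i
      cases i <;> rfl
    rw [this]

/-- Bound variables in `ArP` are positional, those of formulas are named. Allowing an arbitrary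
renaming `ρ` lets the quantifier case pick any name for its variable; the bound `N` on the relevant
variables guarantees that a fresh one exists. -/
theorem ArP.exists_formula {P : (ℕ → M.Num) → Prop} (hP : ArP M P) :
    ∃ N, (∀ v w, (∀ i < N, v i = w i) → (P v ↔ P w)) ∧
      ∃ L : List M.sets, ∀ V : ℕ → M.sets, (∀ A ∈ L, ∃ k, V k = A) → ∀ ρ : ℕ → ℕ,
        ∃ φ : L2Formula, φ.Arithmetical ∧ ∀ v, M.Sat φ v V ↔ P (fun i => v (ρ i)) := by
  induction hP with
  | eq s t =>
    obtain ⟨a, ha⟩ := exists_termVal_congr (M := M) s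
    obtain ⟨b, hb⟩ := exists_termVal_congr (M := M) t
    refine ⟨max a b, fun v w h => ?_, [], fun V _ ρ =>
      ⟨.eq (renameTerm ρ s) (renameTerm ρ t), trivial, fun v => ?_⟩⟩
    · beta_reduce
      rw [ha v w fun i hi => h i (lt_max_of_lt_left hi),
        hb v w fun i hi => h i (lt_max_of_lt_right hi)]
    · rw [Sat, termVal_renameTerm, termVal_renameTerm]
  | lt s t =>
    obtain ⟨a, ha⟩ := exists_termVal_congr (M := M) s
    obtain ⟨b, hb⟩ := exists_termVal_congr (M := M) t
    refine ⟨max a b, fun v w h => ?_, [], fun V _ ρ =>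
      ⟨.lt (renameTerm ρ s) (renameTerm ρ t), trivial, fun v => ?_⟩⟩
    · beta_reduce
      rw [ha v w fun i hi => h i (lt_max_of_lt_left hi),
        hb v w fun i hi => h i (lt_max_of_lt_right hi)]
    · rw [Sat, termVal_renameTerm, termVal_renameTerm]
  | mem t A =>
    obtain ⟨a, ha⟩ := exists_termVal_congr (M := M) t
    refine ⟨a, fun v w h => ?_, [A], fun V hV ρ => ?_⟩
    · beta_reduce
      rw [ha v w h]
    · obtain ⟨k, hk⟩ := hV A (List.mem_singleton.2 rfl)
      refine ⟨.mem (renameTerm ρ t) k, trivial, fun v => ?_⟩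
      rw [Sat, termVal_renameTerm, hk]
  | neg _ ih =>
    obtain ⟨N, hN, L, hL⟩ := ih
    refine ⟨N, fun v w h => not_congr (hN v w h), L, fun V hV ρ => ?_⟩
    obtain ⟨φ, hφ, h⟩ := hL V hV ρ
    exact ⟨.neg φ, hφ, fun v => not_congr (h v)⟩
  | and _ _ ih ih' =>
    obtain ⟨N, hN, L, hL⟩ := ih
    obtain ⟨N', hN', L', hL'⟩ := ih'
    refine ⟨max N N', fun v w h => and_congr (hN v w fun i hi => h i (lt_max_of_lt_left hi))
      (hN' v w fun i hi => h i (lt_max_of_lt_right hi)), L ++ L', fun V hV ρ => ?_⟩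
    obtain ⟨φ, hφ, h⟩ := hL V (fun A hA => hV A (List.mem_append_left _ hA)) ρ
    obtain ⟨φ', hφ', h'⟩ := hL' V (fun A hA => hV A (List.mem_append_right _ hA)) ρ
    exact ⟨.and φ φ', ⟨hφ, hφ'⟩, fun v => and_congr (h v) (h' v)⟩
  | @ex P _ ih =>
    obtain ⟨N, hN, L, hL⟩ := ih
    refine ⟨N, fun v w h => exists_congr fun a => hN _ _ fun i hi => ?_, L, fun V hV ρ => ?_⟩
    · cases i with
      | zero => rfl
      | succ i => exact h i (by omega)
    · obtain ⟨k, hk⟩ : ∃ k, ∀ i < N, ρ i ≠ k := by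
        refine ⟨(Finset.range N).sup ρ + 1, fun i hi h => ?_⟩
        have := Finset.le_sup (f := ρ) (Finset.mem_range.2 hi)
        omega
      obtain ⟨φ, hφ, h⟩ := hL V hV (fun i => Nat.casesOn i k ρ)
      refine ⟨.exNum k φ, hφ, fun v => exists_congr fun a => ?_⟩
      rw [h]
      refine hN _ _ fun i hi => ?_
      cases i with
      | zero => exact Function.update_self ..
      | succ i => exact Function.update_of_ne (hk i (by omega)) ..

/-- Types whose elements can depend arithmetically on an assignment. -/
class ArType (M : L2Structure.{u}) (α : Type*) where
  /-- the families of elements that depend arithmetically on an assignment -/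
  plot : ((ℕ → M.Num) → α) → Prop
  rename : ∀ g, plot g → ∀ ρ : ℕ → ℕ, plot (fun v => g (fun i => v (ρ i)))

instance : ArType M Prop where
  plot := ArP M
  rename _ h ρ := h.rename ρ

/-- A family of numbers is judged by its graph: variable 0 carries the value, the remaining
variables carry the assignment. -/
instance : ArType M M.Num where
  plot g := ArP M (fun v => v 0 = g (tail v))
  rename _ h ρ := (h.rename (liftRen ρ)).congr fun _ => Iff.rfl

instance {α β : Type*} [ArType M α] [ArType M β] : ArType M (α × β) where
  plot g := ArType.plot (fun v => (g v).1) ∧ ArType.plot (fun v => (g v).2)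
  rename _ h ρ := ⟨ArType.rename _ h.1 ρ, ArType.rename _ h.2 ρ⟩

/-- Arithmetical predicates and functions. -/
@[fun_prop]
def Arith (M : L2Structure.{u}) {α β : Type*} [ArType M α] [ArType M β] (f : α → β) : Prop :=
  ∀ g : (ℕ → M.Num) → α, ArType.plot g → ArType.plot (fun v => f (g v))

/-- The value is only given by its graph, so it is introduced by an existential quantifier. -/
theorem ArP.subst {Q : M.Num → (ℕ → M.Num) → Prop} (hQ : ArP M (fun w => Q (w 0) (tail w)))
    {g : (ℕ → M.Num) → M.Num} (hg : ArType.plot g) : ArP M (fun v => Q (g v) v) :=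
  (hg.and hQ).ex.congr fun v => by
    show Q (g v) v ↔ ∃ a, a = g v ∧ Q a v
    simp

theorem ArP.subst₃ {R : M.Num → M.Num → M.Num → Prop} (hR : ArP M (fun w => R (w 0) (w 1) (w 2)))
    {g h k : (ℕ → M.Num) → M.Num} (hg : ArType.plot g) (hh : ArType.plot h)
    (hk : ArType.plot k) : ArP M (fun v => R (g v) (h v) (k v)) := by
  refine ArP.subst (Q := fun a v => R a (h v) (k v)) ?_ hg
  refine ArP.subst (Q := fun b w => R (w 0) b (k (tail w))) ?_ (ArType.rename _ hh _)
  refine ArP.subst (Q := fun c u => R (u 1) (u 0) c) ?_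
    (ArType.rename _ (ArType.rename _ hk (· + 1)) (· + 1))
  exact hR.rename fun i => match i with | 0 => 2 | 1 => 1 | 2 => 0 | i + 3 => i + 3

/-! ### Closure properties of arithmetical predicates and functions -/

namespace Arith

variable {α β γ : Type*} [ArType M α] [ArType M β] [ArType M γ]

@[fun_prop] theorem id : Arith M (fun x : α => x) := fun _ h => h

@[fun_prop] theorem comp {f : β → γ} {g : α → β} (hf : Arith M f) (hg : Arith M g) :
    Arith M (fun x => f (g x)) := fun _ h => hf _ (hg _ h)

@[fun_prop] theorem prodMk {f : α → β} {g : α → γ} (hf : Arith M f) (hg : Arith M g) :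
    Arith M (fun x => (f x, g x)) := fun _ h => ⟨hf _ h, hg _ h⟩

@[fun_prop] theorem fst {f : α → β × γ} (hf : Arith M f) : Arith M (fun x => (f x).1) :=
  fun _ h => (hf _ h).1

@[fun_prop] theorem snd {f : α → β × γ} (hf : Arith M f) : Arith M (fun x => (f x).2) :=
  fun _ h => (hf _ h).2

theorem of_iff {P Q : α → Prop} (hP : Arith M P) (h : ∀ x, Q x ↔ P x) : Arith M Q := by
  have : Q = P := funext fun v => propext (h v)
  rwa [this]

@[fun_prop] theorem not {P : α → Prop} (hP : Arith M P) : Arith M (fun x => ¬ P x) :=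
  fun _ h => (hP _ h).neg

@[fun_prop] theorem and {P Q : α → Prop} (hP : Arith M P) (hQ : Arith M Q) :
    Arith M (fun x => P x ∧ Q x) := fun _ h => (hP _ h).and (hQ _ h)

@[fun_prop] theorem or {P Q : α → Prop} (hP : Arith M P) (hQ : Arith M Q) :
    Arith M (fun x => P x ∨ Q x) :=
  (hP.not.and hQ.not).not.of_iff fun _ => or_iff_not_and_not

@[fun_prop] theorem imp {P Q : α → Prop} (hP : Arith M P) (hQ : Arith M Q) :
    Arith M (fun x => P x → Q x) :=
  (hP.not.or hQ).of_iff fun _ => imp_iff_not_or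

@[fun_prop] theorem iff {P Q : α → Prop} (hP : Arith M P) (hQ : Arith M Q) :
    Arith M (fun x => P x ↔ Q x) :=
  ((hP.imp hQ).and (hQ.imp hP)).of_iff fun _ => iff_iff_implies_and_implies

-- The truth value of `P` is decided outside the model, so that a trivially true or a trivially
-- false formula defines it.
@[fun_prop] theorem const_prop (P : Prop) : Arith M (fun _ : α => P) := by
  have h : ArP M fun _ : ℕ → M.Num => True := (ArP.eq .zero .zero).congr fun _ => by simp
  intro g _
  by_cases hP : P
  · exact h.congr fun _ => by simp [hP]
  · exact h.neg.congr fun _ => by simp [hP]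

@[fun_prop] theorem ex {P : α → M.Num → Prop} (hP : Arith M (fun p : α × M.Num => P p.1 p.2)) :
    Arith M (fun x => ∃ y, P x y) := by
  intro g hg
  refine (hP (fun v => (g (tail v), v 0)) ⟨ArType.rename _ hg _, ?_⟩).ex
  exact (ArP.eq (.var 0) (.var 1) :)

@[fun_prop] theorem all {P : α → M.Num → Prop} (hP : Arith M (fun p : α × M.Num => P p.1 p.2)) :
    Arith M (fun x => ∀ y, P x y) :=
  (ex (P := fun x y => ¬ P x y) hP.not).not.of_iff fun _ => by simp

@[fun_prop] theorem eq {f g : α → M.Num} (hf : Arith M f) (hg : Arith M g) :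
    Arith M (fun x => f x = g x) := fun _ h =>
  ArP.subst₃ (R := fun a b _ => a = b) (ArP.eq (.var 0) (.var 1) :) (hf _ h) (hg _ h) (hg _ h)

@[fun_prop] theorem lt {f g : α → M.Num} (hf : Arith M f) (hg : Arith M g) :
    Arith M (fun x => f x < g x) := fun _ h =>
  ArP.subst₃ (R := fun a b _ => a < b) (ArP.lt (.var 0) (.var 1) :) (hf _ h) (hg _ h) (hg _ h)

@[fun_prop] theorem mem {A : Set M.Num} (hA : A ∈ M.sets) {f : α → M.Num} (hf : Arith M f) :
    Arith M (fun x => f x ∈ A) := fun _ h =>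
  ArP.subst (Q := fun a _ => a ∈ A) (ArP.mem (.var 0) ⟨A, hA⟩ :) (hf _ h)

@[fun_prop] theorem existsUnique {P : α → M.Num → Prop}
    (hP : Arith M (fun p : α × M.Num => P p.1 p.2)) : Arith M (fun x => ∃! y, P x y) := by
  unfold ExistsUnique
  have h : Arith M (fun p : (α × M.Num) × M.Num => P p.1.1 p.2) :=
    hP.comp (g := fun p : (α × M.Num) × M.Num => (p.1.1, p.2)) (by fun_prop)
  fun_prop

/-- A function with an arithmetical graph is arithmetical. -/
theorem of_graph {f : α → M.Num} (hf : Arith M (fun p : α × M.Num => p.2 = f p.1)) :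
    Arith M f := fun g hg =>
  hf (fun v => (g (tail v), v 0)) ⟨ArType.rename _ hg _, (ArP.eq (.var 0) (.var 1) :)⟩

@[fun_prop] theorem add {f g : α → M.Num} (hf : Arith M f) (hg : Arith M g) :
    Arith M (fun x => f x + g x) := of_graph <| by
  refine Arith.of_iff (P := fun p : α × M.Num => ∃ a b, a = f p.1 ∧ b = g p.1 ∧ p.2 = a + b) ?_
    fun _ => by simp
  have h : Arith M fun p : ((α × M.Num) × M.Num) × M.Num => p.1.1.2 = p.1.2 + p.2 := fun _ h =>
    ArP.subst₃ (R := fun a b c => a = b + c) (ArP.eq (.var 0) (.add (.var 1) (.var 2)) :)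
      h.1.1.2 h.1.2 h.2
  fun_prop

@[fun_prop] theorem mul {f g : α → M.Num} (hf : Arith M f) (hg : Arith M g) :
    Arith M (fun x => f x * g x) := of_graph <| by
  refine Arith.of_iff (P := fun p : α × M.Num => ∃ a b, a = f p.1 ∧ b = g p.1 ∧ p.2 = a * b) ?_
    fun _ => by simp
  have h : Arith M fun p : ((α × M.Num) × M.Num) × M.Num => p.1.1.2 = p.1.2 * p.2 := fun _ h =>
    ArP.subst₃ (R := fun a b c => a = b * c) (ArP.eq (.var 0) (.mul (.var 1) (.var 2)) :)
      h.1.1.2 h.1.2 h.2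
  fun_prop

end Arith

/-- Models of `ACA₀` that contain at least one set. -/
class ACA (M : L2Structure.{u}) : Prop where
  models : M.ModelsACA0
  nonempty : Nonempty M.sets

/-- Comprehension for arithmetical predicates. -/
theorem Arith.mem_sets [hM : M.ACA] {P : M.Num → Prop} (hP : Arith M P) :
    {a | P a} ∈ M.sets := by
  have h : ArP M fun v => P (v 0) := hP (fun v => v 0) (ArP.eq (.var 0) (.var 1) :)
  obtain ⟨N, -, L, hL⟩ := h.exists_formula
  obtain ⟨A₀⟩ := hM.nonempty
  -- The finitely many set parameters become the values of the first set variables; `A₀` fills the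
  -- others.
  obtain ⟨φ, hφ, hv⟩ := hL (fun k => L.getD k A₀) (fun A hA => by
    obtain ⟨k, hk, rfl⟩ := List.mem_iff_getElem.1 hA
    exact ⟨k, by simp [hk]⟩) _root_.id
  have := hM.models.comprehension φ hφ 0 (fun _ => 0) (fun k => L.getD k A₀)
  simp only [hv] at this
  simpa using this

-- Comprehension with the number parameter `a` makes `{a}` a set of the model, which can then serve
-- as a set parameter.
@[fun_prop] theorem Arith.const_num [hM : M.ACA] {α : Type*} [ArType M α] (a : M.Num) :
    Arith M (fun _ : α => a) := by
  obtain ⟨A₀⟩ := hM.nonempty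
  have h : {b | b = a} ∈ M.sets := by
    have := hM.models.comprehension (.eq (.var 0) (.var 1)) trivial 0 (fun _ => a) (fun _ => A₀)
    simpa [Sat, termVal, Function.update] using this
  exact Arith.of_graph (Arith.mem h (Arith.id.snd))

end L2Structure

namespace L2Structure

variable {M : L2Structure.{u}}

/-! ## Arithmetic in a model of `ACA₀` -/

section

variable [hM : M.ACA]

theorem arith_induction {P : M.Num → Prop} (hP : Arith M P) (h0 : P 0)
    (hs : ∀ n, P n → P (n + 1)) (n : M.Num) : P n :=
  hM.models.induction _ hP.mem_sets h0 hs n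

/-! ### The numbers of the model as an ordered semiring -/

namespace Num

theorem zero_add' (m : M.Num) : 0 + m = m := by
  refine arith_induction (P := fun m => 0 + m = m) (by fun_prop) (hM.models.add_zero 0)
    (fun n h => ?_) m
  rw [hM.models.add_succ, h]

theorem add_assoc' (a b c : M.Num) : a + b + c = a + (b + c) := by
  have one_case : ∀ a b : M.Num, a + b + 1 = a + (b + 1) := fun a b =>
    (hM.models.add_succ a b).symm
  refine arith_induction (P := fun c => a + b + c = a + (b + c)) (by fun_prop) ?_
    (fun n h => ?_) c
  · rw [hM.models.add_zero, hM.models.add_zero]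
  · rw [hM.models.add_succ, h, hM.models.add_succ, hM.models.add_succ]

theorem one_add' (a : M.Num) : 1 + a = a + 1 := by
  refine arith_induction (P := fun a => 1 + a = a + 1) (by fun_prop) ?_ (fun n h => ?_) a
  · rw [hM.models.add_zero, zero_add']
  · rw [hM.models.add_succ, h]

theorem add_comm' (a b : M.Num) : a + b = b + a := by
  refine arith_induction (P := fun b => a + b = b + a) (by fun_prop) ?_ (fun n h => ?_) b
  · rw [hM.models.add_zero, zero_add']
  · rw [hM.models.add_succ, h, add_assoc', add_assoc', one_add']

theorem zero_mul' (a : M.Num) : 0 * a = 0 := by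
  refine arith_induction (P := fun a => 0 * a = 0) (by fun_prop) (hM.models.mul_zero 0)
    (fun n h => ?_) a
  rw [hM.models.mul_succ, h, hM.models.add_zero]

theorem succ_mul' (a b : M.Num) : (a + 1) * b = a * b + b := by
  refine arith_induction (P := fun b => (a + 1) * b = a * b + b) (by fun_prop) ?_
    (fun n h => ?_) b
  · rw [hM.models.mul_zero, hM.models.mul_zero, hM.models.add_zero]
  · rw [hM.models.mul_succ, h, hM.models.mul_succ, add_assoc', add_assoc',
      ← add_assoc' n, ← add_assoc' a, add_comm' n a, add_assoc']

theorem mul_comm' (a b : M.Num) : a * b = b * a := by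
  refine arith_induction (P := fun b => a * b = b * a) (by fun_prop) ?_ (fun n h => ?_) b
  · rw [hM.models.mul_zero, zero_mul']
  · rw [hM.models.mul_succ, h, succ_mul']

theorem mul_add' (a b c : M.Num) : a * (b + c) = a * b + a * c := by
  refine arith_induction (P := fun c => a * (b + c) = a * b + a * c) (by fun_prop) ?_
    (fun n h => ?_) c
  · rw [hM.models.mul_zero, hM.models.add_zero, hM.models.add_zero]
  · rw [hM.models.add_succ, hM.models.mul_succ, h, hM.models.mul_succ, add_assoc']

theorem mul_assoc' (a b c : M.Num) : a * b * c = a * (b * c) := by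
  refine arith_induction (P := fun c => a * b * c = a * (b * c)) (by fun_prop) ?_
    (fun n h => ?_) c
  · rw [hM.models.mul_zero, hM.models.mul_zero, hM.models.mul_zero]
  · rw [hM.models.mul_succ, h, hM.models.mul_succ, mul_add']

instance : CommSemiring M.Num where
  add_assoc := add_assoc'
  zero_add := zero_add'
  add_zero := hM.models.add_zero
  add_comm := add_comm'
  nsmul := nsmulRec
  left_distrib := mul_add'
  right_distrib a b c := by rw [mul_comm', mul_add', mul_comm' c, mul_comm' c]
  zero_mul := zero_mul'
  mul_zero := hM.models.mul_zero
  mul_assoc := mul_assoc'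
  one_mul a := by rw [← zero_add' 1, succ_mul', zero_mul', zero_add']
  mul_one a := by rw [← zero_add' 1, hM.models.mul_succ, hM.models.mul_zero, zero_add']
  mul_comm := mul_comm'

instance : IsCancelAdd M.Num :=
  have : IsLeftCancelAdd M.Num := ⟨fun a b c h => by
    revert h
    refine arith_induction (P := fun a => a + b = a + c → b = c) (by fun_prop) ?_
      (fun n h h' => ?_) a
    · simp
    · refine h (hM.models.succ_inj _ _ ?_)
      rw [add_right_comm, h', add_right_comm]⟩
  { toIsRightCancelAdd := AddCommMagma.IsLeftCancelAdd.toIsRightCancelAdd _ }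

theorem eq_zero_or_exists_succ (a : M.Num) : a = 0 ∨ ∃ b, a = b + 1 :=
  arith_induction (P := fun a => a = 0 ∨ ∃ b, a = b + 1) (by fun_prop) (.inl rfl)
    (fun n _ => .inr ⟨n, rfl⟩) a

theorem lt_iff_exists (a b : M.Num) : a < b ↔ ∃ c, b = a + c + 1 := by
  refine arith_induction (P := fun b => a < b ↔ ∃ c, b = a + c + 1) (by fun_prop) ?_
    (fun n h => ?_) b
  · refine iff_of_false (hM.models.not_lt_zero a) fun ⟨c, hc⟩ => hM.models.succ_ne_zero _ hc.symm
  · rw [hM.models.lt_succ, h]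
    constructor
    · rintro (⟨c, rfl⟩ | rfl)
      · exact ⟨c + 1, by ring⟩
      · exact ⟨0, by ring⟩
    · rintro ⟨c, hc⟩
      obtain rfl := hM.models.succ_inj _ _ hc
      obtain rfl | ⟨d, rfl⟩ := eq_zero_or_exists_succ c
      · exact .inr (by ring)
      · exact .inl ⟨d, by ring⟩

/-- The order `≤` is the existence of a difference, while `<` remains the relation of the structure;
`lt_iff_exists` reconciles the two. -/
noncomputable instance : LinearOrder M.Num where
  le a b := ∃ c, b = a + c
  le_refl a := ⟨0, by ring⟩
  le_trans a b c := by
    rintro ⟨d, rfl⟩ ⟨e, rfl⟩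
    exact ⟨d + e, by ring⟩
  lt_iff_le_not_ge a b := by
    rw [lt_iff_exists]
    constructor
    · rintro ⟨c, rfl⟩
      refine ⟨⟨c + 1, by ring⟩, fun ⟨d, hd⟩ => hM.models.succ_ne_zero (c + d) ?_⟩
      refine (add_left_cancel (a := a) ?_).symm
      linear_combination hd
    · rintro ⟨⟨c, rfl⟩, h⟩
      obtain rfl | ⟨d, rfl⟩ := eq_zero_or_exists_succ c
      · exact absurd ⟨0, by ring⟩ h
      · exact ⟨d, by ring⟩
  le_antisymm a b := by
    rintro ⟨c, rfl⟩ ⟨d, hd⟩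
    obtain rfl | ⟨e, rfl⟩ := eq_zero_or_exists_succ c
    · ring
    · refine absurd ?_ (hM.models.succ_ne_zero (e + d))
      refine (add_left_cancel (a := a) ?_).symm
      linear_combination hd
  le_total a b := by
    refine arith_induction (P := fun a => (∃ c, b = a + c) ∨ ∃ c, a = b + c) (by fun_prop) ?_
      (fun n h => ?_) a
    · exact .inl ⟨b, by ring⟩
    · rcases h with ⟨c, rfl⟩ | ⟨c, rfl⟩
      · obtain rfl | ⟨e, rfl⟩ := eq_zero_or_exists_succ c
        · exact .inr ⟨1, by ring⟩
        · exact .inl ⟨e, by ring⟩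
      · exact .inr ⟨c + 1, by ring⟩
  toDecidableLE := Classical.decRel _

theorem le_iff_exists (a b : M.Num) : a ≤ b ↔ ∃ c, b = a + c := Iff.rfl

theorem lt_add_one_iff {a b : M.Num} : a < b + 1 ↔ a ≤ b := by
  rw [hM.models.lt_succ, le_iff_lt_or_eq]

theorem lt_add_one (a : M.Num) : a < a + 1 := lt_add_one_iff.2 le_rfl

theorem add_one_le_iff {a b : M.Num} : a + 1 ≤ b ↔ a < b := by
  rw [lt_iff_exists, le_iff_exists]
  exact exists_congr fun c => by rw [add_right_comm]

instance : IsOrderedCancelAddMonoid M.Num where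
  add_le_add_left a b h c := by
    obtain ⟨d, rfl⟩ := h
    exact ⟨d, by ring⟩
  le_of_add_le_add_left a b c h := by
    obtain ⟨d, hd⟩ := h
    exact ⟨d, add_left_cancel (a := a) (by rw [hd, add_assoc])⟩

instance : CanonicallyOrderedAdd M.Num where
  exists_add_of_le h := h
  le_add_self _ b := ⟨b, add_comm _ _⟩
  le_self_add _ b := ⟨b, rfl⟩

instance : Nontrivial M.Num := ⟨1, 0, by simpa using hM.models.succ_ne_zero 0⟩

instance : IsStrictOrderedRing M.Num := by
  have key : ∀ a b c : M.Num, 0 < a → b < c → a * b < a * c := fun a b c ha hb => by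
    obtain ⟨d, rfl⟩ := (lt_iff_exists _ _).1 ha
    obtain ⟨e, rfl⟩ := (lt_iff_exists _ _).1 hb
    exact (lt_iff_exists _ _).2 ⟨d * e + d + e, by ring⟩
  exact { zero_le_one := zero_le
          mul_lt_mul_of_pos_left := fun a ha b c h => key a b c ha h
          mul_lt_mul_of_pos_right := fun a ha b c h => by
            rw [mul_comm b, mul_comm c]
            exact key a b c ha h }

end Num

@[fun_prop] theorem Arith.le {α : Type*} [ArType M α] {f g : α → M.Num} (hf : Arith M f)
    (hg : Arith M g) : Arith M (fun x => f x ≤ g x) :=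
  Arith.of_iff (P := fun x => ∃ c, g x = f x + c) (by fun_prop) fun _ => Iff.rfl

theorem arith_strong_induction {P : M.Num → Prop} (hP : Arith M P)
    (h : ∀ n, (∀ m < n, P m) → P n) (n : M.Num) : P n := by
  suffices ∀ m < n + 1, P m from this n (Num.lt_add_one n)
  refine arith_induction (P := fun n => ∀ m < n, P m) (by fun_prop) ?_ (fun n ih m hm => ?_) _
  · exact fun m hm => absurd hm (hM.models.not_lt_zero m)
  · exact h m fun k hk => ih k (hk.trans_le (Num.lt_add_one_iff.1 hm))

theorem exists_least {P : M.Num → Prop} (hP : Arith M P) (h : ∃ n, P n) :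
    ∃ n, P n ∧ ∀ m < n, ¬ P m := by
  by_contra! hcon
  obtain ⟨n, hn⟩ := h
  refine arith_strong_induction (P := fun n => ¬ P n) (by fun_prop) (fun n ih hPn => ?_) n hn
  obtain ⟨m, hm, hPm⟩ := hcon n hPn
  exact ih m hm hPm

open Classical in
/-- The least number with a given property, and `0` if there is none. -/
noncomputable def mu (P : M.Num → Prop) : M.Num :=
  if h : ∃ n, P n ∧ ∀ m < n, ¬ P m then h.choose else 0

theorem mu_spec {P : M.Num → Prop} (hP : Arith M P) (h : ∃ n, P n) : P (mu P) := by
  have := exists_least hP h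
  rw [mu, dif_pos this]
  exact this.choose_spec.1

theorem mu_eq {P : M.Num → Prop} {n : M.Num} (h : P n) (hu : ∀ m, P m → m = n) : mu P = n := by
  have : ∃ n, P n ∧ ∀ m < n, ¬ P m := ⟨n, h, fun m hm hPm => hm.ne (hu m hPm)⟩
  rw [mu, dif_pos this]
  exact hu _ this.choose_spec.1

theorem mu_eq_zero {P : M.Num → Prop} (h : ∀ n, ¬ P n) : mu P = 0 := by
  rw [mu, dif_neg]
  rintro ⟨n, hn, -⟩
  exact h n hn

/-- Both alternatives are arithmetical in `P`, hence so is the graph of `mu`. The second one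
accounts for the default value. -/
theorem eq_mu_iff (P : M.Num → Prop) (y : M.Num) :
    y = mu P ↔ (P y ∧ ∀ m < y, ¬ P m) ∨ ((¬ ∃ n, P n ∧ ∀ m < n, ¬ P m) ∧ y = 0) := by
  by_cases h : ∃ n, P n ∧ ∀ m < n, ¬ P m
  · rw [mu, dif_pos h]
    constructor
    · rintro rfl
      exact .inl h.choose_spec
    · rintro (⟨h1, h2⟩ | ⟨h1, -⟩)
      · have h3 := h.choose_spec
        exact le_antisymm (not_lt.1 fun hlt => h2 _ hlt h3.1) (not_lt.1 fun hlt => h3.2 _ hlt h1)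
      · exact absurd h h1
  · rw [mu, dif_neg h]
    exact ⟨fun hy => .inr ⟨h, hy⟩, fun hy => hy.elim (fun h' => absurd ⟨y, h'⟩ h) fun h' => h'.2⟩

@[fun_prop] theorem Arith.mu {α : Type*} [ArType M α] {P : α → M.Num → Prop}
    (hP : Arith M (fun p : α × M.Num => P p.1 p.2)) : Arith M (fun x => mu (P x)) := by
  refine Arith.of_graph (Arith.of_iff ?_ fun p => eq_mu_iff (P p.1) p.2)
  have h : ∀ {β : Type _} [ArType M β] {f : β → α} {g : β → M.Num}, Arith M f → Arith M g →
    Arith M fun x => P (f x) (g x) := fun hf hg => hP.comp (hf.prodMk hg)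
  have h1 : Arith M fun p : α × M.Num => ∃ n, P p.1 n ∧ ∀ m < n, ¬ P p.1 m := by fun_prop
  fun_prop

@[fun_prop] theorem Arith.ite {α : Type*} [ArType M α] {P : α → Prop} [∀ x, Decidable (P x)] {f g : α → M.Num}
    (hP : Arith M P) (hf : Arith M f) (hg : Arith M g) :
    Arith M (fun x => if P x then f x else g x) := by
  refine Arith.of_graph (Arith.of_iff (P := fun p : α × M.Num =>
    (P p.1 ∧ p.2 = f p.1) ∨ (¬ P p.1 ∧ p.2 = g p.1)) (by fun_prop) fun p => ?_)
  by_cases h : P p.1 <;> simp [h]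

/-! ### Pairs -/

@[fun_prop] theorem Arith.pair {α : Type*} [ArType M α] {f g : α → M.Num}
    (hf : Arith M f) (hg : Arith M g) : Arith M (fun x => pair (f x) (g x)) := by
  unfold L2Structure.pair
  fun_prop

theorem pair_lt_sq (i j : M.Num) : pair i j < (i + j + 1) * (i + j + 1) := by
  rw [Num.lt_iff_exists]
  exact ⟨i + j + j, by unfold pair; ring⟩

theorem sq_le_pair (i j : M.Num) : (i + j) * (i + j) ≤ pair i j := le_self_add

/-- The pair lies between the consecutive squares of `i + j` and `i + j + 1`, which determines `i +
j`, and then `i`. -/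
theorem pair_inj {i j i' j' : M.Num} : pair i j = pair i' j' ↔ i = i' ∧ j = j' := by
  refine ⟨fun h => ?_, by rintro ⟨rfl, rfl⟩; rfl⟩
  have key : ∀ {i j i' j' : M.Num}, pair i j = pair i' j' → i' + j' ≤ i + j := by
    intro i j i' j' h
    by_contra! hlt
    have h1 := Num.add_one_le_iff.2 hlt
    exact absurd ((mul_le_mul' h1 h1).trans (sq_le_pair i' j'))
      (h ▸ pair_lt_sq i j).not_ge
  have hs : i + j = i' + j' := le_antisymm (key h.symm) (key h)
  have hi : i = i' := by
    unfold pair at h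
    rw [hs] at h
    exact add_left_cancel h
  subst hi
  exact ⟨rfl, add_left_cancel hs⟩

theorem left_le_pair (i j : M.Num) : i ≤ pair i j := le_add_self

/-- The first component of a pair. -/
noncomputable def pfst (x : M.Num) : M.Num := mu fun i => ∃ j, x = pair i j

/-- The second component of a pair. -/
noncomputable def psnd (x : M.Num) : M.Num := mu fun j => ∃ i, x = pair i j

@[simp] theorem pfst_pair (i j : M.Num) : pfst (pair i j) = i :=
  mu_eq ⟨j, rfl⟩ fun _ ⟨_, h⟩ => (pair_inj.1 h).1.symm

@[simp] theorem psnd_pair (i j : M.Num) : psnd (pair i j) = j :=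
  mu_eq ⟨i, rfl⟩ fun _ ⟨_, h⟩ => (pair_inj.1 h).2.symm

@[fun_prop] theorem Arith.pfst {α : Type*} [ArType M α] {f : α → M.Num}
    (hf : Arith M f) : Arith M (fun x => pfst (f x)) := by
  unfold L2Structure.pfst
  fun_prop

@[fun_prop] theorem Arith.psnd {α : Type*} [ArType M α] {f : α → M.Num}
    (hf : Arith M f) : Arith M (fun x => psnd (f x)) := by
  unfold L2Structure.psnd
  fun_prop

end

end L2Structure

namespace L2Structure

variable {M : L2Structure.{u}}

/-! ### Finite sets -/

section

variable [hM : M.ACA]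

theorem mu_min {P : M.Num → Prop} {m : M.Num} (h : m < mu P) : ¬ P m := by
  by_cases hP : ∃ n, P n ∧ ∀ m < n, ¬ P m
  · rw [mu, dif_pos hP] at h
    exact hP.choose_spec.2 m h
  · rw [mu, dif_neg hP] at h
    exact absurd h (hM.models.not_lt_zero m)

theorem Num.not_lt_zero (m : M.Num) : ¬ m < 0 := hM.models.not_lt_zero m

@[fun_prop] theorem Arith.dvd {α : Type*} [ArType M α] {f g : α → M.Num} (hf : Arith M f)
    (hg : Arith M g) : Arith M (fun x => f x ∣ g x) :=
  Arith.of_iff (P := fun x => ∃ c, g x = f x * c) (by fun_prop) fun _ => Iff.rfl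

theorem Num.dvd_of_dvd_add {a b c : M.Num} (h : a ∣ b + c) (hb : a ∣ b) : a ∣ c := by
  obtain ⟨x, rfl⟩ := hb
  obtain ⟨y, hy⟩ := h
  obtain rfl | ha := eq_or_ne a 0
  · simp_all
  · have hxy : x ≤ y := le_of_mul_le_mul_left (hy ▸ le_self_add) (pos_iff_ne_zero.2 ha)
    obtain ⟨z, rfl⟩ := hxy
    exact ⟨z, add_left_cancel (a := a * x) (by rw [hy, mul_add])⟩

/-- The modulus is coprime to `m`, as witnessed by `X * (m * (j + 1) + 1) = X * m * (j + 1) + X`. -/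
theorem dvd_of_dvd_mul_modulus {m j X : M.Num} (h : m * (j + 1) + 1 ∣ X * m) :
    m * (j + 1) + 1 ∣ X := by
  refine Num.dvd_of_dvd_add (b := X * m * (j + 1)) ?_ (h.mul_right _)
  exact ⟨X, by ring⟩

/-- This replaces coprimality of the moduli of the β-function. Modulo `m * (j + 1) + 1`, the product
`b * (m * (k + 1) + 1)` agrees up to sign with `b * m * (d + 1)`, where `d + 1` is the distance of
`j` and `k`. As `d + 1` divides `m`, the modulus divides `b * m * m`, and both factors `m` can be
cancelled. -/
theorem dvd_of_dvd_mul_modulus_coprime {m j k b : M.Num}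
    (hd : ∀ d, j ≠ k → (j = k + d + 1 ∨ k = j + d + 1) → d + 1 ∣ m) (hjk : j ≠ k)
    (h : m * (j + 1) + 1 ∣ b * (m * (k + 1) + 1)) : m * (j + 1) + 1 ∣ b := by
  obtain ⟨d, hd', h1⟩ : ∃ d, d + 1 ∣ m ∧ m * (j + 1) + 1 ∣ b * m * (d + 1) := by
    rcases lt_or_gt_of_ne hjk with hlt | hlt
    · obtain ⟨d, rfl⟩ := (Num.lt_iff_exists _ _).1 hlt
      refine ⟨d, hd d hjk (.inr rfl), ?_⟩
      refine Num.dvd_of_dvd_add (b := b * (m * (j + 1) + 1)) ?_ (Dvd.intro_left _ rfl)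
      convert h using 1
      ring
    · obtain ⟨d, rfl⟩ := (Num.lt_iff_exists _ _).1 hlt
      refine ⟨d, hd d hjk (.inl rfl), Num.dvd_of_dvd_add (b := b * (m * (k + 1) + 1)) ?_ h⟩
      exact ⟨b, by ring⟩
  obtain ⟨m', hm'⟩ := hd'
  refine dvd_of_dvd_mul_modulus (dvd_of_dvd_mul_modulus ?_)
  have : b * m * m = b * m * (d + 1) * m' := by
    conv_lhs => rw [mul_assoc, hm']
    conv_rhs => rw [hm']
    ring
  rw [this]
  exact h1.mul_right _

/-- A substitute for the factorial, obtained before any recursion is available. -/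
theorem exists_common_multiple (K : M.Num) : ∃ m, 0 < m ∧ ∀ d, d < K → d + 1 ∣ m := by
  refine arith_induction (P := fun K => ∃ m, 0 < m ∧ ∀ d, d < K → d + 1 ∣ m) (by fun_prop)
    ⟨1, zero_lt_one, fun d hd => absurd hd (Num.not_lt_zero d)⟩ (fun K ih => ?_) K
  obtain ⟨m, hm, h⟩ := ih
  refine ⟨m * (K + 1), mul_pos hm (Num.lt_add_one_iff.2 zero_le), fun d hd => ?_⟩
  rcases (Num.lt_add_one_iff.1 hd).lt_or_eq with hd | rfl
  · exact (h d hd).mul_right _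
  · exact Dvd.intro_left _ rfl

@[fun_prop] theorem Arith.elem {α : Type*} [ArType M α] {f g : α → M.Num} (hf : Arith M f)
    (hg : Arith M g) : Arith M (fun x => Elem (f x) (g x)) := by
  unfold Elem
  fun_prop

@[fun_prop] theorem Arith.isFin {α : Type*} [ArType M α] {f : α → M.Num} (hf : Arith M f) :
    Arith M (fun x => IsFin (f x)) := by
  unfold IsFin
  fun_prop

theorem elem_pair {i k m n : M.Num} :
    Elem i (pair k (pair m n)) ↔ i < k ∧ m * (i + 1) + 1 ∣ n := by
  constructor
  · rintro ⟨k', m', n', h, hi, hq⟩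
    obtain ⟨h1, h⟩ := pair_inj.1 h
    obtain ⟨h2, h3⟩ := pair_inj.1 h
    subst h1 h2 h3
    exact ⟨hi, hq⟩
  · rintro ⟨hi, hq⟩
    exact ⟨k, m, n, rfl, hi, hq⟩

theorem Elem.lt {i c : M.Num} (h : Elem i c) : i < c := by
  obtain ⟨k, m, n, rfl, hi, -⟩ := h
  exact hi.trans_le (left_le_pair _ _)

/-- The number `n` is built as the product of the moduli `m * (j + 1) + 1` over all `j < K` with `P
j`. The auxiliary claim by induction on `k` treats the factors with `j < k`. -/
theorem exists_code {P : M.Num → Prop} (hP : Arith M P) (K : M.Num) :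
    ∃ c, ∀ i, Elem i c ↔ i < K ∧ P i := by
  obtain ⟨m, hm0, hm⟩ := exists_common_multiple K
  suffices ∀ k, k ≤ K → ∃ n, ∀ j < K, (m * (j + 1) + 1 ∣ n ↔ j < k ∧ P j) by
    obtain ⟨n, hn⟩ := this K le_rfl
    refine ⟨pair K (pair m n), fun i => elem_pair.trans ?_⟩
    constructor
    · exact fun h => (hn i h.1).1 h.2
    · exact fun h => ⟨h.1, (hn i h.1).2 h⟩
  intro k
  refine arith_induction
    (P := fun k => k ≤ K → ∃ n, ∀ j < K, (m * (j + 1) + 1 ∣ n ↔ j < k ∧ P j)) (by fun_prop)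
    (fun _ => ⟨1, fun j _ => ⟨fun h => ?_, fun h => absurd h.1 (Num.not_lt_zero j)⟩⟩)
    (fun k ih hk => ?_) k
  -- No modulus divides the empty product 1, because `m` is positive.
  · obtain ⟨q, hq⟩ := h
    obtain rfl | ⟨r, rfl⟩ := Num.eq_zero_or_exists_succ q
    · simp at hq
    · obtain ⟨e, rfl⟩ := (Num.lt_iff_exists _ _).1 hm0
      refine absurd ?_ (hM.models.succ_ne_zero
        ((0 + e) * (j + 1) + j + ((0 + e + 1) * (j + 1) + 1) * r))
      refine (add_left_cancel (a := 1) ?_).symm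
      rw [add_zero]
      exact hq.trans (by ring)
  · obtain ⟨n, hn⟩ := ih ((Num.lt_add_one k).le.trans hk)
    by_cases hPk : P k
    · refine ⟨n * (m * (k + 1) + 1), fun j hj => ?_⟩
      obtain rfl | hjk := eq_or_ne j k
      · simp [hPk]
      · have h1 : j < k + 1 ↔ j < k := by rw [Num.lt_add_one_iff, le_iff_lt_or_eq]; tauto
        rw [h1, ← hn j hj]
        refine ⟨dvd_of_dvd_mul_modulus_coprime (fun d _ hd => hm d ?_) hjk, fun h => h.mul_right _⟩
        have hk' := Num.add_one_le_iff.1 hk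
        have h2 : ∀ a : M.Num, d < a + d + 1 := fun a => Num.lt_add_one_iff.2 le_add_self
        rcases hd with hd | hd
        · exact (h2 k).trans (hd ▸ hj)
        · exact (h2 j).trans (hd ▸ hk')
    · refine ⟨n, fun j hj => (hn j hj).trans ?_⟩
      rw [Num.lt_add_one_iff, le_iff_lt_or_eq]
      constructor
      · exact fun h => ⟨.inl h.1, h.2⟩
      · rintro ⟨h | rfl, h'⟩
        · exact ⟨h, h'⟩
        · exact absurd h' hPk

theorem IsFin.ext {c d : M.Num} (hc : IsFin c) (hd : IsFin d) (h : ∀ i, Elem i c ↔ Elem i d) :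
    c = d :=
  le_antisymm (not_lt.1 fun hlt => hc d hlt h)
    (not_lt.1 fun hlt => hd c hlt fun i => (h i).symm)

/-- The code of the finite set of all numbers with a given property. -/
noncomputable def mkFin (P : M.Num → Prop) : M.Num := mu fun c => ∀ i, Elem i c ↔ P i

@[fun_prop] theorem Arith.mkFin {α : Type*} [ArType M α] {P : α → M.Num → Prop}
    (hP : Arith M (fun p : α × M.Num => P p.1 p.2)) : Arith M (fun x => mkFin (P x)) := by
  unfold L2Structure.mkFin
  have h : ∀ {β : Type _} [ArType M β] {f : β → α} {g : β → M.Num}, Arith M f → Arith M g →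
    Arith M fun x => P (f x) (g x) := fun hf hg => hP.comp (hf.prodMk hg)
  have h1 : Arith M fun p : (α × M.Num) × M.Num => P p.1.1 p.2 := h (by fun_prop) (by fun_prop)
  fun_prop

theorem elem_mkFin {P : M.Num → Prop} (hP : Arith M P) {K : M.Num} (hK : ∀ i, P i → i < K)
    (i : M.Num) : Elem i (mkFin P) ↔ P i := by
  obtain ⟨c, hc⟩ := exists_code hP K
  exact mu_spec (P := fun c => ∀ i, Elem i c ↔ P i) (by fun_prop)
    ⟨c, fun i => (hc i).trans ⟨fun h => h.2, fun h => ⟨hK i h, h⟩⟩⟩ i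

theorem isFin_mkFin {P : M.Num → Prop} (hP : Arith M P) {K : M.Num} (hK : ∀ i, P i → i < K) :
    IsFin (mkFin P) := fun _ hd h =>
  mu_min hd fun i => (h i).symm.trans (elem_mkFin hP hK i)

/-! ### Finite sequences -/

@[fun_prop] theorem Arith.entry {α : Type*} [ArType M α] {f g h : α → M.Num} (hf : Arith M f)
    (hg : Arith M g) (hh : Arith M h) : Arith M (fun x => Entry (f x) (g x) (h x)) := by
  unfold Entry
  fun_prop

@[fun_prop] theorem Arith.isSeq {α : Type*} [ArType M α] {f g : α → M.Num} (hf : Arith M f)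
    (hg : Arith M g) : Arith M (fun x => IsSeq (f x) (g x)) := by
  unfold IsSeq
  fun_prop

/-- The entry of a sequence at a given position, and `0` if there is none. -/
noncomputable def get (s i : M.Num) : M.Num := mu fun j => Entry s i j

@[fun_prop] theorem Arith.get {α : Type*} [ArType M α] {f g : α → M.Num} (hf : Arith M f)
    (hg : Arith M g) : Arith M (fun x => get (f x) (g x)) := by
  unfold L2Structure.get
  fun_prop

/-- The length of a sequence. -/
noncomputable def len (s : M.Num) : M.Num := mu fun l => IsSeq s l

@[fun_prop] theorem Arith.len {α : Type*} [ArType M α] {f : α → M.Num} (hf : Arith M f) :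
    Arith M (fun x => len (f x)) := by
  unfold L2Structure.len
  fun_prop

/-- The code of the sequence of the first `l` values of a function. -/
noncomputable def mkSeq (F : M.Num → M.Num) (l : M.Num) : M.Num :=
  mkFin fun p => ∃ i, i < l ∧ p = pair i (F i)

@[fun_prop] theorem Arith.mkSeq {α : Type*} [ArType M α] {F : α → M.Num → M.Num} {f : α → M.Num}
    (hF : Arith M (fun p : α × M.Num => F p.1 p.2)) (hf : Arith M f) :
    Arith M (fun x => mkSeq (F x) (f x)) := by
  unfold L2Structure.mkSeq
  have h : ∀ {β : Type _} [ArType M β] {f : β → α} {g : β → M.Num}, Arith M f → Arith M g →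
    Arith M fun x => F (f x) (g x) := fun hf hg => hF.comp (hf.prodMk hg)
  have h1 : Arith M fun p : (α × M.Num) × M.Num => F p.1.1 p.2 := h (by fun_prop) (by fun_prop)
  fun_prop

namespace IsSeq

variable {s t l l' i j : M.Num}

theorem lt_of_entry (h : IsSeq s l) (he : Entry s i j) : i < l := by
  obtain ⟨i', j', hi, hp⟩ := h.2.1 _ he
  rwa [(pair_inj.1 hp).1]

theorem entry_get (h : IsSeq s l) (hi : i < l) : Entry s i (get s i) :=
  mu_spec (P := fun j => Entry s i j) (by fun_prop) (h.2.2 i hi).exists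

theorem entry_iff (h : IsSeq s l) : Entry s i j ↔ i < l ∧ j = get s i := by
  constructor
  · exact fun he => ⟨h.lt_of_entry he,
      (h.2.2 i (h.lt_of_entry he)).unique he (h.entry_get (h.lt_of_entry he))⟩
  · rintro ⟨hi, rfl⟩
    exact h.entry_get hi

theorem get_of_not_lt (h : IsSeq s l) (hi : ¬ i < l) : get s i = 0 :=
  mu_eq_zero fun _ he => hi (h.lt_of_entry he)

theorem ext (h : IsSeq s l) (h' : IsSeq t l) (hst : ∀ i < l, get s i = get t i) : s = t := by
  refine h.1.ext h'.1 fun p => ⟨fun hp => ?_, fun hp => ?_⟩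
  · obtain ⟨i, j, hi, rfl⟩ := h.2.1 p hp
    rw [(h.entry_iff.1 hp).2, hst i hi]
    exact h'.entry_get hi
  · obtain ⟨i, j, hi, rfl⟩ := h'.2.1 p hp
    rw [(h'.entry_iff.1 hp).2, ← hst i hi]
    exact h.entry_get hi

theorem len_le (h : IsSeq s l) (h' : IsSeq s l') : l ≤ l' := by
  by_contra! hlt
  exact lt_irrefl l' (h'.lt_of_entry (h.entry_get hlt))

theorem len_eq (h : IsSeq s l) : len s = l :=
  mu_eq h fun _ h' => le_antisymm (h'.len_le h) (h.len_le h')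

theorem lt_code (h : IsSeq s l) (hi : i < l) : i < s :=
  (left_le_pair i _).trans_lt (h.entry_get hi).lt

end IsSeq

/-- Only bounded predicates have a code, so the coding of finite sequences needs a bound on the
values. -/
theorem exists_bound {F : M.Num → M.Num} (hF : Arith M F) (l : M.Num) :
    ∃ b, ∀ i < l, F i < b := by
  refine arith_induction (P := fun l => ∃ b, ∀ i < l, F i < b) (by fun_prop)
    ⟨0, fun i hi => absurd hi (Num.not_lt_zero i)⟩ (fun l ih => ?_) l
  obtain ⟨b, hb⟩ := ih
  refine ⟨b + F l + 1, fun i hi => ?_⟩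
  rcases (Num.lt_add_one_iff.1 hi).lt_or_eq with hi | rfl
  · exact (hb i hi).trans (Num.lt_add_one_iff.2 le_self_add)
  · exact Num.lt_add_one_iff.2 le_add_self

section

variable {F : M.Num → M.Num} {l i j : M.Num}

theorem mkSeq_aux (hF : Arith M F) (l : M.Num) :
    ∃ K, ∀ p, (∃ i, i < l ∧ p = pair i (F i)) → p < K := by
  obtain ⟨K, hK⟩ := exists_bound (F := fun i => pair i (F i)) (by fun_prop) l
  exact ⟨K, by rintro p ⟨i, hi, rfl⟩; exact hK i hi⟩

theorem entry_mkSeq (hF : Arith M F) : Entry (mkSeq F l) i j ↔ i < l ∧ j = F i := by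
  obtain ⟨K, hK⟩ := mkSeq_aux hF l
  refine (elem_mkFin (by fun_prop) hK _).trans ?_
  constructor
  · rintro ⟨i', hi, h⟩
    obtain ⟨rfl, rfl⟩ := pair_inj.1 h
    exact ⟨hi, rfl⟩
  · rintro ⟨hi, rfl⟩
    exact ⟨i, hi, rfl⟩

theorem isSeq_mkSeq (hF : Arith M F) (l : M.Num) : IsSeq (mkSeq F l) l := by
  obtain ⟨K, hK⟩ := mkSeq_aux hF l
  refine ⟨isFin_mkFin (by fun_prop) hK, fun p hp => ?_, fun i hi => ?_⟩
  · obtain ⟨i, hi, rfl⟩ := (elem_mkFin (by fun_prop) hK _).1 hp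
    exact ⟨i, F i, hi, rfl⟩
  · exact ⟨F i, (entry_mkSeq hF).2 ⟨hi, rfl⟩, fun j hj => ((entry_mkSeq hF).1 hj).2⟩

theorem get_mkSeq (hF : Arith M F) (hi : i < l) : get (mkSeq F l) i = F i :=
  (((isSeq_mkSeq hF l).entry_iff.1 ((entry_mkSeq hF).2 ⟨hi, rfl⟩)).2).symm

theorem len_mkSeq (hF : Arith M F) (l : M.Num) : len (mkSeq F l) = l := (isSeq_mkSeq hF l).len_eq

end

/-! ### Primitive recursion -/

/-- The sequence of the values of a function defined by primitive recursion. -/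
def IsRecSeq (a : M.Num) (g : M.Num → M.Num → M.Num) (n s : M.Num) : Prop :=
  IsSeq s (n + 1) ∧ get s 0 = a ∧ ∀ i < n, get s (i + 1) = g i (get s i)

/-- The function with `primRec a g 0 = a` and `primRec a g (n + 1) = g n (primRec a g n)`. -/
noncomputable def primRec (a : M.Num) (g : M.Num → M.Num → M.Num) (n : M.Num) : M.Num :=
  get (mu fun s => IsRecSeq a g n s) n

@[fun_prop] theorem Arith.primRec {α : Type*} [ArType M α] {a n : α → M.Num}
    {g : α → M.Num → M.Num → M.Num} (ha : Arith M a)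
    (hg : Arith M (fun p : (α × M.Num) × M.Num => g p.1.1 p.1.2 p.2)) (hn : Arith M n) :
    Arith M (fun x => primRec (a x) (g x) (n x)) := by
  unfold L2Structure.primRec IsRecSeq
  have h : ∀ {β : Type _} [ArType M β] {f : β → α} {k l : β → M.Num}, Arith M f → Arith M k →
    Arith M l → Arith M fun x => g (f x) (k x) (l x) :=
    fun hf hk hl => hg.comp ((hf.prodMk hk).prodMk hl)
  have h1 : Arith M fun p : (α × M.Num) × M.Num => g p.1.1 p.2 (L2Structure.get p.1.2 p.2) :=
    h (by fun_prop) (by fun_prop) (by fun_prop)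
  fun_prop

theorem IsRecSeq.get_eq {a : M.Num} {g : M.Num → M.Num → M.Num} {n n' s s' : M.Num}
    (h : IsRecSeq a g n s) (h' : IsRecSeq a g n' s') (i : M.Num) (hn : i ≤ n) (hn' : i ≤ n') :
    get s i = get s' i := by
  revert hn hn'
  refine arith_induction (P := fun i => i ≤ n → i ≤ n' → get s i = get s' i) (by fun_prop)
    (fun _ _ => h.2.1.trans h'.2.1.symm) (fun i ih hn hn' => ?_) i
  have h1 := Num.add_one_le_iff.1 hn
  have h2 := Num.add_one_le_iff.1 hn'
  rw [h.2.2 i h1, h'.2.2 i h2, ih h1.le h2.le]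

theorem exists_isRecSeq (a : M.Num) {g : M.Num → M.Num → M.Num}
    (hg : Arith M (fun p : M.Num × M.Num => g p.1 p.2)) (n : M.Num) : ∃ s, IsRecSeq a g n s := by
  unfold IsRecSeq
  refine arith_induction (P := fun n => ∃ s, IsSeq s (n + 1) ∧ get s 0 = a ∧
    ∀ i < n, get s (i + 1) = g i (get s i)) (by fun_prop) ?_ (fun n ih => ?_) n
  · have hF : Arith M fun _ : M.Num => a := by fun_prop
    refine ⟨mkSeq (fun _ => a) (0 + 1), isSeq_mkSeq hF _, get_mkSeq hF ?_,
      fun i hi => absurd hi (Num.not_lt_zero i)⟩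
    exact Num.lt_add_one 0
  · obtain ⟨s, hs, h0, h1⟩ := ih
    classical
    let F : M.Num → M.Num := fun i => if i < n + 1 then get s i else g n (get s n)
    have hF : Arith M F := by
      have : Arith M fun _ : M.Num => g n (get s n) := by fun_prop
      show Arith M fun i => if i < n + 1 then get s i else g n (get s n)
      fun_prop
    have hlt : ∀ i < n + 1, get (mkSeq F (n + 1 + 1)) i = get s i := fun i hi => by
      rw [get_mkSeq hF (hi.trans (Num.lt_add_one _))]
      exact if_pos hi
    refine ⟨mkSeq F (n + 1 + 1), isSeq_mkSeq hF _, ?_, fun i hi => ?_⟩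
    · rw [hlt 0 (Num.lt_add_one_iff.2 zero_le), h0]
    · rw [hlt i hi]
      rcases (Num.lt_add_one_iff.1 hi).lt_or_eq with hi' | rfl
      · rw [hlt (i + 1) (add_lt_add_left hi' 1), h1 i hi']
      · rw [get_mkSeq hF (Num.lt_add_one _)]
        exact if_neg (lt_irrefl _)

section

variable (a : M.Num) {g : M.Num → M.Num → M.Num}
  (hg : Arith M (fun p : M.Num × M.Num => g p.1 p.2))

include hg

theorem isRecSeq_mu (n : M.Num) : IsRecSeq a g n (mu fun s => IsRecSeq a g n s) :=
  mu_spec (P := fun s => IsRecSeq a g n s) (by unfold IsRecSeq; fun_prop) (exists_isRecSeq a hg n)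

theorem primRec_zero : primRec a g 0 = a := (isRecSeq_mu a hg 0).2.1

theorem primRec_succ (n : M.Num) : primRec a g (n + 1) = g n (primRec a g n) := by
  unfold primRec
  rw [(isRecSeq_mu a hg (n + 1)).2.2 n (Num.lt_add_one n)]
  rw [(isRecSeq_mu a hg (n + 1)).get_eq (isRecSeq_mu a hg n) n (Num.lt_add_one n).le le_rfl]

end

end

end L2Structure

namespace L2Structure

variable {M : L2Structure.{u}}

/-! ## The Kleene normal form -/

section

variable [hM : M.ACA]

/-- The assignment of the number variables that is coded by a number. -/
noncomputable def dec (x : M.Num) : ℕ → M.Num := fun i => get x (i : M.Num)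

open Classical in
/-- The code of an assignment after a change of one value. -/
noncomputable def upd (x i a : M.Num) : M.Num :=
  mkSeq (fun j => if j = i then a else get x j) (x + i + 1)

@[fun_prop] theorem Arith.upd {α : Type*} [ArType M α] {f g h : α → M.Num} (hf : Arith M f)
    (hg : Arith M g) (hh : Arith M h) : Arith M (fun x => upd (f x) (g x) (h x)) := by
  unfold L2Structure.upd
  fun_prop

theorem get_of_le {x j : M.Num} (h : x ≤ j) : get x j = 0 :=
  mu_eq_zero fun _ he => (((left_le_pair j _).trans_lt (Elem.lt he)).trans_le h).false

/-- The length `x + i + 1` of the new sequence covers `i` and every position at which `x` has an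
entry, as such positions are below the code `x`. -/
theorem get_upd (x i a j : M.Num) :
    get (upd x i a) j = open Classical in if j = i then a else get x j := by
  have hF : Arith M fun j => open Classical in if j = i then a else get x j := by fun_prop
  by_cases h : j < x + i + 1
  · exact get_mkSeq hF h
  · rw [upd, (isSeq_mkSeq hF _).get_of_not_lt h, if_neg, get_of_le]
    · exact (le_self_add.trans le_self_add).trans (not_lt.1 h)
    · rintro rfl
      exact h (Num.lt_add_one_iff.2 le_add_self)

theorem dec_upd (x : M.Num) (i : ℕ) (a : M.Num) :
    dec (upd x (i : M.Num) a) = Function.update (dec x) i a := by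
  funext j
  rw [dec, get_upd, Function.update_apply]
  simp only [Nat.cast_inj]
  rfl

/-- The length `N` is standard, so this is an induction outside the model; `v` itself need not be
known to the model. -/
theorem exists_dec_eq (v : ℕ → M.Num) (N : ℕ) : ∃ x : M.Num, ∀ i < N, dec x i = v i := by
  induction N with
  | zero => exact ⟨0, fun i hi => absurd hi (Nat.not_lt_zero i)⟩
  | succ N ih =>
    obtain ⟨x, hx⟩ := ih
    refine ⟨upd x N (v N), fun i hi => ?_⟩
    rw [dec_upd, Function.update_apply]
    split_ifs with h
    · rw [h]
    · exact hx i (by omega)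

theorem arith_termVal_dec (t : L2Term) : Arith M (fun x => M.termVal (dec x) t) := by
  induction t with
  | var i =>
    simp only [termVal, dec]
    fun_prop
  | zero => exact Arith.const_num 0
  | one => exact Arith.const_num 1
  | add s t hs ht => exact hs.add ht
  | mul s t hs ht => exact hs.mul ht

end

theorem exists_sat_congr {θ : L2Formula} (hθ : θ.Arithmetical) :
    ∃ N, ∀ (v w : ℕ → M.Num) (V : ℕ → M.sets), (∀ i < N, v i = w i) →
      (M.Sat θ v V ↔ M.Sat θ w V) := by
  have binary : ∀ {θ ψ : L2Formula} (op : Prop → Prop → Prop),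
      (∃ N, ∀ (v w : ℕ → M.Num) (V : ℕ → M.sets), (∀ i < N, v i = w i) →
        (M.Sat θ v V ↔ M.Sat θ w V)) →
      (∃ N, ∀ (v w : ℕ → M.Num) (V : ℕ → M.sets), (∀ i < N, v i = w i) →
        (M.Sat ψ v V ↔ M.Sat ψ w V)) →
      ∃ N, ∀ (v w : ℕ → M.Num) (V : ℕ → M.sets), (∀ i < N, v i = w i) →
        (op (M.Sat θ v V) (M.Sat ψ v V) ↔ op (M.Sat θ w V) (M.Sat ψ w V)) := by
    rintro θ ψ op ⟨N, hN⟩ ⟨N', hN'⟩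
    refine ⟨max N N', fun v w V h => ?_⟩
    rw [hN v w V fun i hi => h i (lt_max_of_lt_left hi),
      hN' v w V fun i hi => h i (lt_max_of_lt_right hi)]
  have agree : ∀ {N i : ℕ} {v w : ℕ → M.Num} (a : M.Num), (∀ j < N, v j = w j) →
      ∀ j < N, Function.update v i a j = Function.update w i a j := fun a h j hj => by
    simp only [Function.update_apply, h j hj]
  induction θ with
  | eq s t =>
    obtain ⟨N, hN⟩ := exists_termVal_congr (M := M) s
    obtain ⟨N', hN'⟩ := exists_termVal_congr (M := M) t
    refine ⟨max N N', fun v w V h => ?_⟩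
    rw [Sat, Sat, hN v w fun i hi => h i (lt_max_of_lt_left hi),
      hN' v w fun i hi => h i (lt_max_of_lt_right hi)]
  | lt s t =>
    obtain ⟨N, hN⟩ := exists_termVal_congr (M := M) s
    obtain ⟨N', hN'⟩ := exists_termVal_congr (M := M) t
    refine ⟨max N N', fun v w V h => ?_⟩
    rw [Sat, Sat, hN v w fun i hi => h i (lt_max_of_lt_left hi),
      hN' v w fun i hi => h i (lt_max_of_lt_right hi)]
  | mem t Y =>
    obtain ⟨N, hN⟩ := exists_termVal_congr (M := M) t
    exact ⟨N, fun v w V h => by rw [Sat, Sat, hN v w h]⟩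
  | neg θ ih => exact binary (fun p _ => ¬ p) (ih hθ) (ih hθ)
  | and θ ψ ih ih' => exact binary (· ∧ ·) (ih hθ.1) (ih' hθ.2)
  | or θ ψ ih ih' => exact binary (· ∨ ·) (ih hθ.1) (ih' hθ.2)
  | imp θ ψ ih ih' => exact binary (fun p q => p → q) (ih hθ.1) (ih' hθ.2)
  | iff θ ψ ih ih' => exact binary (· ↔ ·) (ih hθ.1) (ih' hθ.2)
  | allNum i θ ih =>
    obtain ⟨N, hN⟩ := ih hθ
    exact ⟨N, fun v w V h => forall_congr' fun a => hN _ _ V (agree a h)⟩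
  | exNum i θ ih =>
    obtain ⟨N, hN⟩ := ih hθ
    exact ⟨N, fun v w V h => exists_congr fun a => hN _ _ V (agree a h)⟩
  | allSet Y θ ih => exact hθ.elim
  | exSet Y θ ih => exact hθ.elim

/-! ### Certificates for the truth of arithmetical formulas -/

section

variable [hM : M.ACA]

/-- Conditions of the form `∀ x ∃ y …`, where the matrix is arithmetical and consults the given set
at finitely many places that depend arithmetically on `x` and `y`. -/
def Pi2 (G : Set M.Num → Prop) : Prop :=
  ∃ (β : M.Num → M.Num → Prop → Prop → Prop → Prop) (t₁ t₂ t₃ : M.Num → M.Num → M.Num),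
    Arith M (fun z : M.Num × M.Num × Prop × Prop × Prop =>
      β z.1 z.2.1 z.2.2.1 z.2.2.2.1 z.2.2.2.2) ∧
    Arith M (fun z : M.Num × M.Num => t₁ z.1 z.2) ∧
    Arith M (fun z : M.Num × M.Num => t₂ z.1 z.2) ∧
    Arith M (fun z : M.Num × M.Num => t₃ z.1 z.2) ∧
    ∀ C, G C ↔ ∀ x, ∃ y, β x y (t₁ x y ∈ C) (t₂ x y ∈ C) (t₃ x y ∈ C)

namespace Pi2

theorem trivial : Pi2 (M := M) fun _ => True :=
  ⟨fun _ _ _ _ _ => True, fun _ _ => 0, fun _ _ => 0, fun _ _ => 0, by fun_prop, by fun_prop,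
    by fun_prop, by fun_prop, by simp⟩

/-- Two-way choice of a number. -/
noncomputable def choice (t t' : M.Num → M.Num → M.Num) (x y : M.Num) : M.Num :=
  open Classical in if pfst x = 0 then t (psnd x) y else t' (psnd x) y

theorem arith_choice {t t' : M.Num → M.Num → M.Num}
    (ht : Arith M (fun z : M.Num × M.Num => t z.1 z.2))
    (ht' : Arith M (fun z : M.Num × M.Num => t' z.1 z.2)) :
    Arith M (fun z : M.Num × M.Num => choice t t' z.1 z.2) := by
  unfold choice
  have h : Arith M fun z : M.Num × M.Num => t (psnd z.1) z.2 :=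
    ht.comp (g := fun z : M.Num × M.Num => (psnd z.1, z.2)) (by fun_prop)
  have h' : Arith M fun z : M.Num × M.Num => t' (psnd z.1) z.2 :=
    ht'.comp (g := fun z : M.Num × M.Num => (psnd z.1, z.2)) (by fun_prop)
  fun_prop

/-- The first component of the universally quantified number selects the conjunct, so the number of
queries does not grow. -/
theorem and {G H : Set M.Num → Prop} (hG : Pi2 G) (hH : Pi2 H) : Pi2 fun C => G C ∧ H C := by
  obtain ⟨β, t₁, t₂, t₃, hβ, h₁, h₂, h₃, hG⟩ := hG
  obtain ⟨β', t₁', t₂', t₃', hβ', h₁', h₂', h₃', hH⟩ := hH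
  refine ⟨fun x y p q r => (pfst x = 0 → β (psnd x) y p q r) ∧
    (¬ pfst x = 0 → β' (psnd x) y p q r), choice t₁ t₁', choice t₂ t₂', choice t₃ t₃', ?_,
    arith_choice h₁ h₁', arith_choice h₂ h₂', arith_choice h₃ h₃', fun C => ?_⟩
  · have h : Arith M fun z : M.Num × M.Num × Prop × Prop × Prop =>
        β (psnd z.1) z.2.1 z.2.2.1 z.2.2.2.1 z.2.2.2.2 :=
      hβ.comp (g := fun z : M.Num × M.Num × Prop × Prop × Prop =>
        (psnd z.1, z.2.1, z.2.2.1, z.2.2.2.1, z.2.2.2.2)) (by fun_prop)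
    have h' : Arith M fun z : M.Num × M.Num × Prop × Prop × Prop =>
        β' (psnd z.1) z.2.1 z.2.2.1 z.2.2.2.1 z.2.2.2.2 :=
      hβ'.comp (g := fun z : M.Num × M.Num × Prop × Prop × Prop =>
        (psnd z.1, z.2.1, z.2.2.1, z.2.2.2.1, z.2.2.2.2)) (by fun_prop)
    fun_prop
  · refine (and_congr (hG C) (hH C)).trans ?_
    constructor
    · rintro ⟨h, h'⟩ x
      by_cases hx : pfst x = 0
      · obtain ⟨y, hy⟩ := h (psnd x)
        exact ⟨y, fun _ => by simpa only [choice, if_pos hx] using hy, fun hn => absurd hx hn⟩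
      · obtain ⟨y, hy⟩ := h' (psnd x)
        exact ⟨y, fun hn => absurd hn hx, fun _ => by simpa only [choice, if_neg hx] using hy⟩
    · refine fun h => ⟨fun x => ?_, fun x => ?_⟩
      · obtain ⟨y, hy, -⟩ := h (pair 0 x)
        exact ⟨y, by simpa [choice] using hy⟩
      · obtain ⟨y, -, hy⟩ := h (pair 1 x)
        exact ⟨y, by simpa [choice] using hy⟩

theorem preimage {G : Set M.Num → Prop} (hG : Pi2 G) {r : M.Num → M.Num} (hr : Arith M r) :
    Pi2 fun C => G (r ⁻¹' C) := by
  obtain ⟨β, t₁, t₂, t₃, hβ, h₁, h₂, h₃, hG⟩ := hG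
  exact ⟨β, fun x y => r (t₁ x y), fun x y => r (t₂ x y), fun x y => r (t₃ x y), hβ, by fun_prop,
    by fun_prop, by fun_prop, fun C => hG _⟩

end Pi2

/-- Any system `G` of certificates, from which the value of the set variable `X` is obtained as a
preimage under `h`, can be extended by the truth values of a formula at all coded assignments. -/
def Certifiable (V : ℕ → M.sets) (X : ℕ) (θ : L2Formula) : Prop :=
  ∀ (G : Set M.Num → Prop) (h : M.Num → M.Num), Pi2 G → Arith M h →
    ∃ (G' : Set M.Num → Prop) (r t : M.Num → M.Num), Pi2 G' ∧ Arith M r ∧ Arith M t ∧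
      (∀ C, G' C → G (r ⁻¹' C)) ∧
      (∀ C ∈ M.sets, G C → ∃ C' ∈ M.sets, G' C' ∧ r ⁻¹' C' = C) ∧
      ∀ C ∈ M.sets, G' C → ∀ A : M.sets, (A : Set M.Num) = {z | r (h z) ∈ C} →
        ∀ x, M.Sat θ (dec x) (Function.update V X A) ↔ t x ∈ C

/-- The old certificate is stored in the column `pair 0` and the new truth values `D` in the column
`pair 1`. -/
theorem exists_extension {G E : Set M.Num → Prop}
    (H : ∀ C ∈ M.sets, G C → ∃ D : M.Num → Prop, Arith M D ∧
      ∀ C', (∀ z, pair 0 z ∈ C' ↔ z ∈ C) → (∀ x, pair 1 x ∈ C' ↔ D x) → E C')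
    {C : Set M.Num} (hC : C ∈ M.sets) (hGC : G C) :
    ∃ C' ∈ M.sets, (G (pair 0 ⁻¹' C') ∧ E C') ∧ pair 0 ⁻¹' C' = C := by
  obtain ⟨D, hD, hE⟩ := H C hC hGC
  have h : Arith M fun z => (pfst z = 0 ∧ psnd z ∈ C) ∨ (pfst z = 1 ∧ D (psnd z)) := by
    fun_prop (disch := assumption)
  have h0 : pair 0 ⁻¹' {z | (pfst z = 0 ∧ psnd z ∈ C) ∨ (pfst z = 1 ∧ D (psnd z))} = C := by
    ext z
    simp
  refine ⟨_, h.mem_sets, ⟨by rwa [h0], hE _ (fun z => ?_) fun x => ?_⟩, h0⟩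
  · simp
  · simp

namespace Certifiable

variable {V : ℕ → M.sets} {X : ℕ} {θ θ₁ θ₂ : L2Formula}

theorem of_arith {p : M.Num → Prop} (hp : Arith M p)
    (h : ∀ A x, M.Sat θ (dec x) (Function.update V X A) ↔ p x) : Certifiable V X θ := by
  intro G k hG hk
  have hE : Pi2 fun C : Set M.Num => ∀ x, pair 1 x ∈ C ↔ p x :=
    ⟨fun x _ P _ _ => P ↔ p x, fun x _ => pair 1 x, fun _ _ => 0, fun _ _ => 0, by fun_prop,
      by fun_prop, by fun_prop, by fun_prop, fun C => by simp⟩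
  refine ⟨_, pair 0, pair 1, (hG.preimage (r := pair 0) (by fun_prop)).and hE, by fun_prop,
    by fun_prop, fun C hC => hC.1, fun C hC => exists_extension (fun C hC hGC => ?_) hC,
    fun C hC hGC A hA x => ?_⟩
  · exact ⟨p, hp, fun C' _ h1 x => h1 x⟩
  · rw [h, hGC.2]

theorem mem_self (t : L2Term) : Certifiable V X (.mem t X) := by
  intro G k hG hk
  have ht := arith_termVal_dec (M := M) t
  have ht' : Arith M fun z : M.Num × M.Num => M.termVal (dec z.1) t :=
    ht.comp (g := fun z : M.Num × M.Num => z.1) (by fun_prop)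
  have hE : Pi2 fun C : Set M.Num =>
      ∀ x, pair 1 x ∈ C ↔ pair 0 (k (M.termVal (dec x) t)) ∈ C :=
    ⟨fun x _ P Q _ => P ↔ Q, fun x _ => pair 1 x, fun x _ => pair 0 (k (M.termVal (dec x) t)),
      fun _ _ => 0, by fun_prop, by fun_prop, by fun_prop, by fun_prop, fun C => by simp⟩
  refine ⟨_, pair 0, pair 1, (hG.preimage (r := pair 0) (by fun_prop)).and hE, by fun_prop,
    by fun_prop, fun C hC => hC.1, fun C hC => exists_extension (fun C hC hGC => ?_) hC,
    fun C hC hGC A hA x => ?_⟩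
  · exact ⟨fun x => k (M.termVal (dec x) t) ∈ C, by fun_prop (disch := assumption),
      fun C' h0 h1 x => by rw [h1, h0]⟩
  · rw [Sat, Function.update_self, hA, hGC.2]
    rfl

/-- The certificate for the second subformula extends that for the first, so both refer to the same
value of the set variable. The third query is needed here: one for the compound formula and one for
each part. -/
theorem binary {op : Prop → Prop → Prop} (hop : Arith M fun z : Prop × Prop => op z.1 z.2)
    (h₁ : Certifiable V X θ₁) (h₂ : Certifiable V X θ₂)
    (h : ∀ v V, M.Sat θ v V ↔ op (M.Sat θ₁ v V) (M.Sat θ₂ v V)) : Certifiable V X θ := by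
  intro G k hG hk
  obtain ⟨G₁, r₁, t₁, hG₁, hr₁, ht₁, hsub₁, hex₁, hsat₁⟩ := h₁ G k hG hk
  obtain ⟨G₂, r₂, t₂, hG₂, hr₂, ht₂, hsub₂, hex₂, hsat₂⟩ :=
    h₂ G₁ (fun z => r₁ (k z)) hG₁ (by fun_prop)
  have hE : Pi2 fun C : Set M.Num =>
      ∀ x, pair 1 x ∈ C ↔ op (pair 0 (r₂ (t₁ x)) ∈ C) (pair 0 (t₂ x) ∈ C) := by
    refine ⟨fun x _ P Q R => P ↔ op Q R, fun x _ => pair 1 x, fun x _ => pair 0 (r₂ (t₁ x)),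
      fun x _ => pair 0 (t₂ x), ?_, by fun_prop, by fun_prop, by fun_prop, fun C => by simp⟩
    have : Arith M fun z : M.Num × M.Num × Prop × Prop × Prop => op z.2.2.2.1 z.2.2.2.2 :=
      hop.comp (g := fun z : M.Num × M.Num × Prop × Prop × Prop => (z.2.2.2.1, z.2.2.2.2))
        (by fun_prop)
    fun_prop
  refine ⟨_, fun z => pair 0 (r₂ (r₁ z)), pair 1,
    (hG₂.preimage (r := pair 0) (by fun_prop)).and hE, by fun_prop, by fun_prop,
    fun C hC => hsub₁ _ (hsub₂ _ hC.1), fun C hC hGC => ?_, fun C hC hGC A hA x => ?_⟩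
  · obtain ⟨C₁, hC₁, hGC₁, rfl⟩ := hex₁ C hC hGC
    obtain ⟨C₂, hC₂, hGC₂, rfl⟩ := hex₂ C₁ hC₁ hGC₁
    obtain ⟨C₃, hC₃, hGC₃, rfl⟩ := exists_extension (G := G₂) (E := fun C =>
      ∀ x, pair 1 x ∈ C ↔ op (pair 0 (r₂ (t₁ x)) ∈ C) (pair 0 (t₂ x) ∈ C)) (fun C hC _ => by
      refine ⟨fun x => op (r₂ (t₁ x) ∈ C) (t₂ x ∈ C), ?_, fun C' h0 h1 x => ?_⟩
      · exact hop.comp (g := fun x => (r₂ (t₁ x) ∈ C, t₂ x ∈ C))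
          (by fun_prop (disch := assumption))
      · exact (h1 x).trans (by rw [h0, h0])) hC₂ hGC₂
    exact ⟨C₃, hC₃, hGC₃, rfl⟩
  · have m0 : pair 0 ⁻¹' C ∈ M.sets :=
      Arith.mem_sets (P := fun z => pair 0 z ∈ C) (by fun_prop (disch := assumption))
    have m1 : r₂ ⁻¹' (pair 0 ⁻¹' C) ∈ M.sets :=
      Arith.mem_sets (P := fun z => pair 0 (r₂ z) ∈ C) (by fun_prop (disch := assumption))
    rw [h, hsat₁ _ m1 (hsub₂ _ hGC.1) A hA, hsat₂ _ m0 hGC.1 A hA]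
    exact (hGC.2 x).symm

/-- One direction of the truth condition demands a witness and is properly of the form ∀∃; the other
is purely universal. -/
theorem exNum (i : ℕ) (h₁ : Certifiable V X θ) : Certifiable V X (.exNum i θ) := by
  intro G k hG hk
  obtain ⟨G₁, r₁, t₁, hG₁, hr₁, ht₁, hsub₁, hex₁, hsat₁⟩ := h₁ G k hG hk
  have hE₁ : Pi2 fun C : Set M.Num =>
      ∀ x, ∃ y, pair 1 x ∈ C → pair 0 (t₁ (upd x i y)) ∈ C :=
    ⟨fun x y P Q _ => P → Q, fun x _ => pair 1 x, fun x y => pair 0 (t₁ (upd x i y)),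
      fun _ _ => 0, by fun_prop, by fun_prop, by fun_prop, by fun_prop, fun C => Iff.rfl⟩
  have hE₂ : Pi2 fun C : Set M.Num =>
      ∀ x y, pair 0 (t₁ (upd x i y)) ∈ C → pair 1 x ∈ C := by
    -- Both universal quantifiers are merged by pairing, and the existential one is idle.
    refine ⟨fun x y P Q _ => P → Q, fun x _ => pair 0 (t₁ (upd (pfst x) i (psnd x))),
      fun x y => pair 1 (pfst x), fun _ _ => 0, by fun_prop, by fun_prop, by fun_prop,
      by fun_prop, fun C => ?_⟩
    constructor
    · exact fun h x => ⟨0, h _ _⟩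
    · intro h x y
      obtain ⟨_, hxy⟩ := h (pair x y)
      simpa only [pfst_pair, psnd_pair] using hxy
  refine ⟨_, fun z => pair 0 (r₁ z), pair 1,
    (hG₁.preimage (r := pair 0) (by fun_prop)).and (hE₁.and hE₂), by fun_prop, by fun_prop,
    fun C hC => hsub₁ _ hC.1, fun C hC hGC => ?_, fun C hC hGC A hA x => ?_⟩
  · obtain ⟨C₁, hC₁, hGC₁, rfl⟩ := hex₁ C hC hGC
    obtain ⟨C₂, hC₂, hGC₂, rfl⟩ := exists_extension (G := G₁) (E := fun C =>
      (∀ x, ∃ y, pair 1 x ∈ C → pair 0 (t₁ (upd x i y)) ∈ C) ∧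
        ∀ x y, pair 0 (t₁ (upd x i y)) ∈ C → pair 1 x ∈ C) (fun C hC _ => by
      refine ⟨fun x => ∃ y, t₁ (upd x i y) ∈ C, by fun_prop (disch := assumption),
        fun C' h0 h1 => ⟨fun x => ?_, fun x y hy => ?_⟩⟩
      · by_cases hx : ∃ y, t₁ (upd x i y) ∈ C
        · obtain ⟨y, hy⟩ := hx
          exact ⟨y, fun _ => (h0 _).2 hy⟩
        · exact ⟨0, fun h => absurd ((h1 x).1 h) hx⟩
      · exact (h1 x).2 ⟨y, (h0 _).1 hy⟩) hC₁ hGC₁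
    exact ⟨C₂, hC₂, hGC₂, rfl⟩
  · have m0 : pair 0 ⁻¹' C ∈ M.sets :=
      Arith.mem_sets (P := fun z => pair 0 z ∈ C) (by fun_prop (disch := assumption))
    have key : ∀ a, M.Sat θ (Function.update (dec x) i a) (Function.update V X A) ↔
        pair 0 (t₁ (upd x i a)) ∈ C := fun a => by
      rw [← dec_upd, hsat₁ _ m0 hGC.1 A hA]
      rfl
    rw [Sat]
    simp only [key]
    constructor
    · rintro ⟨a, ha⟩
      exact hGC.2.2 x a ha
    · intro hx
      obtain ⟨a, ha⟩ := hGC.2.1 x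
      exact ⟨a, ha hx⟩

end Certifiable

/-- The formula is standard, so the induction over its subformulas takes place outside the model,
and no truth predicate for arithmetical formulas is required. -/
theorem certifiable_of_arithmetical (V : ℕ → M.sets) (X : ℕ) {θ : L2Formula}
    (hθ : θ.Arithmetical) : Certifiable V X θ := by
  have hneg : ∀ {θ ψ : L2Formula}, Certifiable V X θ →
      (∀ v V, M.Sat ψ v V ↔ ¬ M.Sat θ v V) → Certifiable V X ψ := fun h h' =>
    Certifiable.binary (op := fun p _ => ¬ p) (by fun_prop) h h h'
  induction θ with
  | eq s t =>
    have hs := arith_termVal_dec (M := M) s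
    have ht := arith_termVal_dec (M := M) t
    exact Certifiable.of_arith (hs.eq ht) fun A x => Iff.rfl
  | lt s t =>
    have hs := arith_termVal_dec (M := M) s
    have ht := arith_termVal_dec (M := M) t
    exact Certifiable.of_arith (hs.lt ht) fun A x => Iff.rfl
  | mem t Y =>
    obtain rfl | hY := eq_or_ne Y X
    · exact Certifiable.mem_self t
    · refine Certifiable.of_arith (Arith.mem (V Y).2 (arith_termVal_dec (M := M) t))
        fun A x => ?_
      rw [Sat, Function.update_of_ne hY]
  | neg θ ih => exact hneg (ih hθ) fun _ _ => Iff.rfl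
  | and θ ψ ih ih' =>
    exact .binary (op := (· ∧ ·)) (by fun_prop) (ih hθ.1) (ih' hθ.2) fun _ _ => Iff.rfl
  | or θ ψ ih ih' =>
    exact .binary (op := (· ∨ ·)) (by fun_prop) (ih hθ.1) (ih' hθ.2) fun _ _ => Iff.rfl
  | imp θ ψ ih ih' =>
    exact .binary (op := fun p q => p → q) (by fun_prop) (ih hθ.1) (ih' hθ.2) fun _ _ => Iff.rfl
  | iff θ ψ ih ih' =>
    exact .binary (op := (· ↔ ·)) (by fun_prop) (ih hθ.1) (ih' hθ.2) fun _ _ => Iff.rfl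
  | allNum i θ ih =>
    refine hneg (θ := .exNum i (.neg θ)) (.exNum i (hneg (ih hθ) fun _ _ => Iff.rfl)) fun v V => ?_
    simp only [Sat]
    push Not
    rfl
  | exNum i θ ih => exact (ih hθ).exNum i
  | allSet Y θ ih => exact hθ.elim
  | exSet Y θ ih => exact hθ.elim

theorem lt_sum_add_one (a b c d e : M.Num) :
    a < a + b + c + d + e + 1 ∧ b < a + b + c + d + e + 1 ∧ c < a + b + c + d + e + 1 ∧
      d < a + b + c + d + e + 1 ∧ e < a + b + c + d + e + 1 := by
  have ha := zero_le (a := a)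
  have hb := zero_le (a := b)
  have hc := zero_le (a := c)
  have hd := zero_le (a := d)
  have he := zero_le (a := e)
  simp only [Num.lt_add_one_iff]
  grind

/-- The Kleene normal form: a family of `Σ¹₁`-statements amounts to the existence of paths that
satisfy arithmetical conditions on pairs of entries. -/
theorem exists_normal_form {θ : L2Formula} (hθ : θ.Arithmetical) (X i : ℕ) (v : ℕ → M.Num)
    (V : ℕ → M.sets) :
    ∃ S : M.Num → M.Num → M.Num → M.Num → M.Num → Prop,
      Arith M (fun z : M.Num × M.Num × M.Num × M.Num × M.Num =>
        S z.1 z.2.1 z.2.2.1 z.2.2.2.1 z.2.2.2.2) ∧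
      ∀ n, (∃ A : M.sets, ¬ M.Sat θ (Function.update v i n) (Function.update V X A)) ↔
        ∃ F : M.Num → M.Num, Arith M F ∧ ∀ j k, S n j k (F j) (F k) := by
  obtain ⟨G, r, t, hG, hr, ht, -, hex, hsat⟩ :=
    certifiable_of_arithmetical V X hθ (fun _ => True) (fun z => z) Pi2.trivial (by fun_prop)
  obtain ⟨N, hN⟩ := exists_sat_congr (M := M) hθ
  -- Only the first `N` number variables matter for `θ`, so one number `x₀` can replace the
  -- assignment `v`.
  obtain ⟨x₀, hx₀⟩ := exists_dec_eq v N
  have hdec : ∀ n (A : M.sets), M.Sat θ (Function.update v i n) (Function.update V X A) ↔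
      M.Sat θ (dec (upd x₀ i n)) (Function.update V X A) := fun n A => by
    refine hN _ _ _ fun j hj => ?_
    rw [dec_upd]
    simp only [Function.update_apply, hx₀ j hj]
  have hset : ∀ n, (∃ A : M.sets, ¬ M.Sat θ (Function.update v i n) (Function.update V X A)) ↔
      ∃ C ∈ M.sets, G C ∧ t (upd x₀ i n) ∉ C := by
    intro n
    simp only [hdec]
    constructor
    · rintro ⟨A, hA⟩
      obtain ⟨C, hC, hGC, hrC⟩ := hex A A.2 trivial
      exact ⟨C, hC, hGC, fun h => hA ((hsat C hC hGC A hrC.symm _).2 h)⟩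
    · rintro ⟨C, hC, hGC, h⟩
      have m : {z | r z ∈ C} ∈ M.sets := Arith.mem_sets (by fun_prop (disch := assumption))
      exact ⟨⟨_, m⟩, fun h' => h ((hsat C hC hGC ⟨_, m⟩ rfl _).1 h')⟩
  obtain ⟨β, t₁, t₂, t₃, hβ, h₁, h₂, h₃, hG⟩ := hG
  have hβ' : ∀ {α : Type u} [ArType M α] {f g : α → M.Num} {P Q R : α → Prop}, Arith M f →
      Arith M g → Arith M P → Arith M Q → Arith M R →
      Arith M fun x => β (f x) (g x) (P x) (Q x) (R x) := fun hf hg hP hQ hR =>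
    hβ.comp (hf.prodMk (hg.prodMk (hP.prodMk (hQ.prodMk hR))))
  -- An entry at position j is `pair y (pair a b)`: y is a witness for x = j in the ∀∃-condition,
  -- and a codes the part of the certificate below the bound b. The first group of conditions checks
  -- position j alone; the last one makes the finite parts at j and k compatible.
  refine ⟨fun n j k p q =>
    (j < psnd (psnd p) ∧ t (upd x₀ i n) < psnd (psnd p) ∧ ¬ Elem (t (upd x₀ i n)) (pfst (psnd p)) ∧
      t₁ j (pfst p) < psnd (psnd p) ∧ t₂ j (pfst p) < psnd (psnd p) ∧
      t₃ j (pfst p) < psnd (psnd p) ∧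
      β j (pfst p) (Elem (t₁ j (pfst p)) (pfst (psnd p))) (Elem (t₂ j (pfst p)) (pfst (psnd p)))
        (Elem (t₃ j (pfst p)) (pfst (psnd p)))) ∧
    ∀ z, z < psnd (psnd p) → z < psnd (psnd q) →
      (Elem z (pfst (psnd p)) ↔ Elem z (pfst (psnd q))), ?_, fun n => (hset n).trans ?_⟩
  · have c₁ : Arith M fun z : M.Num × M.Num × M.Num × M.Num × M.Num =>
        t₁ z.2.1 (pfst z.2.2.2.1) :=
      h₁.comp (g := fun z : M.Num × M.Num × M.Num × M.Num × M.Num => (z.2.1, pfst z.2.2.2.1))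
        (by fun_prop)
    have c₂ : Arith M fun z : M.Num × M.Num × M.Num × M.Num × M.Num =>
        t₂ z.2.1 (pfst z.2.2.2.1) :=
      h₂.comp (g := fun z : M.Num × M.Num × M.Num × M.Num × M.Num => (z.2.1, pfst z.2.2.2.1))
        (by fun_prop)
    have c₃ : Arith M fun z : M.Num × M.Num × M.Num × M.Num × M.Num =>
        t₃ z.2.1 (pfst z.2.2.2.1) :=
      h₃.comp (g := fun z : M.Num × M.Num × M.Num × M.Num × M.Num => (z.2.1, pfst z.2.2.2.1))
        (by fun_prop)
    have cβ := hβ' (α := M.Num × M.Num × M.Num × M.Num × M.Num) (f := fun z => z.2.1)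
      (g := fun z => pfst z.2.2.2.1)
      (P := fun z => Elem (t₁ z.2.1 (pfst z.2.2.2.1)) (pfst (psnd z.2.2.2.1)))
      (Q := fun z => Elem (t₂ z.2.1 (pfst z.2.2.2.1)) (pfst (psnd z.2.2.2.1)))
      (R := fun z => Elem (t₃ z.2.1 (pfst z.2.2.2.1)) (pfst (psnd z.2.2.2.1)))
      (by fun_prop) (by fun_prop) (by fun_prop) (by fun_prop) (by fun_prop)
    fun_prop
  constructor
  · rintro ⟨C, hC, hGC, hn⟩
    rw [hG] at hGC
    set y : M.Num → M.Num := fun j => mu fun y => β j y (t₁ j y ∈ C) (t₂ j y ∈ C) (t₃ j y ∈ C)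
      with hy
    have hys : ∀ j, β j (y j) (t₁ j (y j) ∈ C) (t₂ j (y j) ∈ C) (t₃ j (y j) ∈ C) := fun j =>
      mu_spec (P := fun y => β j y (t₁ j y ∈ C) (t₂ j y ∈ C) (t₃ j y ∈ C))
        (hβ' (by fun_prop) (by fun_prop) (by fun_prop (disch := assumption))
          (by fun_prop (disch := assumption)) (by fun_prop (disch := assumption))) (hGC j)
    have hya : Arith M y := by
      have := hβ' (α := M.Num × M.Num) (f := fun z => z.1) (g := fun z => z.2)
        (P := fun z => t₁ z.1 z.2 ∈ C) (Q := fun z => t₂ z.1 z.2 ∈ C)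
        (R := fun z => t₃ z.1 z.2 ∈ C) (by fun_prop) (by fun_prop)
        (by fun_prop (disch := assumption)) (by fun_prop (disch := assumption))
        (by fun_prop (disch := assumption))
      exact Arith.mu this
    -- The bound exceeds `j` and every place that is consulted at position `j`.
    set b : M.Num → M.Num := fun j => j + t (upd x₀ i n) + t₁ j (y j) + t₂ j (y j) + t₃ j (y j) + 1
      with hb
    have c₁ : Arith M fun j => t₁ j (y j) := h₁.comp (g := fun j => (j, y j)) (by fun_prop)
    have c₂ : Arith M fun j => t₂ j (y j) := h₂.comp (g := fun j => (j, y j)) (by fun_prop)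
    have c₃ : Arith M fun j => t₃ j (y j) := h₃.comp (g := fun j => (j, y j)) (by fun_prop)
    have hba : Arith M b := by
      have : Arith M fun _ : M.Num => t (upd x₀ i n) := by fun_prop
      rw [hb]
      fun_prop
    have hel : ∀ j z, z < b j → (Elem z (mkFin fun z => z < b j ∧ z ∈ C) ↔ z ∈ C) := fun j z hz =>
      (elem_mkFin (P := fun z => z < b j ∧ z ∈ C) (K := b j) (by fun_prop (disch := assumption))
        (fun z hz => hz.1) z).trans (and_iff_right hz)
    refine ⟨fun j => pair (y j) (pair (mkFin fun z => z < b j ∧ z ∈ C) (b j)), ?_, fun j k => ?_⟩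
    · fun_prop (disch := assumption)
    · simp only [pfst_pair, psnd_pair]
      obtain ⟨l1, l2, l3, l4, l5⟩ :=
        lt_sum_add_one j (t (upd x₀ i n)) (t₁ j (y j)) (t₂ j (y j)) (t₃ j (y j))
      refine ⟨⟨l1, l2, by rwa [hel j _ l2], l3, l4, l5, ?_⟩, fun z hz hz' => ?_⟩
      · rw [hel j _ l3, hel j _ l4, hel j _ l5]
        exact hys j
      · rw [hel j z hz, hel k z hz']
  · rintro ⟨F, hF, h⟩
    have hel : ∀ j z, z < psnd (psnd (F j)) →
        (Elem z (pfst (psnd (F z))) ↔ Elem z (pfst (psnd (F j)))) := fun j z hz =>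
      (h z j).2 z (h z j).1.1 hz
    -- Since the bound at position `z` exceeds `z`, the finite part stored there decides membership
    -- of `z`; compatibility extends this to all other positions.
    refine ⟨{z | Elem z (pfst (psnd (F z)))}, Arith.mem_sets (by fun_prop), ?_, ?_⟩
    · rw [hG]
      intro j
      obtain ⟨-, -, -, l3, l4, l5, hj⟩ := (h j j).1
      refine ⟨pfst (F j), ?_⟩
      simp only [Set.mem_ofPred_eq]
      rwa [hel j _ l3, hel j _ l4, hel j _ l5]
    · obtain ⟨-, l2, hn, -⟩ := (h 0 0).1
      simp only [Set.mem_ofPred_eq]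
      rwa [hel 0 _ l2]

end

end L2Structure

namespace L2Structure

variable {M : L2Structure.{u}}

/-! ## Trees over linear orders -/

section

variable [hM : M.ACA]

/-- Arithmetical linear orders. -/
structure LOrd (M : L2Structure.{u}) where
  mem : M.Num → Prop
  lt : M.Num → M.Num → Prop
  arith_mem : Arith M mem
  arith_lt : Arith M fun z : M.Num × M.Num => lt z.1 z.2
  linear : IsLinOrd mem lt

namespace LOrd

variable (L : LOrd M)

@[fun_prop] theorem arith_mem' {α : Type*} [ArType M α] {f : α → M.Num} (hf : Arith M f) :
    Arith M fun x => L.mem (f x) := L.arith_mem.comp hf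

@[fun_prop] theorem arith_lt' {α : Type*} [ArType M α] {f g : α → M.Num} (hf : Arith M f)
    (hg : Arith M g) : Arith M fun x => L.lt (f x) (g x) := L.arith_lt.comp (hf.prodMk hg)

/-- The order `n = {0, …, n - 1}`. -/
def fin (n : M.Num) : LOrd M where
  mem x := x < n
  lt := (· < ·)
  arith_mem := by fun_prop
  arith_lt := by fun_prop
  linear := ⟨fun x _ => lt_irrefl x, fun _ _ _ _ _ _ => lt_trans, fun x y _ _ => lt_trichotomy x y⟩

variable {L} {x y z : M.Num}

theorem irrefl (hx : L.mem x) : ¬ L.lt x x := L.linear.1 x hx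

theorem trans (hx : L.mem x) (hy : L.mem y) (hz : L.mem z) (h : L.lt x y) (h' : L.lt y z) :
    L.lt x z := L.linear.2.1 x y z hx hy hz h h'

theorem trichotomy (hx : L.mem x) (hy : L.mem y) : L.lt x y ∨ x = y ∨ L.lt y x :=
  L.linear.2.2 x y hx hy

theorem asymm (hx : L.mem x) (hy : L.mem y) (h : L.lt x y) : ¬ L.lt y x := fun h' =>
  irrefl hx (trans hx hy hx h h')

end LOrd

/-- The lexicographic order on entries. -/
def EntLt (r : M.Num → M.Num → Prop) (p q : M.Num) : Prop :=
  pfst p < pfst q ∨ (pfst p = pfst q ∧ r (psnd p) (psnd q))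

/-- The entries over an order: pairs of a number and an element of the order. -/
def Ent (A : M.Num → Prop) (p : M.Num) : Prop := p = pair (pfst p) (psnd p) ∧ A (psnd p)

/-- Sequences of entries. -/
def SeqOf (A : M.Num → Prop) (s : M.Num) : Prop :=
  IsSeq s (len s) ∧ ∀ i < len s, Ent A (get s i)

/-- The Kleene-Brouwer order. -/
def KBLt (r : M.Num → M.Num → Prop) (s t : M.Num) : Prop :=
  ∃ i, i < len s ∧ (∀ j < i, get s j = get t j) ∧
    (i = len t ∨ (i < len t ∧ EntLt r (get s i) (get t i)))

theorem isLinOrd_entLt (L : LOrd M) : IsLinOrd (Ent L.mem) (EntLt L.lt) := by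
  refine ⟨fun p hp h => ?_, fun p q u hp hq hu h h' => ?_, fun p q hp hq => ?_⟩
  · exact h.elim (lt_irrefl _) fun h => L.irrefl hp.2 h.2
  · rcases h with h | ⟨h1, h2⟩ <;> rcases h' with h' | ⟨h1', h2'⟩
    · exact .inl (h.trans h')
    · exact .inl (h1' ▸ h)
    · exact .inl (h1 ▸ h')
    · exact .inr ⟨h1.trans h1', L.trans hp.2 hq.2 hu.2 h2 h2'⟩
  · rcases lt_trichotomy (pfst p) (pfst q) with h | h | h
    · exact .inl (.inl h)
    · rcases L.trichotomy hp.2 hq.2 with h' | h' | h'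
      · exact .inl (.inr ⟨h, h'⟩)
      · exact .inr (.inl (hp.1.trans ((by rw [h, h'] : _ = _).trans hq.1.symm)))
      · exact .inr (.inr (.inr ⟨h.symm, h'⟩))
    · exact .inr (.inr (.inl h))

/-- Transitivity compares the two places of first difference. For trichotomy, the least place where
the entries differ or one sequence ends decides the comparison. -/
theorem isLinOrd_KBLt (L : LOrd M) : IsLinOrd (SeqOf L.mem) (KBLt L.lt) := by
  have hE := isLinOrd_entLt L
  refine ⟨fun s hs h => ?_, fun s t u hs ht hu h h' => ?_, fun s t hs ht => ?_⟩
  · obtain ⟨i, hi, -, h | ⟨-, h⟩⟩ := h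
    · exact hi.ne h
    · exact hE.1 _ (hs.2 i hi) h
  · obtain ⟨i, hi, hij, h⟩ := h
    obtain ⟨k, hk, hkj, h'⟩ := h'
    have hit : i ≤ len t := h.elim (fun h => h.le) fun h => h.1.le
    have hku : k ≤ len u := h'.elim (fun h => h.le) fun h => h.1.le
    rcases lt_trichotomy i k with hik | rfl | hik
    · refine ⟨i, hi, fun j hj => (hij j hj).trans (hkj j (hj.trans hik)), .inr ?_⟩
      rcases h with rfl | h
      · exact absurd (hik.trans hk) (lt_irrefl _)
      · exact ⟨hik.trans_le hku, hkj i hik ▸ h.2⟩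
    · refine ⟨i, hi, fun j hj => (hij j hj).trans (hkj j hj), ?_⟩
      rcases h with rfl | h
      · exact absurd hk (lt_irrefl _)
      · exact h'.imp_right fun h' =>
          ⟨h'.1, hE.2.1 _ _ _ (hs.2 i hi) (ht.2 i hk) (hu.2 i h'.1) h.2 h'.2⟩
    · refine ⟨k, hik.trans hi, fun j hj => (hij j (hj.trans hik)).trans (hkj j hj), ?_⟩
      rwa [hij k hik]
  · by_cases hst : ∃ i, i = len s ∨ i = len t ∨ get s i ≠ get t i
    · obtain ⟨i, hi, hlt⟩ := exists_least (by fun_prop) hst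
      have his : i ≤ len s := not_lt.1 fun h => hlt _ h (.inl rfl)
      have hit : i ≤ len t := not_lt.1 fun h => hlt _ h (.inr (.inl rfl))
      have hag : ∀ j < i, get s j = get t j := fun j hj => by
        by_contra hne
        exact hlt j hj (.inr (.inr hne))
      rcases his.lt_or_eq with his | his <;> rcases hit.lt_or_eq with hit | hit
      · have hne : get s i ≠ get t i := (hi.resolve_left his.ne).resolve_left hit.ne
        rcases hE.2.2 _ _ (hs.2 i his) (ht.2 i hit) with h | h | h
        · exact .inl ⟨i, his, hag, .inr ⟨hit, h⟩⟩
        · exact absurd h hne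
        · exact .inr (.inr ⟨i, hit, fun j hj => (hag j hj).symm, .inr ⟨his, h⟩⟩)
      · exact .inl ⟨i, his, hag, .inl hit⟩
      · exact .inr (.inr ⟨i, hit, fun j hj => (hag j hj).symm, .inl his⟩)
      · refine .inr (.inl ?_)
        have hs' := hs.1
        have ht' := ht.1
        rw [← his] at hs'
        rw [← hit] at ht'
        exact hs'.ext ht' hag
    · exact absurd ⟨len s, .inl rfl⟩ hst

/-! ### Elements of the dilator -/

/-- The code of a sequence `s` with base point `g` in the component with index `c`. -/
def node (g c s : M.Num) : M.Num := pair g (pair c s) + 1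

theorem node_ne_zero (g c s : M.Num) : node g c s ≠ 0 := hM.models.succ_ne_zero _

theorem node_inj {g c s g' c' s' : M.Num} :
    node g c s = node g' c' s' ↔ g = g' ∧ c = c' ∧ s = s' := by
  unfold node
  rw [add_left_inj, pair_inj, pair_inj]

@[fun_prop] theorem Arith.node {α : Type*} [ArType M α] {f g h : α → M.Num} (hf : Arith M f)
    (hg : Arith M g) (hh : Arith M h) : Arith M fun x => node (f x) (g x) (h x) := by
  unfold L2Structure.node
  fun_prop

/-- The base point of a node. -/
noncomputable def nodeBase (σ : M.Num) : M.Num := mu fun g => ∃ c s, σ = node g c s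

/-- The index of the component of a node. -/
noncomputable def nodeIndex (σ : M.Num) : M.Num := mu fun c => ∃ g s, σ = node g c s

/-- The sequence of a node. -/
noncomputable def nodeSeq (σ : M.Num) : M.Num := mu fun s => ∃ g c, σ = node g c s

@[simp] theorem nodeBase_node (g c s : M.Num) : nodeBase (node g c s) = g :=
  mu_eq ⟨c, s, rfl⟩ fun _ ⟨_, _, h⟩ => (node_inj.1 h).1.symm

@[simp] theorem nodeIndex_node (g c s : M.Num) : nodeIndex (node g c s) = c :=
  mu_eq ⟨g, s, rfl⟩ fun _ ⟨_, _, h⟩ => (node_inj.1 h).2.1.symm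

@[simp] theorem nodeSeq_node (g c s : M.Num) : nodeSeq (node g c s) = s :=
  mu_eq ⟨g, c, rfl⟩ fun _ ⟨_, _, h⟩ => (node_inj.1 h).2.2.symm

@[fun_prop] theorem Arith.nodeBase {α : Type*} [ArType M α] {f : α → M.Num} (hf : Arith M f) :
    Arith M fun x => nodeBase (f x) := by
  unfold L2Structure.nodeBase
  fun_prop

@[fun_prop] theorem Arith.nodeIndex {α : Type*} [ArType M α] {f : α → M.Num} (hf : Arith M f) :
    Arith M fun x => nodeIndex (f x) := by
  unfold L2Structure.nodeIndex
  fun_prop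

@[fun_prop] theorem Arith.nodeSeq {α : Type*} [ArType M α] {f : α → M.Num} (hf : Arith M f) :
    Arith M fun x => nodeSeq (f x) := by
  unfold L2Structure.nodeSeq
  fun_prop

/-- Arithmetical conditions on pairs of entries, which define a family of trees: `S c i j x y`
constrains the numbers `x`, `y` at positions `i`, `j`, and `W c i j` demands that the element of the
order at position `j` is smaller than the one at position `i`. -/
structure Spec (M : L2Structure.{u}) where
  S : M.Num → M.Num → M.Num → M.Num → M.Num → Prop
  W : M.Num → M.Num → M.Num → Prop
  arith_S : Arith M fun z : M.Num × M.Num × M.Num × M.Num × M.Num =>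
    S z.1 z.2.1 z.2.2.1 z.2.2.2.1 z.2.2.2.2
  arith_W : Arith M fun z : M.Num × M.Num × M.Num => W z.1 z.2.1 z.2.2
  not_S_zero : ∀ i j x y, ¬ S 0 i j x y

namespace Spec

variable (D : Spec M)

@[fun_prop] theorem arith_S' {α : Type*} [ArType M α] {f₁ f₂ f₃ f₄ f₅ : α → M.Num}
    (h₁ : Arith M f₁) (h₂ : Arith M f₂) (h₃ : Arith M f₃) (h₄ : Arith M f₄) (h₅ : Arith M f₅) :
    Arith M fun x => D.S (f₁ x) (f₂ x) (f₃ x) (f₄ x) (f₅ x) :=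
  D.arith_S.comp (h₁.prodMk (h₂.prodMk (h₃.prodMk (h₄.prodMk h₅))))

@[fun_prop] theorem arith_W' {α : Type*} [ArType M α] {f₁ f₂ f₃ : α → M.Num}
    (h₁ : Arith M f₁) (h₂ : Arith M f₂) (h₃ : Arith M f₃) :
    Arith M fun x => D.W (f₁ x) (f₂ x) (f₃ x) :=
  D.arith_W.comp (h₁.prodMk (h₂.prodMk h₃))

/-- The sequence `s` belongs to the tree with base point `g` and index `c` over a given order. -/
def IsNode (A : M.Num → Prop) (r : M.Num → M.Num → Prop) (g c s : M.Num) : Prop :=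
  A g ∧ SeqOf A s ∧ (∀ i, i < len s → r (psnd (get s i)) g) ∧
    ∀ i j, i < len s → j < len s → D.S c i j (pfst (get s i)) (pfst (get s j)) ∧
      (D.W c i j → r (psnd (get s j)) (psnd (get s i)))

/-- The elements of the dilator over a given order. -/
def TMem (A : M.Num → Prop) (r : M.Num → M.Num → Prop) (σ : M.Num) : Prop :=
  σ = 0 ∨ ∃ g c s, σ = node g c s ∧ D.IsNode A r g c s

end Spec

/-- The order on the elements of the dilator over a given order. -/
def TLt (r : M.Num → M.Num → Prop) (σ τ : M.Num) : Prop :=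
  (σ = 0 ∧ τ ≠ 0) ∨ ∃ g c s g' c' s', σ = node g c s ∧ τ = node g' c' s' ∧
    (r g g' ∨ (g = g' ∧ (c < c' ∨ (c = c' ∧ KBLt r s s'))))

section

variable {α : Type*} [ArType M α] {A : α → M.Num → Prop} {r : α → M.Num → M.Num → Prop}
  {f g h : α → M.Num}

@[fun_prop] theorem arith_tMem (D : Spec M) (hA : Arith M fun p : α × M.Num => A p.1 p.2)
    (hr : Arith M fun p : (α × M.Num) × M.Num => r p.1.1 p.1.2 p.2) (hf : Arith M f) :
    Arith M fun x => D.TMem (A x) (r x) (f x) := by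
  have hA' : ∀ {β : Type _} [ArType M β] {f : β → α} {g : β → M.Num}, Arith M f → Arith M g →
    Arith M fun x => A (f x) (g x) := fun hf hg => hA.comp (hf.prodMk hg)
  have hr' : ∀ {β : Type _} [ArType M β] {f : β → α} {k l : β → M.Num}, Arith M f → Arith M k →
    Arith M l → Arith M fun x => r (f x) (k x) (l x) :=
    fun hf hk hl => hr.comp ((hf.prodMk hk).prodMk hl)
  unfold Spec.TMem Spec.IsNode SeqOf Ent
  have h1 : Arith M fun p : ((α × M.Num) × M.Num) × M.Num => A p.1.1.1 p.1.1.2 :=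
    hA' (by fun_prop) (by fun_prop)
  have h2 : Arith M fun p : (((α × M.Num) × M.Num) × M.Num) × M.Num =>
    A p.1.1.1.1 (psnd (get p.1.2 p.2)) := hA' (by fun_prop) (by fun_prop)
  have h3 : Arith M fun p : (((α × M.Num) × M.Num) × M.Num) × M.Num =>
    r p.1.1.1.1 (psnd (get p.1.2 p.2)) p.1.1.1.2 :=
    hr' (by fun_prop) (by fun_prop) (by fun_prop)
  have h4 : Arith M fun p : ((((α × M.Num) × M.Num) × M.Num) × M.Num) × M.Num =>
    r p.1.1.1.1.1 (psnd (get p.1.1.2 p.2)) (psnd (get p.1.1.2 p.1.2)) :=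
    hr' (by fun_prop) (by fun_prop) (by fun_prop)
  fun_prop

@[fun_prop] theorem arith_kbLt (hr : Arith M fun p : (α × M.Num) × M.Num => r p.1.1 p.1.2 p.2)
    (hf : Arith M f) (hg : Arith M g) : Arith M fun x => KBLt (r x) (f x) (g x) := by
  have hr' : ∀ {β : Type _} [ArType M β] {f : β → α} {k l : β → M.Num}, Arith M f → Arith M k →
    Arith M l → Arith M fun x => r (f x) (k x) (l x) :=
    fun hf hk hl => hr.comp ((hf.prodMk hk).prodMk hl)
  unfold KBLt EntLt
  have h1 : Arith M fun p : α × M.Num =>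
    r p.1 (psnd (get (f p.1) p.2)) (psnd (get (g p.1) p.2)) :=
    hr' (by fun_prop) (by fun_prop) (by fun_prop)
  fun_prop

@[fun_prop] theorem arith_tLt (hr : Arith M fun p : (α × M.Num) × M.Num => r p.1.1 p.1.2 p.2)
    (hf : Arith M f) (hg : Arith M g) : Arith M fun x => TLt (r x) (f x) (g x) := by
  refine Arith.of_iff (P := fun x => (f x = 0 ∧ g x ≠ 0) ∨ (f x =
    node (nodeBase (f x)) (nodeIndex (f x))
      (nodeSeq (f x)) ∧ g x = node (nodeBase (g x))
      (nodeIndex (g x)) (nodeSeq (g x)) ∧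
      (r x (nodeBase (f x)) (nodeBase (g x)) ∨
        (nodeBase (f x) = nodeBase (g x) ∧
          (nodeIndex (f x) < nodeIndex (g x) ∨
            (nodeIndex (f x) = nodeIndex (g x) ∧
              KBLt (r x) (nodeSeq (f x)) (nodeSeq (g x)))))))) ?_
    fun x => ?_
  · have h1 : Arith M fun x => r x (nodeBase (f x)) (nodeBase (g x)) :=
      hr.comp (g := fun x => ((x, nodeBase (f x)), nodeBase (g x)))
        (by fun_prop)
    have h2 : Arith M fun x => KBLt (r x) (nodeSeq (f x)) (nodeSeq (g x)) :=
      arith_kbLt hr (by fun_prop) (by fun_prop)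
    exact .or (by fun_prop) (.and (by fun_prop) (.and (by fun_prop) (.or h1 (.and (by fun_prop)
      (.or (by fun_prop) (.and (by fun_prop) h2))))))
  · refine or_congr Iff.rfl ⟨?_, fun h => ⟨_, _, _, _, _, _, h⟩⟩
    rintro ⟨a, b, c, a', b', c', h, h', hlt⟩
    rw [h, h']
    simpa using hlt

end

theorem isLinOrd_TLt (D : Spec M) (L : LOrd M) : IsLinOrd (D.TMem L.mem L.lt) (TLt L.lt) := by
  have hK := isLinOrd_KBLt L
  refine ⟨?_, ?_, ?_⟩
  · rintro σ hσ (⟨h, h'⟩ | ⟨g, c, s, g', c', s', rfl, h', h⟩)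
    · exact h' h
    · obtain ⟨rfl, rfl, rfl⟩ := node_inj.1 h'
      obtain h0 | ⟨g', c', s', h0, hn⟩ := hσ
      · exact node_ne_zero _ _ _ h0
      obtain ⟨rfl, rfl, rfl⟩ := node_inj.1 h0
      rcases h with h | ⟨-, h | ⟨-, h⟩⟩
      · exact L.irrefl hn.1 h
      · exact lt_irrefl _ h
      · exact hK.1 _ hn.2.1 h
  · rintro σ τ υ hσ hτ hυ h h'
    obtain ⟨g₂, c₂, s₂, g₃, c₃, s₃, rfl, rfl, h''⟩ := h'.resolve_left fun h0 => by
      obtain ⟨h1, h2⟩ | ⟨_, _, _, _, _, _, -, h1, -⟩ := h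
      · exact h2 h0.1
      · exact node_ne_zero _ _ _ (h1.symm.trans h0.1)
    obtain ⟨rfl, -⟩ | ⟨g₁, c₁, s₁, g₂', c₂', s₂', rfl, he, h⟩ := h
    · exact .inl ⟨rfl, node_ne_zero _ _ _⟩
    obtain ⟨e1, e2, e3⟩ := node_inj.1 he
    subst e1 e2 e3
    obtain ⟨_, _, _, he, hn₁⟩ := hσ.resolve_left (node_ne_zero _ _ _)
    obtain ⟨rfl, rfl, rfl⟩ := node_inj.1 he
    obtain ⟨_, _, _, he, hn₂⟩ := hτ.resolve_left (node_ne_zero _ _ _)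
    obtain ⟨rfl, rfl, rfl⟩ := node_inj.1 he
    obtain ⟨_, _, _, he, hn₃⟩ := hυ.resolve_left (node_ne_zero _ _ _)
    obtain ⟨rfl, rfl, rfl⟩ := node_inj.1 he
    refine .inr ⟨_, _, _, _, _, _, rfl, rfl, ?_⟩
    clear h'
    rename' h'' => h'
    rcases h with h | ⟨rfl, h⟩ <;> rcases h' with h' | ⟨rfl, h'⟩
    · exact .inl (L.trans hn₁.1 hn₂.1 hn₃.1 h h')
    · exact .inl h
    · exact .inl h'
    · refine .inr ⟨rfl, ?_⟩
      rcases h with h | ⟨rfl, h⟩ <;> rcases h' with h' | ⟨rfl, h'⟩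
      · exact .inl (h.trans h')
      · exact .inl h
      · exact .inl h'
      · exact .inr ⟨rfl, hK.2.1 _ _ _ hn₁.2.1 hn₂.2.1 hn₃.2.1 h h'⟩
  · rintro σ τ (rfl | ⟨g₁, c₁, s₁, rfl, h₁⟩) (rfl | ⟨g₂, c₂, s₂, rfl, h₂⟩)
    · exact .inr (.inl rfl)
    · exact .inl (.inl ⟨rfl, node_ne_zero _ _ _⟩)
    · exact .inr (.inr (.inl ⟨rfl, node_ne_zero _ _ _⟩))
    · rcases L.trichotomy h₁.1 h₂.1 with h | rfl | h
      · exact .inl (.inr ⟨_, _, _, _, _, _, rfl, rfl, .inl h⟩)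
      · rcases lt_trichotomy c₁ c₂ with h | rfl | h
        · exact .inl (.inr ⟨_, _, _, _, _, _, rfl, rfl, .inr ⟨rfl, .inl h⟩⟩)
        · rcases hK.2.2 s₁ s₂ h₁.2.1 h₂.2.1 with h | rfl | h
          · exact .inl (.inr ⟨_, _, _, _, _, _, rfl, rfl, .inr ⟨rfl, .inr ⟨rfl, h⟩⟩⟩)
          · exact .inr (.inl rfl)
          · exact .inr (.inr (.inr ⟨_, _, _, _, _, _, rfl, rfl, .inr ⟨rfl, .inr ⟨rfl, h⟩⟩⟩))
        · exact .inr (.inr (.inr ⟨_, _, _, _, _, _, rfl, rfl, .inr ⟨rfl, .inl h⟩⟩))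
      · exact .inr (.inr (.inr ⟨_, _, _, _, _, _, rfl, rfl, .inl h⟩))

end

end L2Structure

namespace L2Structure

variable {M : L2Structure.{u}}

/-! ### The action on embeddings -/

section

variable [hM : M.ACA]

/-- `e` codes an embedding of `k = {0, …, k - 1}` into a linear order. -/
structure Emb (e k : M.Num) (L : LOrd M) : Prop where
  isSeq : IsSeq e k
  mem : ∀ i < k, L.mem (get e i)
  lt : ∀ i j, i < j → j < k → L.lt (get e i) (get e j)

namespace Emb

variable {e k i j : M.Num} {L : LOrd M}

theorem lt_iff (he : Emb e k L) (hi : i < k) (hj : j < k) :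
    L.lt (get e i) (get e j) ↔ i < j := by
  refine ⟨fun h => ?_, fun h => he.lt i j h hj⟩
  by_contra hn
  rcases (not_lt.1 hn).lt_or_eq with h' | rfl
  · exact L.asymm (he.mem i hi) (he.mem j hj) h (he.lt j i h' hi)
  · exact L.irrefl (he.mem _ hi) h

theorem inj (he : Emb e k L) (hi : i < k) (hj : j < k) (h : get e i = get e j) : i = j := by
  rcases lt_trichotomy i j with h' | h' | h'
  · exact absurd (h ▸ he.lt i j h' hj) (L.irrefl (he.mem j hj))
  · exact h'
  · exact absurd (h ▸ he.lt j i h' hi) (L.irrefl (he.mem j hj))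

end Emb

/-- The action of a function on sequences of entries. -/
noncomputable def smap (e s : M.Num) : M.Num :=
  mkSeq (fun i => pair (pfst (get s i)) (get e (psnd (get s i)))) (len s)

open Classical in
/-- The action of a function on the elements of the dilator. -/
noncomputable def tmap (e σ : M.Num) : M.Num :=
  if σ = 0 then 0 else node (get e (nodeBase σ)) (nodeIndex σ) (smap e (nodeSeq σ))

@[fun_prop] theorem arith_smap {α : Type*} [ArType M α] {f g : α → M.Num} (hf : Arith M f)
    (hg : Arith M g) : Arith M fun x => smap (f x) (g x) := by
  unfold smap
  fun_prop

@[fun_prop] theorem arith_tmap {α : Type*} [ArType M α] {f g : α → M.Num} (hf : Arith M f)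
    (hg : Arith M g) : Arith M fun x => tmap (f x) (g x) := by
  unfold tmap
  fun_prop

theorem tmap_zero (e : M.Num) : tmap e 0 = 0 := if_pos rfl

theorem tmap_node (e g c s : M.Num) : tmap e (node g c s) = node (get e g) c (smap e s) := by
  rw [tmap, if_neg (node_ne_zero _ _ _), nodeBase_node, nodeIndex_node, nodeSeq_node]

theorem isSeq_smap (e s : M.Num) : IsSeq (smap e s) (len s) := isSeq_mkSeq (by fun_prop) _

@[simp] theorem len_smap (e s : M.Num) : len (smap e s) = len s := (isSeq_smap e s).len_eq

theorem get_smap {e s i : M.Num} (hi : i < len s) :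
    get (smap e s) i = pair (pfst (get s i)) (get e (psnd (get s i))) :=
  get_mkSeq (F := fun i => pair (pfst (get s i)) (get e (psnd (get s i)))) (by fun_prop) hi

variable {D : Spec M} {L : LOrd M} {e k : M.Num}

/-- The conditions from the trees concern first components, which are unchanged, and the remaining
ones are positive order statements, which embeddings preserve. -/
theorem isNode_smap (he : Emb e k L) {g c s : M.Num}
    (h : D.IsNode (· < k) (· < ·) g c s) : D.IsNode L.mem L.lt (get e g) c (smap e s) := by
  obtain ⟨hg, hs, hb, hp⟩ := h
  refine ⟨he.mem g hg, ⟨by simpa using isSeq_smap e s, fun i hi => ?_⟩, fun i hi => ?_,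
    fun i j hi hj => ?_⟩
  · rw [len_smap] at hi
    rw [get_smap hi]
    exact ⟨by simp, by simpa using he.mem _ (hs.2 i hi).2⟩
  · rw [len_smap] at hi
    rw [get_smap hi, psnd_pair]
    exact he.lt _ _ (hb i hi) hg
  · rw [len_smap] at hi hj
    rw [get_smap hi, get_smap hj]
    simp only [pfst_pair, psnd_pair]
    exact ⟨(hp i j hi hj).1, fun hW => he.lt _ _ ((hp i j hi hj).2 hW) (hs.2 i hi).2⟩

theorem tMem_tmap (he : Emb e k L) {σ : M.Num} (h : D.TMem (· < k) (· < ·) σ) :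
    D.TMem L.mem L.lt (tmap e σ) := by
  obtain rfl | ⟨g, c, s, rfl, h⟩ := h
  · exact .inl (tmap_zero e)
  · exact .inr ⟨_, _, _, tmap_node e g c s, isNode_smap he h⟩

theorem kbLt_smap (he : Emb e k L) {s t : M.Num} (ht : SeqOf (· < k) t)
    (h : KBLt (· < ·) s t) : KBLt L.lt (smap e s) (smap e t) := by
  obtain ⟨i, hi, hij, h⟩ := h
  have hit : i ≤ len t := h.elim (fun h => h.le) fun h => h.1.le
  refine ⟨i, by simpa using hi, fun j hj => ?_, ?_⟩
  · rw [get_smap (hj.trans hi), get_smap (hj.trans_le hit), hij j hj]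
  · rw [len_smap]
    refine h.imp_right fun h => ⟨h.1, ?_⟩
    rw [get_smap hi, get_smap h.1]
    simp only [EntLt, pfst_pair, psnd_pair]
    exact h.2.imp_right fun h' => ⟨h'.1, he.lt _ _ h'.2 (ht.2 i h.1).2⟩

theorem tLt_tmap (he : Emb e k L) {σ τ : M.Num} (hσ : D.TMem (· < k) (· < ·) σ)
    (hτ : D.TMem (· < k) (· < ·) τ) (h : TLt (· < ·) σ τ) : TLt L.lt (tmap e σ) (tmap e τ) := by
  obtain rfl | ⟨g, c, s, rfl, h₁⟩ := hσ <;> obtain rfl | ⟨g', c', s', rfl, h₂⟩ := hτ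
  · exact absurd h ((isLinOrd_TLt D (LOrd.fin 0)).1 0 (.inl rfl))
  · rw [tmap_zero, tmap_node]
    exact .inl ⟨rfl, node_ne_zero _ _ _⟩
  · obtain ⟨h, -⟩ | ⟨_, _, _, _, _, _, -, h, -⟩ := h
    · exact absurd h (node_ne_zero _ _ _)
    · exact absurd h.symm (node_ne_zero _ _ _)
  · obtain ⟨h, -⟩ | ⟨_, _, _, _, _, _, e₁, e₂, h⟩ := h
    · exact absurd h (node_ne_zero _ _ _)
    obtain ⟨rfl, rfl, rfl⟩ := node_inj.1 e₁
    obtain ⟨rfl, rfl, rfl⟩ := node_inj.1 e₂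
    rw [tmap_node, tmap_node]
    refine .inr ⟨_, _, _, _, _, _, rfl, rfl, ?_⟩
    exact h.imp (fun h => he.lt _ _ h h₂.1) fun h => ⟨congrArg _ h.1,
      h.2.imp_right fun h => ⟨h.1, kbLt_smap he h₂.2.1 h.2⟩⟩

/-- A strictly increasing map between linear orders reflects the order as well. -/
theorem tLt_tmap_iff (he : Emb e k L) {σ τ : M.Num} (hσ : D.TMem (· < k) (· < ·) σ)
    (hτ : D.TMem (· < k) (· < ·) τ) : TLt L.lt (tmap e σ) (tmap e τ) ↔ TLt (· < ·) σ τ := by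
  refine ⟨fun h => ?_, tLt_tmap he hσ hτ⟩
  have hL := isLinOrd_TLt D L
  have hσ' := tMem_tmap he hσ
  have hτ' := tMem_tmap he hτ
  rcases (isLinOrd_TLt D (LOrd.fin k)).2.2 σ τ hσ hτ with h' | rfl | h'
  · exact h'
  · exact absurd h (hL.1 _ hσ')
  · exact absurd (hL.2.1 _ _ _ hσ' hτ' hσ' h (tLt_tmap he hτ hσ h')) (hL.1 _ hσ')

theorem tmap_tmap {f g h : M.Num} (hfg : ∀ i < k, get h i = get g (get f i)) {σ : M.Num}
    (hσ : D.TMem (· < k) (· < ·) σ) : tmap g (tmap f σ) = tmap h σ := by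
  obtain rfl | ⟨b, c, s, rfl, hn⟩ := hσ
  · simp only [tmap_zero]
  · rw [tmap_node, tmap_node, tmap_node, hfg b hn.1]
    congr 1
    have h1 : IsSeq (smap g (smap f s)) (len s) := by simpa using isSeq_smap g (smap f s)
    refine h1.ext (isSeq_smap h s) fun i hi => ?_
    rw [get_smap (by simpa using hi), get_smap hi, get_smap hi, hfg _ (hn.2.1.2 i hi).2]
    simp

theorem tmap_of_forall_get {f : M.Num} (hf : ∀ i < k, get f i = i) {σ : M.Num}
    (hσ : D.TMem (· < k) (· < ·) σ) : tmap f σ = σ := by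
  obtain rfl | ⟨b, c, s, rfl, hn⟩ := hσ
  · exact tmap_zero f
  · rw [tmap_node, hf b hn.1]
    congr 1
    refine (isSeq_smap f s).ext hn.2.1.1 fun i hi => ?_
    rw [get_smap hi, hf _ (hn.2.1.2 i hi).2]
    exact (hn.2.1.2 i hi).1.symm

/-! ### Supports -/

/-- The element `y` of the order occurs in `σ`. -/
def Occ (y σ : M.Num) : Prop :=
  ∃ g c s, σ = node g c s ∧ (y = g ∨ ∃ i, i < len s ∧ y = psnd (get s i))

/-- The support of an element of the dilator. -/
noncomputable def tsupp (σ : M.Num) : M.Num := mkFin fun y => Occ y σ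

@[fun_prop] theorem arith_occ {α : Type*} [ArType M α] {f g : α → M.Num} (hf : Arith M f)
    (hg : Arith M g) : Arith M fun x => Occ (f x) (g x) := by
  unfold Occ
  fun_prop

@[fun_prop] theorem arith_tsupp {α : Type*} [ArType M α] {f : α → M.Num} (hf : Arith M f) :
    Arith M fun x => tsupp (f x) := by
  unfold tsupp
  fun_prop

theorem not_occ_zero (y : M.Num) : ¬ Occ y 0 := fun ⟨_, _, _, h, _⟩ => node_ne_zero _ _ _ h.symm

theorem occ_node {y g c s : M.Num} :
    Occ y (node g c s) ↔ y = g ∨ ∃ i, i < len s ∧ y = psnd (get s i) := by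
  constructor
  · rintro ⟨_, _, _, h, h'⟩
    obtain ⟨rfl, rfl, rfl⟩ := node_inj.1 h
    exact h'
  · exact fun h => ⟨g, c, s, rfl, h⟩

theorem exists_occ_bound (σ : M.Num) : ∃ K, ∀ y, Occ y σ → y < K := by
  by_cases h : ∃ g c s, σ = node g c s
  · obtain ⟨g, c, s, rfl⟩ := h
    obtain ⟨b, hb⟩ := exists_bound (F := fun i => psnd (get s i)) (by fun_prop) (len s)
    refine ⟨g + b + 1, fun y hy => ?_⟩
    obtain rfl | ⟨i, hi, rfl⟩ := occ_node.1 hy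
    · exact Num.lt_add_one_iff.2 le_self_add
    · exact (hb i hi).trans (Num.lt_add_one_iff.2 le_add_self)
  · exact ⟨0, fun y ⟨g, c, s, hy, _⟩ => absurd ⟨g, c, s, hy⟩ h⟩

theorem elem_tsupp {y σ : M.Num} : Elem y (tsupp σ) ↔ Occ y σ := by
  obtain ⟨K, hK⟩ := exists_occ_bound σ
  exact elem_mkFin (P := fun y => Occ y σ) (by fun_prop) hK y

theorem isFin_tsupp (σ : M.Num) : IsFin (tsupp σ) := by
  obtain ⟨K, hK⟩ := exists_occ_bound σ
  exact isFin_mkFin (P := fun y => Occ y σ) (by fun_prop) hK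

theorem occ_mem {A : M.Num → Prop} {r : M.Num → M.Num → Prop} {y σ : M.Num}
    (hσ : D.TMem A r σ) (hy : Occ y σ) : A y := by
  obtain rfl | ⟨g, c, s, rfl, h⟩ := hσ
  · exact absurd hy (not_occ_zero y)
  · obtain rfl | ⟨i, hi, rfl⟩ := occ_node.1 hy
    · exact h.1
    · exact (h.2.1.2 i hi).2

theorem occ_tmap {y f σ : M.Num} {A : M.Num → Prop} {r : M.Num → M.Num → Prop}
    (hσ : D.TMem A r σ) : Occ y (tmap f σ) ↔ ∃ i, Occ i σ ∧ y = get f i := by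
  obtain rfl | ⟨g, c, s, rfl, -⟩ := hσ
  · rw [tmap_zero]
    exact ⟨fun h => absurd h (not_occ_zero y), fun ⟨i, h, _⟩ => absurd h (not_occ_zero i)⟩
  · rw [tmap_node, occ_node, len_smap]
    constructor
    · rintro (rfl | ⟨i, hi, rfl⟩)
      · exact ⟨g, occ_node.2 (.inl rfl), rfl⟩
      · rw [get_smap hi, psnd_pair]
        exact ⟨_, occ_node.2 (.inr ⟨i, hi, rfl⟩), rfl⟩
    · rintro ⟨x, hx, rfl⟩
      obtain rfl | ⟨i, hi, rfl⟩ := occ_node.1 hx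
      · exact .inl rfl
      · exact .inr ⟨i, hi, by rw [get_smap hi, psnd_pair]⟩

/-- An element whose support is contained in the range of an embedding lies in the range of the
induced embedding. -/
theorem exists_tmap_eq (he : Emb e k L) {σ : M.Num} (hσ : D.TMem L.mem L.lt σ)
    (h : ∀ y, Occ y σ → ∃ i < k, get e i = y) :
    ∃ ρ, D.TMem (· < k) (· < ·) ρ ∧ tmap e ρ = σ := by
  obtain rfl | ⟨g, c, s, rfl, hn⟩ := hσ
  · exact ⟨0, .inl rfl, tmap_zero e⟩
  -- The preimage is found by applying the inverse of the embedding to the base point and to all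
  -- second components.
  set inv : M.Num → M.Num := fun y => mu fun i => i < k ∧ get e i = y with hinv
  have hia : Arith M inv := by
    rw [hinv]
    fun_prop
  have hi : ∀ y, Occ y (node g c s) → inv y < k ∧ get e (inv y) = y := fun y hy =>
    mu_spec (P := fun i => i < k ∧ get e i = y) (by fun_prop) (h y hy)
  have hg := hi g (occ_node.2 (.inl rfl))
  have hs : ∀ i < len s, _ := fun i hi' => hi (psnd (get s i)) (occ_node.2 (.inr ⟨i, hi', rfl⟩))
  set F : M.Num → M.Num := fun i => pair (pfst (get s i)) (inv (psnd (get s i))) with hF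
  have hFa : Arith M F := by
    rw [hF]
    fun_prop
  have hget : ∀ i < len s, get (mkSeq F (len s)) i = F i := fun i hi => get_mkSeq hFa hi
  have hlen : len (mkSeq F (len s)) = len s := len_mkSeq hFa _
  refine ⟨node (inv g) c (mkSeq F (len s)), .inr ⟨_, _, _, rfl, hg.1, ⟨?_, fun i hi => ?_⟩,
    fun i hi => ?_, fun i j hi hj => ?_⟩, ?_⟩
  · rw [hlen]
    exact isSeq_mkSeq hFa _
  · rw [hlen] at hi
    rw [hget i hi]
    exact ⟨by simp [hF], by simpa [hF] using (hs i hi).1⟩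
  · rw [hlen] at hi
    rw [hget i hi]
    simp only [hF, psnd_pair]
    rw [← he.lt_iff (hs i hi).1 hg.1, (hs i hi).2, hg.2]
    exact hn.2.2.1 i hi
  · rw [hlen] at hi hj
    rw [hget i hi, hget j hj]
    simp only [hF, psnd_pair, pfst_pair]
    rw [← he.lt_iff (hs j hj).1 (hs i hi).1, (hs i hi).2, (hs j hj).2]
    exact hn.2.2.2 i j hi hj
  · rw [tmap_node, hg.2]
    congr 1
    have h1 := isSeq_smap e (mkSeq F (len s))
    rw [hlen] at h1
    refine h1.ext hn.2.1.1 fun i hi => ?_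
    rw [get_smap (by rwa [hlen]), hget i hi]
    simp only [hF, psnd_pair, pfst_pair]
    rw [(hs i hi).2]
    exact (hn.2.1.2 i hi).1.symm

/-! ### Enumerations of finite sets -/

/-- The new element is inserted at the least position `p` whose entry is not below `b`; the later
entries move up by one. -/
theorem exists_emb_insert (he : Emb e k L) {b : M.Num} (hb : L.mem b)
    (hne : ∀ i < k, get e i ≠ b) :
    ∃ e', Emb e' (k + 1) L ∧ ∀ y, (∃ i < k + 1, get e' i = y) ↔ y = b ∨ ∃ i < k, get e i = y := by
  classical
  obtain ⟨p, hp, hpl⟩ := exists_least (P := fun p => ¬ (p < k ∧ L.lt (get e p) b)) (by fun_prop)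
    ⟨k, fun h => lt_irrefl _ h.1⟩
  have hpk : p ≤ k := not_lt.1 fun h => hpl k h fun h => lt_irrefl _ h.1
  have hlow : ∀ i < p, i < k ∧ L.lt (get e i) b := fun i hi => not_not.1 (hpl i hi)
  have hhigh : ∀ i, p ≤ i → i < k → L.lt b (get e i) := by
    intro i hpi hik
    have hpk' := hpi.trans_lt hik
    have h1 : L.lt b (get e p) := by
      rcases L.trichotomy (he.mem p hpk') hb with h | h | h
      · exact absurd ⟨hpk', h⟩ hp
      · exact absurd h (hne p hpk')
      · exact h
    rcases hpi.lt_or_eq with h | rfl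
    · exact L.trans hb (he.mem p hpk') (he.mem i hik) h1 (he.lt p i h hik)
    · exact h1
  -- The inner `mu` computes the predecessor of `i`.
  set F : M.Num → M.Num := fun i =>
    if i < p then get e i else if i = p then b else get e (mu fun j => i = j + 1) with hF
  have hFa : Arith M F := by
    rw [hF]
    fun_prop
  have F1 : ∀ i < p, F i = get e i := fun i hi => if_pos hi
  have F2 : F p = b := by
    rw [hF]
    exact (if_neg (lt_irrefl p)).trans (if_pos rfl)
  have F3 : ∀ i, p ≤ i → F (i + 1) = get e i := fun i hi => by
    have h1 : p < i + 1 := Num.lt_add_one_iff.2 hi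
    have h2 : (mu fun j => i + 1 = j + 1) = i := mu_eq rfl fun j hj => (add_right_cancel hj).symm
    rw [hF]
    simp only [if_neg h1.not_gt, if_neg h1.ne', h2]
  have cases : ∀ i, i < k + 1 → i < p ∨ i = p ∨ ∃ j, i = j + 1 ∧ p ≤ j ∧ j < k := by
    intro i hi
    rcases lt_trichotomy i p with h | h | h
    · exact .inl h
    · exact .inr (.inl h)
    · obtain rfl | ⟨j, rfl⟩ := Num.eq_zero_or_exists_succ i
      · exact absurd h (Num.not_lt_zero p)
      · exact .inr (.inr ⟨j, rfl, Num.lt_add_one_iff.1 h, lt_of_add_lt_add_right hi⟩)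
  have hget : ∀ i < k + 1, get (mkSeq F (k + 1)) i = F i := fun i hi => get_mkSeq hFa hi
  refine ⟨mkSeq F (k + 1), ⟨isSeq_mkSeq hFa _, fun i hi => ?_, fun i j hij hj => ?_⟩, fun y => ?_⟩
  · rw [hget i hi]
    obtain h | rfl | ⟨j, rfl, h, hj⟩ := cases i hi
    · rw [F1 i h]
      exact he.mem i (hlow i h).1
    · rwa [F2]
    · rw [F3 j h]
      exact he.mem j hj
  · rw [hget i (hij.trans hj), hget j hj]
    obtain h | rfl | ⟨i, rfl, h, hi⟩ := cases i (hij.trans hj) <;>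
      obtain h' | rfl | ⟨j, rfl, h', hj'⟩ := cases j hj
    · rw [F1 i h, F1 j h']
      exact he.lt i j hij (hlow j h').1
    · rw [F1 i h, F2]
      exact (hlow i h).2
    · rw [F1 i h, F3 j h']
      exact he.lt i j (h.trans_le h') hj'
    · exact absurd hij h'.not_gt
    · exact absurd hij (lt_irrefl _)
    · rw [F2, F3 j h']
      exact hhigh j h' hj'
    · exact absurd (hij.trans (h'.trans_le h)) (Num.lt_add_one i).not_gt
    · exact absurd (hij.trans_le h) (Num.lt_add_one i).not_gt
    · rw [F3 i h, F3 j h']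
      exact he.lt i j (lt_of_add_lt_add_right hij) hj'
  · constructor
    · rintro ⟨i, hi, rfl⟩
      rw [hget i hi]
      obtain h | rfl | ⟨j, rfl, h, hj⟩ := cases i hi
      · exact .inr ⟨i, (hlow i h).1, (F1 i h).symm⟩
      · exact .inl F2
      · exact .inr ⟨j, hj, (F3 j h).symm⟩
    · rintro (rfl | ⟨i, hi, rfl⟩)
      · have hp' := Num.lt_add_one_iff.2 hpk
        exact ⟨p, hp', (hget p hp').trans F2⟩
      · rcases lt_or_ge i p with h | h
        · have hi' := hi.trans (Num.lt_add_one k)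
          exact ⟨i, hi', (hget i hi').trans (F1 i h)⟩
        · have hi' : i + 1 < k + 1 := add_lt_add_left hi 1
          exact ⟨i + 1, hi', (hget _ hi').trans (F3 i h)⟩

/-- Every finite subset of a linear order has an increasing enumeration. -/
theorem exists_emb_range {P : M.Num → Prop} (hP : Arith M P) (hPL : ∀ y, P y → L.mem y) {K : M.Num}
    (hK : ∀ y, P y → y < K) : ∃ e k, Emb e k L ∧ ∀ y, P y ↔ ∃ i < k, get e i = y := by
  -- The bound `K` becomes the induction variable, and `Emb` is spelled out so that the induction
  -- predicate is visibly arithmetical.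
  suffices ∃ e k, (IsSeq e k ∧ (∀ i < k, L.mem (get e i)) ∧
      ∀ i j, i < j → j < k → L.lt (get e i) (get e j)) ∧
      ∀ y, (P y ∧ y < K) ↔ ∃ i < k, get e i = y by
    obtain ⟨e, k, ⟨h1, h2, h3⟩, h⟩ := this
    exact ⟨e, k, ⟨h1, h2, h3⟩, fun y => (Iff.intro (fun hy => ⟨hy, hK y hy⟩) And.left).trans (h y)⟩
  clear hK
  refine arith_induction (P := fun K => ∃ e k, (IsSeq e k ∧ (∀ i < k, L.mem (get e i)) ∧
      ∀ i j, i < j → j < k → L.lt (get e i) (get e j)) ∧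
      ∀ y, (P y ∧ y < K) ↔ ∃ i < k, get e i = y) (by fun_prop) ?_ (fun b ih => ?_) K
  · refine ⟨mkSeq (fun _ => 0) 0, 0, ⟨isSeq_mkSeq (by fun_prop) 0, ?_, ?_⟩, fun y => ?_⟩
    · exact fun i hi => absurd hi (Num.not_lt_zero i)
    · exact fun i j _ hj => absurd hj (Num.not_lt_zero j)
    · exact ⟨fun h => absurd h.2 (Num.not_lt_zero y), fun ⟨i, hi, _⟩ =>
        absurd hi (Num.not_lt_zero i)⟩
  · obtain ⟨e, k, ⟨h1, h2, h3⟩, h⟩ := ih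
    have hlt : ∀ y, y < b + 1 ↔ y = b ∨ y < b := fun y => by
      rw [Num.lt_add_one_iff, le_iff_lt_or_eq, or_comm]
    by_cases hb : P b
    · obtain ⟨e', ⟨h1', h2', h3'⟩, h'⟩ := exists_emb_insert ⟨h1, h2, h3⟩ (hPL b hb)
        fun i hi hib => lt_irrefl b ((h b).2 ⟨i, hi, hib⟩).2
      refine ⟨e', k + 1, ⟨h1', h2', h3'⟩, fun y => ?_⟩
      rw [h' y, ← h y, hlt]
      constructor
      · rintro ⟨h, h' | h'⟩
        · exact .inl h'
        · exact .inr ⟨h, h'⟩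
      · rintro (rfl | h)
        · exact ⟨hb, .inl rfl⟩
        · exact ⟨h.1, .inr h.2⟩
    · refine ⟨e, k, ⟨h1, h2, h3⟩, fun y => ?_⟩
      rw [← h y, hlt]
      constructor
      · rintro ⟨hy, rfl | hy'⟩
        · exact absurd hy hb
        · exact ⟨hy, hy'⟩
      · exact fun h => ⟨h.1, .inr h.2⟩

end

end L2Structure

namespace L2Structure

variable {M : L2Structure.{u}}

/-! ## The normal dilator of a family of trees -/

section

variable [hM : M.ACA]

theorem IsMor.emb {f m n : M.Num} (hf : IsMor f m n) : Emb f m (LOrd.fin n) where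
  isSeq := hf.1
  mem i hi := hf.2.1 i _ (hf.1.entry_get hi)
  lt i j hij hj := hf.2.2 i j _ _ hij (hf.1.entry_get (hij.trans hj)) (hf.1.entry_get hj)

theorem Emb.isMor {f m n : M.Num} (hf : Emb f m (LOrd.fin n)) : IsMor f m n := by
  refine ⟨hf.isSeq, fun i j hij => ?_, fun i i' j j' hii hij hij' => ?_⟩
  · obtain ⟨hi, rfl⟩ := hf.isSeq.entry_iff.1 hij
    exact hf.mem i hi
  · obtain ⟨hi, rfl⟩ := hf.isSeq.entry_iff.1 hij
    obtain ⟨hi', rfl⟩ := hf.isSeq.entry_iff.1 hij'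
    exact hf.lt i i' hii hi'

theorem isComp_iff {h f g k m : M.Num} (hh : IsSeq h k) (hf : IsSeq f k) (hg : IsSeq g m)
    (hfm : ∀ i < k, get f i < m) :
    IsComp h f g ↔ ∀ i < k, get h i = get g (get f i) := by
  constructor
  · intro hc i hi
    obtain ⟨j, hj, hj'⟩ := (hc i _).1 (hh.entry_get hi)
    rw [hf.entry_iff] at hj
    rw [hj.2, hg.entry_iff] at hj'
    exact hj'.2
  · intro h i j
    rw [hh.entry_iff]
    constructor
    · rintro ⟨hi, rfl⟩
      exact ⟨_, hf.entry_get hi, hg.entry_iff.2 ⟨hfm i hi, h i hi⟩⟩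
    · rintro ⟨x, hx, hx'⟩
      obtain ⟨hi, rfl⟩ := hf.entry_iff.1 hx
      exact ⟨hi, by rw [h i hi, (hg.entry_iff.1 hx').2]⟩

theorem isRange_iff {a e k : M.Num} (he : IsSeq e k) :
    IsRange a e ↔ ∀ y, Elem y a ↔ ∃ i < k, get e i = y := by
  refine forall_congr' fun y => iff_congr Iff.rfl (exists_congr fun i => ?_)
  rw [he.entry_iff, eq_comm]

theorem occ_lt {D : Spec M} {n y σ : M.Num} (hσ : D.TMem (· < n) (· < ·) σ) (hy : Occ y σ) :
    y < n := occ_mem (A := fun x => x < n) hσ hy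

namespace Spec

variable (D : Spec M)

/-- The coded prae-dilator of a family of trees. -/
noncomputable def data : M.PraeDilatorData where
  fieldSet := {z | D.TMem (· < pfst z) (· < ·) (psnd z)}
  ltSet := {z | TLt (· < ·) (pfst (psnd z)) (psnd (psnd z))}
  mapSet := {z | psnd (psnd (psnd z)) = tmap (pfst (psnd z)) (pfst (psnd (psnd z)))}
  suppSet := {z | psnd (psnd z) = tsupp (pfst (psnd z))}
  fieldSet_mem := Arith.mem_sets (by fun_prop)
  ltSet_mem := Arith.mem_sets (by fun_prop)
  mapSet_mem := Arith.mem_sets (by fun_prop)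
  suppSet_mem := Arith.mem_sets (by fun_prop)

variable {D} {m n f σ τ a : M.Num}

@[simp] theorem data_mem : D.data.Mem n σ ↔ D.TMem (· < n) (· < ·) σ := by
  simp [PraeDilatorData.Mem, data]

@[simp] theorem data_lt : D.data.Lt n σ τ ↔ TLt (· < ·) σ τ := by
  simp [PraeDilatorData.Lt, data]

@[simp] theorem data_map : D.data.Map m n f σ τ ↔ τ = tmap f σ := by
  simp [PraeDilatorData.Map, data]

@[simp] theorem data_supp : D.data.Supp n σ a ↔ a = tsupp σ := by
  simp [PraeDilatorData.Supp, data]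

theorem isPraeDilator (D : Spec M) : D.data.IsPraeDilator where
  linear n := by
    have h := isLinOrd_TLt D (LOrd.fin n)
    refine ⟨fun x hx => ?_, fun x y z hx hy hz => ?_, fun x y hx hy => ?_⟩
    · rw [data_lt]
      exact h.1 x (data_mem.1 hx)
    · rw [data_lt, data_lt, data_lt]
      exact h.2.1 x y z (data_mem.1 hx) (data_mem.1 hy) (data_mem.1 hz)
    · rw [data_lt, data_lt]
      exact h.2.2 x y (data_mem.1 hx) (data_mem.1 hy)
  map_fun m n f _ σ _ := ⟨tmap f σ, by simp, fun τ h => by simpa using h⟩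
  map_mem m n f hf σ τ hσ h := by
    rw [data_map] at h
    rw [data_mem] at hσ ⊢
    exact h ▸ tMem_tmap hf.emb hσ
  map_lt m n f hf σ σ' τ τ' hσ hσ' h h' hlt := by
    rw [data_map] at h h'
    rw [data_mem] at hσ hσ'
    rw [data_lt] at hlt ⊢
    exact h ▸ h' ▸ tLt_tmap hf.emb hσ hσ' hlt
  map_id n f hf σ hσ := by
    rw [data_mem] at hσ
    rw [data_map]
    exact (tmap_of_forall_get (fun i hi => ((hf.1.1.entry_iff.1 (hf.2 i hi)).2).symm) hσ).symm
  map_comp k m n f g h hf hg hh hc ρ σ τ hρ h₁ h₂ := by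
    rw [data_mem] at hρ
    rw [data_map] at h₁ h₂ ⊢
    rw [h₂, h₁]
    exact tmap_tmap ((isComp_iff hh.1 hf.1 hg.1 hf.emb.mem).1 hc) hρ
  supp_fun n σ _ := ⟨tsupp σ, by simp, fun a h => by simpa using h⟩
  supp_fin n σ a hσ h := by
    rw [data_mem] at hσ
    rw [data_supp] at h
    subst h
    exact ⟨isFin_tsupp σ, fun i hi => occ_lt hσ (elem_tsupp.1 hi)⟩
  supp_natural m n f hf σ τ a b hσ h ha hb j := by
    rw [data_mem] at hσ
    rw [data_map] at h
    rw [data_supp] at ha hb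
    subst h ha hb
    rw [elem_tsupp, occ_tmap hσ]
    refine exists_congr fun i => ?_
    rw [elem_tsupp, hf.1.entry_iff]
    exact ⟨fun h => ⟨h.1, occ_lt hσ h.1, h.2⟩, fun h => ⟨h.1, h.2.2⟩⟩
  supp_range n σ a hσ ha := by
    rw [data_mem] at hσ
    rw [data_supp] at ha
    subst ha
    obtain ⟨K, hK⟩ := exists_occ_bound σ
    obtain ⟨e, k, he, hek⟩ := exists_emb_range (L := LOrd.fin n) (P := fun y => Occ y σ)
      (by fun_prop) (fun y hy => occ_mem hσ hy) hK
    obtain ⟨ρ, hρ, hρσ⟩ := exists_tmap_eq he hσ fun y hy => (hek y).1 hy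
    refine ⟨k, e, ρ, he.isMor, (isRange_iff he.isSeq).2 fun y => elem_tsupp.trans (hek y), ?_, ?_⟩
    · rwa [data_mem]
    · rw [data_map, hρσ]

end Spec

/-- The empty sequence. -/
noncomputable def emptySeq : M.Num := mkSeq (fun _ => 0) 0

@[simp] theorem len_emptySeq : len (emptySeq : M.Num) = 0 := len_mkSeq (by fun_prop) 0

theorem isSeq_emptySeq : IsSeq (emptySeq : M.Num) 0 := isSeq_mkSeq (by fun_prop) 0

theorem isNode_emptySeq (D : Spec M) {A : M.Num → Prop} {r : M.Num → M.Num → Prop} {g : M.Num}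
    (hg : A g) (c : M.Num) : D.IsNode A r g c emptySeq := by
  refine ⟨hg, ⟨by simpa using isSeq_emptySeq, ?_⟩, ?_, ?_⟩ <;> rw [len_emptySeq]
  · exact fun i hi => absurd hi (Num.not_lt_zero i)
  · exact fun i hi => absurd hi (Num.not_lt_zero i)
  · exact fun i j hi => absurd hi (Num.not_lt_zero i)

/-- The least element of the dilator with base point `g`. -/
noncomputable def bot (g : M.Num) : M.Num := node g 0 emptySeq

@[fun_prop] theorem arith_bot {α : Type*} [ArType M α] {f : α → M.Num} (hf : Arith M f) :
    Arith M fun x => bot (f x) := by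
  unfold bot
  fun_prop

theorem tMem_bot (D : Spec M) {A : M.Num → Prop} (r : M.Num → M.Num → Prop) {g : M.Num}
    (hg : A g) : D.TMem A r (bot g) :=
  .inr ⟨_, _, _, rfl, isNode_emptySeq D hg 0⟩

theorem tmap_bot (f g : M.Num) : tmap f (bot g) = bot (get f g) := by
  rw [bot, tmap_node, bot]
  congr 1
  have h := isSeq_smap f (emptySeq : M.Num)
  rw [len_emptySeq] at h
  exact h.ext isSeq_emptySeq fun i hi => absurd hi (Num.not_lt_zero i)

theorem tLt_bot_of_node {r : M.Num → M.Num → Prop} {g c s g' : M.Num} (h : r g g') :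
    TLt r (node g c s) (bot g') :=
  .inr ⟨_, _, _, _, _, _, rfl, rfl, .inl h⟩

/-- The base point bounds all elements that occur in a node, so they lie below `m` exactly if the
base point does. A node with base point `m` cannot lie below `bot m`: no index is below 0, and by
`not_S_zero` the tree with index 0 has no nonempty sequence. -/
theorem tLt_bot_iff (D : Spec M) (L : LOrd M) {σ m : M.Num} (hm : L.mem m)
    (hσ : D.TMem L.mem L.lt σ) : TLt L.lt σ (bot m) ↔ ∀ y, Occ y σ → L.lt y m := by
  obtain rfl | ⟨g, c, s, rfl, h⟩ := hσ
  · exact iff_of_true (.inl ⟨rfl, node_ne_zero _ _ _⟩) fun y hy => absurd hy (not_occ_zero y)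
  · constructor
    · rintro (⟨h0, -⟩ | ⟨_, _, _, _, _, _, e₁, e₂, hlt⟩) y hy
      · exact absurd h0 (node_ne_zero _ _ _)
      obtain ⟨rfl, rfl, rfl⟩ := node_inj.1 e₁
      obtain ⟨rfl, rfl, rfl⟩ := node_inj.1 e₂
      have hgm : L.lt g m := by
        obtain hlt | ⟨-, hlt | ⟨rfl, i, hi, -⟩⟩ := hlt
        · exact hlt
        · exact absurd hlt (Num.not_lt_zero c)
        · exact absurd (h.2.2.2 i i hi hi).1 (D.not_S_zero _ _ _ _)
      obtain rfl | ⟨i, hi, rfl⟩ := occ_node.1 hy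
      · exact hgm
      · exact L.trans (h.2.1.2 i hi).2 h.1 hm (h.2.2.1 i hi) hgm
    · exact fun hy => tLt_bot_of_node (hy g (occ_node.2 (.inl rfl)))

/-! ### Normality of the dilator -/

namespace Spec

/-- The family of embeddings that makes the dilator normal. -/
def normalFamily : Set M.Num := {z | psnd (psnd z) = bot (pfst (psnd z))}

theorem normalFamily_mem : normalFamily ∈ M.sets :=
  Arith.mem_sets (P := fun z => psnd (psnd z) = bot (pfst (psnd z))) (by fun_prop)

theorem pair_mem_normalFamily {n m σ : M.Num} :
    pair n (pair m σ) ∈ (normalFamily : Set M.Num) ↔ σ = bot m := by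
  simp [normalFamily]

theorem isNormal (D : Spec M) : D.data.IsNormal normalFamily where
  mu_fun n m _ := ⟨bot m, pair_mem_normalFamily.2 rfl, fun σ h => pair_mem_normalFamily.1 h⟩
  mu_mem n m σ hm h := by
    rw [pair_mem_normalFamily] at h
    subst h
    exact data_mem.2 (tMem_bot D _ hm)
  mu_lt n m m' σ σ' hm _ h h' := by
    rw [pair_mem_normalFamily] at h h'
    subst h h'
    exact data_lt.2 (tLt_bot_of_node hm)
  mu_natural m n f hf i j σ τ _ hij h h' := by
    rw [pair_mem_normalFamily] at h h'
    subst h h'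
    rw [data_map, tmap_bot, (hf.1.entry_iff.1 hij).2]
  normal n m τ hm h σ a hσ ha := by
    rw [pair_mem_normalFamily] at h
    rw [data_supp] at ha
    rw [data_mem] at hσ
    subst h ha
    rw [data_lt]
    simp only [elem_tsupp]
    exact tLt_bot_iff D (LOrd.fin n) hm hσ

end Spec

/-! ### The extension of the dilator to arbitrary linear orders -/

theorem PreOrd.arith_mem (X : M.PreOrd) : Arith M X.Mem := by
  have := X.field_mem
  show Arith M fun x => x ∈ X.field
  fun_prop (disch := assumption)

theorem PreOrd.arith_lt (X : M.PreOrd) : Arith M fun z : M.Num × M.Num => X.Lt z.1 z.2 := by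
  have := X.rel_mem
  show Arith M fun z : M.Num × M.Num => pair z.1 z.2 ∈ X.rel
  fun_prop (disch := assumption)

/-- A coded linear order as an arithmetical linear order. -/
def PreOrd.toLOrd (X : M.PreOrd) (hX : X.IsLinear) : LOrd M where
  mem := X.Mem
  lt := X.Lt
  arith_mem := X.arith_mem
  arith_lt := X.arith_lt
  linear := hX

/-- By strong induction: where two increasing enumerations of the same range agree below `i`, their
next values are both the least remaining element. -/
theorem Emb.unique_aux {L : LOrd M} {e k e' k' : M.Num} (he : Emb e k L) (he' : Emb e' k' L)
    (h : ∀ y, (∃ i < k, get e i = y) ↔ ∃ i < k', get e' i = y) (i : M.Num) :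
    i < k → i < k' ∧ get e i = get e' i := by
  refine arith_strong_induction (P := fun i => i < k → i < k' ∧ get e i = get e' i) (by fun_prop)
    (fun i ih hi => ?_) i
  obtain ⟨i', hi', hii⟩ := (h _).1 ⟨i, hi, rfl⟩
  have h1 : i ≤ i' := by
    by_contra! hlt
    have h2 := (ih i' hlt (hlt.trans hi)).2
    exact hlt.ne (he.inj (hlt.trans hi) hi (h2.trans hii))
  refine ⟨h1.trans_lt hi', ?_⟩
  rcases h1.lt_or_eq with hlt | rfl
  · obtain ⟨j, hj, hji⟩ := (h _).2 ⟨i, h1.trans_lt hi', rfl⟩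
    have h2 : j < i := by
      rw [← he.lt_iff hj hi, hji, ← hii]
      exact he'.lt i i' hlt hi'
    obtain ⟨h3, h4⟩ := ih j h2 hj
    exact absurd (he'.inj h3 (h1.trans_lt hi') (h4.symm.trans hji)) h2.ne
  · exact hii.symm

theorem Emb.unique {L : LOrd M} {e k e' k' : M.Num} (he : Emb e k L) (he' : Emb e' k' L)
    (h : ∀ y, (∃ i < k, get e i = y) ↔ ∃ i < k', get e' i = y) : e = e' ∧ k = k' := by
  have hk : k = k' := by
    refine le_antisymm (not_lt.1 fun hlt => ?_) (not_lt.1 fun hlt => ?_)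
    · exact lt_irrefl _ (he.unique_aux he' h k' hlt).1
    · exact lt_irrefl _ (he'.unique_aux he (fun y => (h y).symm) k hlt).1
  subst hk
  exact ⟨he.isSeq.ext he'.isSeq fun i hi => (he.unique_aux he' h i hi).2, rfl⟩

/-- This supplies the morphisms that correspond to the inclusions `a, b ⊆ a ∪ b` in the definition
of the order on `D^T(X)`. -/
theorem Emb.exists_factor {L : LOrd M} {e k e' k' : M.Num} (he : Emb e k L) (he' : Emb e' k' L)
    (h : ∀ i < k, ∃ j < k', get e' j = get e i) :
    ∃ f, Emb f k (LOrd.fin k') ∧ ∀ i < k, get e' (get f i) = get e i := by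
  set F : M.Num → M.Num := fun i => mu fun j => j < k' ∧ get e' j = get e i with hF
  have hFa : Arith M F := by
    rw [hF]
    fun_prop
  have hFs : ∀ i < k, F i < k' ∧ get e' (F i) = get e i := fun i hi =>
    mu_spec (P := fun j => j < k' ∧ get e' j = get e i) (by fun_prop) (h i hi)
  have hget : ∀ i < k, get (mkSeq F k) i = F i := fun i hi => get_mkSeq hFa hi
  refine ⟨mkSeq F k, ⟨isSeq_mkSeq hFa k, fun i hi => ?_, fun i j hij hj => ?_⟩, fun i hi => ?_⟩
  · rw [hget i hi]
    exact (hFs i hi).1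
  · have hi := hij.trans hj
    rw [hget i hi, hget j hj]
    show F i < F j
    rw [← he'.lt_iff (hFs i hi).1 (hFs j hj).1, (hFs i hi).2, (hFs j hj).2]
    exact he.lt i j hij hj
  · rw [hget i hi]
    exact (hFs i hi).2

section

variable {X : M.PreOrd} (hX : X.IsLinear) {e k a : M.Num}

theorem PreOrd.IsEnum.emb (h : X.IsEnum e k a) (ha : ∀ x, Elem x a → X.Mem x) :
    Emb e k (X.toLOrd hX) where
  isSeq := h.1
  mem i hi := ha _ ((h.2.1 _).2 ⟨i, h.1.entry_get hi⟩)
  lt i j hij hj := h.2.2 i j _ _ hij (h.1.entry_get (hij.trans hj)) (h.1.entry_get hj)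

theorem PreOrd.IsEnum.elem_iff (h : X.IsEnum e k a) (y : M.Num) :
    Elem y a ↔ ∃ i < k, get e i = y := (isRange_iff h.1).1 h.2.1 y

theorem Emb.isEnum (h : Emb e k (X.toLOrd hX)) (ha : ∀ y, Elem y a ↔ ∃ i < k, get e i = y) :
    X.IsEnum e k a := by
  refine ⟨h.isSeq, (isRange_iff h.isSeq).2 ha, fun i i' x x' hii hx hx' => ?_⟩
  obtain ⟨hi, rfl⟩ := h.isSeq.entry_iff.1 hx
  obtain ⟨hi', rfl⟩ := h.isSeq.entry_iff.1 hx'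
  exact h.lt i i' hii hi'

/-- The element `p = ⟨a, σ⟩` of the extension corresponds to the element `σ'` of the dilator
over `X`. -/
def Rep (D : Spec M) (X : M.PreOrd) (p σ' : M.Num) : Prop :=
  ∃ a σ e k, p = pair a σ ∧ IsFin a ∧ (∀ x, Elem x a → X.Mem x) ∧ X.IsEnum e k a ∧
    D.TMem (· < k) (· < ·) σ ∧ (∀ i, Occ i σ ↔ i < k) ∧ σ' = tmap e σ

theorem arith_rep (D : Spec M) (X : M.PreOrd) :
    Arith M fun z : M.Num × M.Num => Rep D X z.1 z.2 := by
  have h1 : ∀ {α : Type u} [ArType M α] {f : α → M.Num}, Arith M f → Arith M fun x => X.Mem (f x) :=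
    fun hf => X.arith_mem.comp hf
  have h2 : ∀ {α : Type u} [ArType M α] {f g : α → M.Num}, Arith M f → Arith M g →
      Arith M fun x => X.Lt (f x) (g x) := fun hf hg => X.arith_lt.comp (hf.prodMk hg)
  unfold Rep PreOrd.IsEnum IsRange
  have h3 := h1 (α := ((((((M.Num × M.Num) × M.Num) × M.Num) × M.Num) × M.Num) × M.Num))
    (f := fun p => p.2) (by fun_prop)
  have h4 := h2 (α := (((((((((M.Num × M.Num) × M.Num) × M.Num) × M.Num) × M.Num) × M.Num) ×
    M.Num) × M.Num) × M.Num)) (f := fun p => p.1.2) (g := fun p => p.2) (by fun_prop) (by fun_prop)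
  fun_prop

variable {D : Spec M} {p q σ τ : M.Num}

/-- Together with the next lemmas, this identifies `D^T(X)` with the trees built directly over `X`,
where one can argue without enumerations. -/
theorem dMem_iff : D.data.DMem X p ↔ ∃ σ', Rep D X p σ' := by
  constructor
  · rintro ⟨a, σ, rfl, ha, haX, e, k, he, hσ, s, hs, hsk⟩
    rw [Spec.data_mem] at hσ
    rw [Spec.data_supp] at hs
    subst hs
    exact ⟨_, a, σ, e, k, rfl, ha, haX, he, hσ, fun i => elem_tsupp.symm.trans (hsk i), rfl⟩
  · rintro ⟨_, a, σ, e, k, rfl, ha, haX, he, hσ, hk, rfl⟩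
    exact ⟨a, σ, rfl, ha, haX, e, k, he, Spec.data_mem.2 hσ, tsupp σ, Spec.data_supp.2 rfl,
      fun i => elem_tsupp.trans (hk i)⟩

include hX

theorem Rep.tMem (h : Rep D X p σ) : D.TMem X.Mem X.Lt σ := by
  obtain ⟨a, σ, e, k, rfl, ha, haX, he, hσ, hk, rfl⟩ := h
  exact tMem_tmap (he.emb hX haX) hσ

/-- The finite set is the support of `σ`, and the second component is the preimage of `σ` under its
increasing enumeration. -/
theorem exists_rep (hσ : D.TMem X.Mem X.Lt σ) : ∃ p, Rep D X p σ := by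
  obtain ⟨K, hK⟩ := exists_occ_bound σ
  obtain ⟨e, k, he, hek⟩ := exists_emb_range (L := X.toLOrd hX) (P := fun y => Occ y σ)
    (by fun_prop) (fun y hy => occ_mem hσ hy) hK
  obtain ⟨ρ, hρ, rfl⟩ := exists_tmap_eq he hσ fun y hy => (hek y).1 hy
  refine ⟨_, _, ρ, e, k, rfl, isFin_tsupp (tmap e ρ), fun x hx => ?_, he.isEnum hX fun y => ?_, hρ,
    fun i => ⟨fun hi => occ_lt hρ hi, fun hi => ?_⟩, rfl⟩
  · exact occ_mem hσ (elem_tsupp.1 hx)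
  · rw [elem_tsupp]
    exact hek y
  · obtain ⟨j, hj, hji⟩ := (occ_tmap hρ).1 ((hek _).2 ⟨i, hi, rfl⟩)
    rwa [he.inj hi (occ_lt hρ hj) hji]

theorem Rep.tLt_of_dLt (hp : Rep D X p σ) (hq : Rep D X q τ) (h : D.data.DLt X p q) :
    TLt X.Lt σ τ := by
  obtain ⟨a, σ, e, k, rfl, ha, haX, he, hσ, hk, rfl⟩ := hp
  obtain ⟨b, τ, e', k', rfl, hb, hbX, he', hτ, hk', rfl⟩ := hq
  obtain ⟨a', σ', b', τ', h₁, h₂, c, hc, hcab, ea, ka, eb, kb, ec, kc, hea, heb, hec, f, g, hf,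
    hfc, hg, hgc, σ'', τ'', hσ', hτ', hlt⟩ := h
  obtain ⟨e1, e2⟩ := pair_inj.1 h₁
  obtain ⟨e3, e4⟩ := pair_inj.1 h₂
  subst e1 e2 e3 e4
  have hcX : ∀ x, Elem x c → X.Mem x := fun x hx => ((hcab x).1 hx).elim (haX x) (hbX x)
  obtain ⟨e5, e6⟩ := (he.emb hX haX).unique (hea.emb hX haX)
    fun y => (he.elem_iff y).symm.trans (hea.elem_iff y)
  obtain ⟨e7, e8⟩ := (he'.emb hX hbX).unique (heb.emb hX hbX)
    fun y => (he'.elem_iff y).symm.trans (heb.elem_iff y)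
  subst e5 e6 e7 e8
  rw [Spec.data_map] at hσ' hτ'
  rw [Spec.data_lt] at hlt
  subst hσ' hτ'
  have h1 := (isComp_iff hea.1 hf.1 hec.1 hf.emb.mem).1 hfc
  have h2 := (isComp_iff heb.1 hg.1 hec.1 hg.emb.mem).1 hgc
  rw [← tmap_tmap h1 hσ, ← tmap_tmap h2 hτ]
  exact tLt_tmap (hec.emb hX hcX) (tMem_tmap hf.emb hσ) (tMem_tmap hg.emb hτ) hlt

/-- Both elements factor through the enumeration of `a ∪ b`, which reflects the order by
`tLt_tmap_iff`. -/
theorem Rep.dLt_of_tLt (hp : Rep D X p σ) (hq : Rep D X q τ) (h : TLt X.Lt σ τ) :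
    D.data.DLt X p q := by
  obtain ⟨a, σ, e, k, rfl, ha, haX, he, hσ, hk, rfl⟩ := hp
  obtain ⟨b, τ, e', k', rfl, hb, hbX, he', hτ, hk', rfl⟩ := hq
  have hab : ∀ x, Elem x a ∨ Elem x b → x < a + b := fun x hx => hx.elim
    (fun h => h.lt.trans_le le_self_add) fun h => h.lt.trans_le le_add_self
  have hP : Arith M fun x => Elem x a ∨ Elem x b := by fun_prop
  obtain ⟨ec, kc, hec, hr⟩ := exists_emb_range (L := X.toLOrd hX) hP
    (fun x hx => hx.elim (haX x) (hbX x)) hab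
  have hea := he.emb hX haX
  have heb := he'.emb hX hbX
  obtain ⟨f, hf, hfe⟩ := hea.exists_factor hec fun i hi =>
    (hr _).1 (.inl ((he.elem_iff _).2 ⟨i, hi, rfl⟩))
  obtain ⟨g, hg, hge⟩ := heb.exists_factor hec fun i hi =>
    (hr _).1 (.inr ((he'.elem_iff _).2 ⟨i, hi, rfl⟩))
  refine ⟨a, σ, b, τ, rfl, rfl, mkFin fun x => Elem x a ∨ Elem x b, isFin_mkFin hP hab,
    fun x => elem_mkFin hP hab x, e, k, e', k', ec, kc, he, he',
    hec.isEnum hX fun y => (elem_mkFin hP hab y).trans (hr y), f, g, hf.isMor,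
    (isComp_iff he.1 hf.isSeq hec.isSeq hf.mem).2 fun i hi => (hfe i hi).symm, hg.isMor,
    (isComp_iff he'.1 hg.isSeq hec.isSeq hg.mem).2 fun i hi => (hge i hi).symm,
    tmap f σ, tmap g τ, Spec.data_map.2 rfl, Spec.data_map.2 rfl, Spec.data_lt.2 ?_⟩
  refine (tLt_tmap_iff hec (tMem_tmap hf hσ) (tMem_tmap hg hτ)).1 ?_
  rw [tmap_tmap (fun i hi => (hfe i hi).symm) hσ, tmap_tmap (fun i hi => (hge i hi).symm) hτ]
  exact h

end

end

end L2Structure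

namespace L2Structure

variable {M : L2Structure.{u}}

/-! ### Well-foundedness -/

section

variable [hM : M.ACA]

/-- Every nonempty arithmetical subset has a minimal element. -/
def WFOn (A : M.Num → Prop) (r : M.Num → M.Num → Prop) : Prop :=
  ∀ P : M.Num → Prop, Arith M P → (∃ y, P y) → (∀ y, P y → A y) → ∃ y, P y ∧ ∀ z, P z → ¬ r z y

theorem IsWellFounded.wfOn {A : M.Num → Prop} {r : M.Num → M.Num → Prop}
    (h : IsWellFounded A r) : WFOn A r := fun P hP hne hA => h {y | P y} hP.mem_sets hne hA

variable {L : LOrd M}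

theorem WFOn.entLt (hL : WFOn L.mem L.lt) : WFOn (Ent L.mem) (EntLt L.lt) := by
  rintro P hP ⟨p₀, hp₀⟩ hA
  obtain ⟨x, ⟨p₁, hp₁, hx⟩, hxmin⟩ := exists_least (P := fun x => ∃ p, P p ∧ pfst p = x)
    (by fun_prop) ⟨_, p₀, hp₀, rfl⟩
  obtain ⟨a, ⟨p, hp, hpx, rfl⟩, hmin⟩ := hL (fun a => ∃ p, P p ∧ pfst p = x ∧ psnd p = a)
    (by fun_prop) ⟨_, p₁, hp₁, hx, rfl⟩ (by rintro a ⟨p, hp, -, rfl⟩; exact (hA p hp).2)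
  refine ⟨p, hp, fun q hq hlt => ?_⟩
  rcases hlt with h | ⟨h, h'⟩
  · exact hxmin _ (hpx ▸ h) ⟨q, hq, rfl⟩
  · exact hmin _ ⟨q, hq, h.trans hpx, rfl⟩ h'

/-- The sequence `s` is an initial segment of the leftmost branch of the tree generated by `Z`. -/
def Leftmost (Z : M.Num → Prop) (r : M.Num → M.Num → Prop) (s : M.Num) : Prop :=
  IsSeq s (len s) ∧ (∃ t, Z t ∧ len s ≤ len t ∧ ∀ i < len s, get t i = get s i) ∧
    ∀ i < len s, ∀ t, Z t → i < len t → (∀ j < i, get t j = get s j) →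
      ¬ EntLt r (get t i) (get s i)

section

variable {Z : M.Num → Prop} (hZ : Arith M Z) (hZL : ∀ s, Z s → SeqOf L.mem s)

include hZ in
theorem arith_leftmost : Arith M (Leftmost Z L.lt) := by
  unfold Leftmost EntLt
  fun_prop

include hZL in
-- At the first place of disagreement, each segment would forbid the other to have a smaller entry.
theorem Leftmost.get_eq {s s' : M.Num} (hs : Leftmost Z L.lt s) (hs' : Leftmost Z L.lt s')
    (i : M.Num) : i < len s → i < len s' → get s i = get s' i := by
  refine arith_strong_induction (P := fun i => i < len s → i < len s' → get s i = get s' i)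
    (by fun_prop) (fun i ih hi hi' => ?_) i
  obtain ⟨t, ht, hlt, hts⟩ := hs.2.1
  obtain ⟨t', ht', hlt', hts'⟩ := hs'.2.1
  have h1 : ¬ EntLt L.lt (get s i) (get s' i) := by
    rw [← hts i hi]
    refine hs'.2.2 i hi' t ht (hi.trans_le hlt) fun j hj => ?_
    rw [hts j (hj.trans hi), ih j hj (hj.trans hi) (hj.trans hi')]
  have h2 : ¬ EntLt L.lt (get s' i) (get s i) := by
    rw [← hts' i hi']
    refine hs.2.2 i hi t' ht' (hi'.trans_le hlt') fun j hj => ?_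
    rw [hts' j (hj.trans hi'), ih j hj (hj.trans hi) (hj.trans hi')]
  have e1 := (hZL t ht).2 i (hi.trans_le hlt)
  have e2 := (hZL t' ht').2 i (hi'.trans_le hlt')
  rw [hts i hi] at e1
  rw [hts' i hi'] at e2
  rcases (isLinOrd_entLt L).2.2 _ _ e1 e2 with h | h | h
  · exact absurd h h1
  · exact h
  · exact absurd h h2

include hZ hZL in
-- The leftmost branch is built by induction on its length. A leftmost segment `s` without proper
-- extension in `Z` would itself belong to `Z`. Some member of `Z` would then lie below it, and this
-- could neither extend `s` nor branch off to the left.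
theorem exists_leftmost (hL : WFOn L.mem L.lt) (hne : ∃ s, Z s)
    (hmin : ∀ s, Z s → ∃ t, Z t ∧ KBLt L.lt t s) (k : M.Num) :
    ∃ s, Leftmost Z L.lt s ∧ len s = k := by
  have hla := arith_leftmost (L := L) hZ
  refine arith_induction (P := fun k => ∃ s, Leftmost Z L.lt s ∧ len s = k) (by fun_prop) ?_
    (fun k ih => ?_) k
  · obtain ⟨t, ht⟩ := hne
    refine ⟨emptySeq, ⟨by simpa using isSeq_emptySeq, ⟨t, ht, by simp, ?_⟩, ?_⟩, len_emptySeq⟩ <;>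
      rw [len_emptySeq] <;> exact fun i hi => absurd hi (Num.not_lt_zero i)
  · obtain ⟨s, hs, rfl⟩ := ih
    have hext : ∃ t, Z t ∧ len s < len t ∧ ∀ i < len s, get t i = get s i := by
      by_contra! hno
      obtain ⟨t, ht, hlt, hts⟩ := hs.2.1
      rcases hlt.lt_or_eq with h | h
      · obtain ⟨i, hi, hne⟩ := hno t ht h
        exact hne (hts i hi)
      have hst : t = s := by
        have h1 := (hZL t ht).1
        rw [← h] at h1
        exact h1.ext hs.1 hts
      subst hst
      obtain ⟨t', ht', i, hi, hag, h'⟩ := hmin t ht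
      rcases h' with rfl | h'
      · obtain ⟨j, hj, hne⟩ := hno t' ht' hi
        exact hne (hag j hj)
      · exact hs.2.2 i h'.1 t' ht' hi hag h'.2
    -- Well-foundedness of the entries provides the least possible next entry `x`.
    obtain ⟨x, ⟨t, ht, hlt, hts, rfl⟩, hx⟩ := hL.entLt
      (fun x => ∃ t, Z t ∧ len s < len t ∧ (∀ i < len s, get t i = get s i) ∧ get t (len s) = x)
      (by fun_prop) (by obtain ⟨t, h1, h2, h3⟩ := hext; exact ⟨_, t, h1, h2, h3, rfl⟩)
      (by rintro x ⟨t, h1, h2, -, rfl⟩; exact (hZL t h1).2 _ h2)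
    have hta : Arith M fun i => get t i := by fun_prop
    have hget : ∀ i < len s + 1, get (mkSeq (fun i => get t i) (len s + 1)) i = get t i :=
      fun i hi => get_mkSeq hta hi
    have hlen : len (mkSeq (fun i => get t i) (len s + 1)) = len s + 1 := len_mkSeq hta _
    refine ⟨mkSeq (fun i => get t i) (len s + 1), ⟨?_, ⟨t, ht, ?_, ?_⟩, ?_⟩, hlen⟩ <;> rw [hlen]
    · exact isSeq_mkSeq hta _
    · exact Num.add_one_le_iff.2 hlt
    · exact fun i hi => (hget i hi).symm
    · intro i hi t' ht' hit' hag
      rw [hget i hi]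
      rcases (Num.lt_add_one_iff.1 hi).lt_or_eq with h | rfl
      · rw [hts i h]
        refine hs.2.2 i h t' ht' hit' fun j hj => ?_
        rw [hag j hj, hget j (hj.trans hi), hts j (hj.trans h)]
      · refine hx _ ⟨t', ht', hit', fun j hj => ?_, rfl⟩
        rw [hag j hj, hget j (hj.trans hi), hts j hj]

include hZ hZL in
/-- A nonempty set of sequences without a minimal element in the Kleene-Brouwer order generates a
tree with an infinite branch. -/
theorem exists_branch (hL : WFOn L.mem L.lt) (hne : ∃ s, Z s)
    (hmin : ∀ s, Z s → ∃ t, Z t ∧ KBLt L.lt t s) :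
    ∃ F : M.Num → M.Num, Arith M F ∧ ∀ k, ∃ t, Z t ∧ k ≤ len t ∧ ∀ i < k, get t i = F i := by
  have hla := arith_leftmost (L := L) hZ
  -- By `Leftmost.get_eq` it does not matter which leftmost segment `mu` selects for each position.
  refine ⟨fun i => get (mu fun s => Leftmost Z L.lt s ∧ len s = i + 1) i, by fun_prop,
    fun k => ?_⟩
  obtain ⟨s, hs, rfl⟩ := exists_leftmost hZ hZL hL hne hmin k
  obtain ⟨t, ht, hlt, hts⟩ := hs.2.1
  refine ⟨t, ht, hlt, fun i hi => (hts i hi).trans ?_⟩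
  obtain ⟨h1, h2⟩ := mu_spec (P := fun s => Leftmost Z L.lt s ∧ len s = i + 1) (by fun_prop)
    (exists_leftmost hZ hZL hL hne hmin (i + 1))
  exact hs.get_eq hZL h1 i hi (h2.symm ▸ Num.lt_add_one i)

end

namespace Spec

variable (D : Spec M)

/-- An infinite branch of the tree with index `c` over a linear order. -/
def IsBranch (L : LOrd M) (c : M.Num) (F : M.Num → M.Num) : Prop :=
  (∀ i, L.mem (psnd (F i))) ∧ ∀ i j, D.S c i j (pfst (F i)) (pfst (F j)) ∧
    (D.W c i j → L.lt (psnd (F j)) (psnd (F i)))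

variable {D}

/-- Minimise the base point, then the index. If the remaining sequences have no minimum in the
Kleene-Brouwer order, they generate a branch; the conditions on a branch concern two positions at a
time and are thus inherited from finite sequences. -/
theorem wfOn_TLt (hL : WFOn L.mem L.lt) (hD : ∀ c F, Arith M F → ¬ D.IsBranch L c F) :
    WFOn (D.TMem L.mem L.lt) (TLt L.lt) := by
  rintro P hP ⟨σ₀, hσ₀⟩ hA
  have hlt0 : ∀ {σ}, ¬ TLt L.lt σ 0 := by
    rintro σ (⟨-, h⟩ | ⟨_, _, _, _, _, _, -, h, -⟩)
    · exact h rfl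
    · exact node_ne_zero _ _ _ h.symm
  by_cases h0 : P 0
  · exact ⟨0, h0, fun _ _ => hlt0⟩
  have hnode : ∀ σ, P σ → ∃ g c s, σ = node g c s ∧ D.IsNode L.mem L.lt g c s := fun σ hσ =>
    (hA σ hσ).resolve_left fun h => h0 (h ▸ hσ)
  have hn : ∀ {g c s}, P (node g c s) → D.IsNode L.mem L.lt g c s := fun h => by
    obtain ⟨_, _, _, he, hn⟩ := hnode _ h
    obtain ⟨rfl, rfl, rfl⟩ := node_inj.1 he
    exact hn
  obtain ⟨g₀, c₀, s₀, rfl, -⟩ := hnode σ₀ hσ₀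
  obtain ⟨g, ⟨c₁, s₁, h₁⟩, hg⟩ := hL (fun g => ∃ c s, P (node g c s)) (by fun_prop)
    ⟨g₀, c₀, s₀, hσ₀⟩ fun g ⟨c, s, h⟩ => (hn h).1
  obtain ⟨c, ⟨s₂, h₂⟩, hc⟩ := exists_least (P := fun c => ∃ s, P (node g c s)) (by fun_prop)
    ⟨c₁, s₁, h₁⟩
  by_cases hmin : ∃ s, P (node g c s) ∧ ∀ t, P (node g c t) → ¬ KBLt L.lt t s
  · obtain ⟨s, hs, hmin⟩ := hmin
    refine ⟨_, hs, fun τ hτ hlt => ?_⟩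
    rcases hlt with ⟨rfl, -⟩ | ⟨g', c', s', _, _, _, rfl, he, hlt⟩
    · exact h0 hτ
    obtain ⟨rfl, rfl, rfl⟩ := node_inj.1 he
    rcases hlt with hlt | ⟨rfl, hlt | ⟨rfl, hlt⟩⟩
    · exact hg g' ⟨c', s', hτ⟩ hlt
    · exact hc c' hlt ⟨s', hτ⟩
    · exact hmin s' hτ hlt
  · push Not at hmin
    obtain ⟨F, hF, hbr⟩ := exists_branch (Z := fun s => P (node g c s)) (by fun_prop)
      (fun s hs => (hn hs).2.1) hL ⟨s₂, h₂⟩ hmin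
    refine absurd ⟨fun i => ?_, fun i j => ?_⟩ (hD c F hF)
    · obtain ⟨t, ht, hk, hti⟩ := hbr (i + 1)
      rw [← hti i (Num.lt_add_one i)]
      exact ((hn ht).2.1.2 i ((Num.lt_add_one i).trans_le hk)).2
    · obtain ⟨t, ht, hk, hti⟩ := hbr (i + j + 1)
      have hi : i < i + j + 1 := Num.lt_add_one_iff.2 le_self_add
      have hj : j < i + j + 1 := Num.lt_add_one_iff.2 le_add_self
      rw [← hti i hi, ← hti j hj]
      exact (hn ht).2.2.2 i j (hi.trans_le hk) (hj.trans_le hk)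

theorem isWellFounded_dLt {X : M.PreOrd} (hX : X.IsLinear)
    (hT : WFOn (D.TMem X.Mem X.Lt) (TLt X.Lt)) :
    IsWellFounded (D.data.DMem X) (D.data.DLt X) := by
  rintro Y hY ⟨p₀, hp₀⟩ hYD
  have hr : Arith M fun z : M.Num × M.Num => Rep D X z.2 z.1 :=
    (arith_rep D X).comp (g := fun z : M.Num × M.Num => (z.2, z.1)) (by fun_prop)
  obtain ⟨σ₀, hσ₀⟩ := dMem_iff.1 (hYD p₀ hp₀)
  obtain ⟨σ, ⟨p, hp, hpσ⟩, hmin⟩ := hT (fun σ => ∃ p, p ∈ Y ∧ Rep D X p σ)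
    (by fun_prop (disch := assumption)) ⟨σ₀, p₀, hp₀, hσ₀⟩ fun σ ⟨p, _, hp⟩ => hp.tMem hX
  refine ⟨p, hp, fun q hq hlt => ?_⟩
  obtain ⟨τ, hτ⟩ := dMem_iff.1 (hYD q hq)
  exact hmin τ ⟨q, hq, hτ⟩ (hτ.tLt_of_dLt hX hpσ hlt)

end Spec

end

end L2Structure

namespace L2Structure

variable {M : L2Structure.{u}}

/-! ## Induction -/

section

variable [hM : M.ACA]

/-- The sequence `t` is a proper extension of `s`. -/
def Ext (s t : M.Num) : Prop := len s < len t ∧ ∀ i < len s, get s i = get t i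

@[fun_prop] theorem arith_ext {α : Type*} [ArType M α] {f g : α → M.Num} (hf : Arith M f)
    (hg : Arith M g) : Arith M fun x => Ext (f x) (g x) := by
  unfold Ext
  fun_prop

theorem ext_mkSeq {F : M.Num → M.Num} (hF : Arith M F) (k : M.Num) :
    Ext (mkSeq F k) (mkSeq F (k + 1)) := by
  refine ⟨?_, fun i hi => ?_⟩
  · rw [len_mkSeq hF, len_mkSeq hF]
    exact Num.lt_add_one k
  · rw [len_mkSeq hF] at hi
    rw [get_mkSeq hF hi, get_mkSeq hF (hi.trans (Num.lt_add_one k))]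

/-- Arithmetical conditions on pairs of entries of sequences, which define a family of trees. -/
structure TreeFamily (M : L2Structure.{u}) where
  S : M.Num → M.Num → M.Num → M.Num → M.Num → Prop
  arith_S : Arith M fun z : M.Num × M.Num × M.Num × M.Num × M.Num =>
    S z.1 z.2.1 z.2.2.1 z.2.2.2.1 z.2.2.2.2
  not_S_zero : ∀ i j x y, ¬ S 0 i j x y

/-! ### Trees, rank functions and the dilator property -/

namespace TreeFamily

variable (D : TreeFamily M)

@[fun_prop] theorem arith_S' {α : Type*} [ArType M α] {f₁ f₂ f₃ f₄ f₅ : α → M.Num}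
    (h₁ : Arith M f₁) (h₂ : Arith M f₂) (h₃ : Arith M f₃) (h₄ : Arith M f₄) (h₅ : Arith M f₅) :
    Arith M fun x => D.S (f₁ x) (f₂ x) (f₃ x) (f₄ x) (f₅ x) :=
  D.arith_S.comp (h₁.prodMk (h₂.prodMk (h₃.prodMk (h₄.prodMk h₅))))

/-- The sequence `s` belongs to the `d`-th tree. -/
def InTree (d s : M.Num) : Prop :=
  IsSeq s (len s) ∧ ∀ i j, i < len s → j < len s → D.S d i j (get s i) (get s j)

@[fun_prop] theorem arith_inTree {α : Type*} [ArType M α] {f g : α → M.Num} (hf : Arith M f)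
    (hg : Arith M g) : Arith M fun x => D.InTree (f x) (g x) := by
  unfold InTree
  fun_prop

/-- An infinite branch of the `d`-th tree. -/
def IsPath (d : M.Num) (F : M.Num → M.Num) : Prop := ∀ i j, D.S d i j (F i) (F j)

/-- The `d`-th tree has no infinite branch. -/
def NoPath (d : M.Num) : Prop := ∀ F, Arith M F → ¬ D.IsPath d F

variable {D}

theorem IsPath.inTree {d : M.Num} {F : M.Num → M.Num} (h : D.IsPath d F) (hF : Arith M F)
    (k : M.Num) : D.InTree d (mkSeq F k) := by
  refine ⟨?_, ?_⟩ <;> rw [len_mkSeq hF]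
  · exact isSeq_mkSeq hF k
  · intro i j hi hj
    rw [get_mkSeq hF hi, get_mkSeq hF hj]
    exact h i j

variable (D) in
/-- A rank function of the `d`-th tree. -/
def IsRank (L : LOrd M) (d : M.Num) (R : M.Num → M.Num) : Prop :=
  (∀ s, L.mem (R s)) ∧ ∀ s t, D.InTree d s → D.InTree d t → Ext s t → L.lt (R t) (R s)

/-- Along a branch, the ranks of the initial segments would form a set without minimal element. -/
theorem IsRank.noPath {L : LOrd M} {d : M.Num} {R : M.Num → M.Num} (h : D.IsRank L d R)
    (hR : Arith M R) (hL : WFOn L.mem L.lt) : D.NoPath d := by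
  intro F hF hp
  obtain ⟨_, ⟨k, rfl⟩, hk⟩ := hL (fun a => ∃ k, R (mkSeq F k) = a) (by fun_prop) ⟨_, 0, rfl⟩
    (by rintro _ ⟨k, rfl⟩; exact h.1 _)
  exact hk _ ⟨k + 1, rfl⟩ (h.2 _ _ (hp.inTree hF k) (hp.inTree hF (k + 1)) (ext_mkSeq hF k))

variable (D) in
/-- In the tree with index `d + 1`, branches of the `(d + 1)`-st tree are combined with rank
functions of the `d`-th tree. -/
def spec : Spec M where
  S := D.S
  W c i j := ∃ d, c = d + 1 ∧ D.InTree d i ∧ D.InTree d j ∧ Ext i j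
  arith_S := D.arith_S
  arith_W := by fun_prop
  not_S_zero := D.not_S_zero

/-- The second components of the branch form a rank function of the `d`-th tree, while the first
components would be a path through the next tree, against `hstep`. -/
theorem not_isBranch (hstep : ∀ d, D.NoPath d → D.NoPath (d + 1)) {L : LOrd M}
    (hL : WFOn L.mem L.lt) (c : M.Num) (F : M.Num → M.Num) (hF : Arith M F) :
    ¬ D.spec.IsBranch L c F := by
  rintro ⟨hmem, hF'⟩
  obtain rfl | ⟨d, rfl⟩ := Num.eq_zero_or_exists_succ c
  · exact D.not_S_zero _ _ _ _ (hF' 0 0).1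
  · have hrank : D.IsRank L d fun i => psnd (F i) :=
      ⟨hmem, fun s t hs ht hst => (hF' s t).2 ⟨d, rfl, hs, ht, hst⟩⟩
    exact hstep d (hrank.noPath (by fun_prop) hL) (fun i => pfst (F i)) (by fun_prop)
      fun i j => (hF' i j).1

theorem isDilator (hstep : ∀ d, D.NoPath d → D.NoPath (d + 1)) : D.spec.data.IsDilator := by
  refine ⟨D.spec.isPraeDilator, fun X hX => Spec.isWellFounded_dLt hX.1 ?_⟩
  have hL : WFOn (X.toLOrd hX.1).mem (X.toLOrd hX.1).lt := hX.2.wfOn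
  exact Spec.wfOn_TLt hL (not_isBranch hstep hL)

end TreeFamily

theorem mkSeq_congr {F G : M.Num → M.Num} {l : M.Num} (h : ∀ i < l, F i = G i) :
    mkSeq F l = mkSeq G l := by
  unfold mkSeq
  congr 1
  funext p
  refine propext (exists_congr fun i => and_congr_right fun hi => ?_)
  rw [h i hi]

/-- A strictly increasing arithmetical map from the dilator over an order to the order itself. -/
structure Collapse (D : TreeFamily M) (L : LOrd M) where
  map : M.Num → M.Num
  arith_map : Arith M map
  mem : ∀ σ, D.spec.TMem L.mem L.lt σ → L.mem (map σ)
  lt : ∀ σ τ, D.spec.TMem L.mem L.lt σ → D.spec.TMem L.mem L.lt τ → TLt L.lt σ τ →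
    L.lt (map σ) (map τ)

theorem exists_collapse (D : TreeFamily M) {X : M.PreOrd} {ξ : Set M.Num} (hξ : ξ ∈ M.sets)
    (h : D.spec.data.IsFixedPoint X ξ) : Nonempty (Collapse D (X.toLOrd h.linear)) := by
  have hX := h.linear
  have hr : Arith M fun z : M.Num × M.Num => Rep D.spec X z.1 z.2 := arith_rep D.spec X
  have hr' : ∀ {α : Type u} [ArType M α] {f g : α → M.Num}, Arith M f → Arith M g →
      Arith M fun x => Rep D.spec X (f x) (g x) := fun hf hg => hr.comp (hf.prodMk hg)
  have ha : Arith M fun z : (M.Num × M.Num) × M.Num =>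
      Rep D.spec X z.2 z.1.1 ∧ pair z.2 z.1.2 ∈ ξ :=
    (hr' (by fun_prop) (by fun_prop)).and (by fun_prop (disch := assumption))
  have hspec : ∀ σ, D.spec.TMem X.Mem X.Lt σ → ∃ p, Rep D.spec X p σ ∧
      pair p (mu fun x => ∃ p, Rep D.spec X p σ ∧ pair p x ∈ ξ) ∈ ξ := fun σ hσ => by
    have ha' : Arith M fun x => ∃ p, Rep D.spec X p σ ∧ pair p x ∈ ξ :=
      Arith.ex ((hr' (by fun_prop) (by fun_prop)).and (by fun_prop (disch := assumption)))
    refine mu_spec ha' ?_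
    obtain ⟨p, hp⟩ := exists_rep hX hσ
    obtain ⟨x, hx, -⟩ := h.fun_ p (dMem_iff.2 ⟨σ, hp⟩)
    exact ⟨x, p, hp, hx⟩
  -- Any representative `p` of `σ` serves, so its uniqueness is not required.
  refine ⟨fun σ => mu fun x => ∃ p, Rep D.spec X p σ ∧ pair p x ∈ ξ, by fun_prop,
    fun σ hσ => ?_, fun σ τ hσ hτ hlt => ?_⟩
  · obtain ⟨p, hp, hx⟩ := hspec σ hσ
    exact h.mem p _ (dMem_iff.2 ⟨σ, hp⟩) hx
  · obtain ⟨p, hp, hx⟩ := hspec σ hσ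
    obtain ⟨q, hq, hy⟩ := hspec τ hτ
    exact h.lt p q _ _ (dMem_iff.2 ⟨σ, hp⟩) (dMem_iff.2 ⟨τ, hq⟩) hx hy (hp.dLt_of_tLt hX hq hlt)

/-! ### Rank functions built from a collapse -/

namespace Collapse

variable {D : TreeFamily M} {L : LOrd M} (ξ : Collapse D L)

@[fun_prop] theorem arith_map' {α : Type*} [ArType M α] {f : α → M.Num} (hf : Arith M f) :
    Arith M fun x => ξ.map (f x) := ξ.arith_map.comp hf

/-- Bounds for the values of the rank functions. -/
noncomputable def bound (n : M.Num) : M.Num :=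
  primRec (ξ.map (bot (ξ.map 0))) (fun _ y => ξ.map (bot (ξ.map (bot y)))) n

@[fun_prop] theorem arith_bound {α : Type*} [ArType M α] {f : α → M.Num} (hf : Arith M f) :
    Arith M fun x => ξ.bound (f x) := by
  unfold bound
  fun_prop

theorem bound_zero : ξ.bound 0 = ξ.map (bot (ξ.map 0)) := primRec_zero _ (by fun_prop)

theorem bound_succ (n : M.Num) : ξ.bound (n + 1) = ξ.map (bot (ξ.map (bot (ξ.bound n)))) :=
  primRec_succ _ (g := fun _ y => ξ.map (bot (ξ.map (bot y)))) (by fun_prop) n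

open Classical in
/-- The value at `s` of the rank function of the tree with index `n + 1`, computed from a table `t`
of the previous rank function. -/
noncomputable def rankStep (n t s : M.Num) : M.Num :=
  if D.InTree (n + 1) s then
    ξ.map (node (ξ.bound n) (n + 1) (mkSeq (fun i => pair (get s i) (get t i)) (len s)))
  else ξ.bound n

@[fun_prop] theorem arith_rankStep {α : Type*} [ArType M α] {f g h : α → M.Num} (hf : Arith M f)
    (hg : Arith M g) (hh : Arith M h) : Arith M fun x => ξ.rankStep (f x) (g x) (h x) := by
  unfold rankStep
  fun_prop

/-- The table of the first `k` values of the `n`-th rank function. -/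
noncomputable def table (k n : M.Num) : M.Num :=
  primRec (mkSeq (fun _ => ξ.map 0) k) (fun n t => mkSeq (fun s => ξ.rankStep n t s) k) n

@[fun_prop] theorem arith_table {α : Type*} [ArType M α] {f g : α → M.Num} (hf : Arith M f)
    (hg : Arith M g) : Arith M fun x => ξ.table (f x) (g x) := by
  unfold table
  fun_prop

/-- The `n`-th rank function. -/
noncomputable def rank (n s : M.Num) : M.Num := get (ξ.table (s + 1) n) s

@[fun_prop] theorem arith_rank {α : Type*} [ArType M α] {f g : α → M.Num} (hf : Arith M f)
    (hg : Arith M g) : Arith M fun x => ξ.rank (f x) (g x) := by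
  unfold rank
  fun_prop

theorem get_table_zero {k s : M.Num} (hs : s < k) : get (ξ.table k 0) s = ξ.map 0 := by
  rw [table, primRec_zero _ (by fun_prop)]
  exact get_mkSeq (F := fun _ => ξ.map 0) (by fun_prop) hs

theorem get_table_succ {k n s : M.Num} (hs : s < k) :
    get (ξ.table k (n + 1)) s = ξ.rankStep n (ξ.table k n) s := by
  have h := primRec_succ (mkSeq (fun _ => ξ.map 0) k)
    (g := fun n t => mkSeq (fun s => ξ.rankStep n t s) k) (by fun_prop) n
  rw [table, h]
  exact get_mkSeq (F := fun s => ξ.rankStep n _ s) (by fun_prop) hs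

/-- Positions in a sequence are smaller than its code, so only table entries below `s` are
consulted. -/
theorem rankStep_congr {n t t' s : M.Num} (h : ∀ i < s, get t i = get t' i) :
    ξ.rankStep n t s = ξ.rankStep n t' s := by
  unfold rankStep
  split_ifs with hs
  · rw [mkSeq_congr fun i hi => by rw [h i (hs.1.lt_code hi)]]
  · rfl

/-- The length of a table does not affect its entries. Hence the recursion on coded tables defines
whole rank functions, without iterating arithmetical comprehension along the numbers. -/
theorem get_table (n : M.Num) : ∀ k s, s < k → get (ξ.table k n) s = ξ.rank n s := by
  refine arith_induction (P := fun n => ∀ k s, s < k → get (ξ.table k n) s = ξ.rank n s)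
    (by fun_prop) (fun k s hs => ?_) (fun n ih k s hs => ?_) n
  · rw [rank, ξ.get_table_zero hs, ξ.get_table_zero (Num.lt_add_one s)]
  · rw [rank, ξ.get_table_succ hs, ξ.get_table_succ (Num.lt_add_one s)]
    refine ξ.rankStep_congr fun i hi => ?_
    rw [ih k i (hi.trans hs), ih (s + 1) i (hi.trans (Num.lt_add_one s))]

theorem rank_zero (s : M.Num) : ξ.rank 0 s = ξ.map 0 := ξ.get_table_zero (Num.lt_add_one s)

theorem rank_succ_of_inTree {n s : M.Num} (hs : D.InTree (n + 1) s) :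
    ξ.rank (n + 1) s = ξ.map (node (ξ.bound n) (n + 1)
      (mkSeq (fun i => pair (get s i) (ξ.rank n i)) (len s))) := by
  rw [rank, ξ.get_table_succ (Num.lt_add_one s), rankStep, if_pos hs]
  rw [mkSeq_congr fun i hi => by
    rw [ξ.get_table n _ i ((hs.1.lt_code hi).trans (Num.lt_add_one s))]]

theorem rank_succ_of_not_inTree {n s : M.Num} (hs : ¬ D.InTree (n + 1) s) :
    ξ.rank (n + 1) s = ξ.bound n := by
  rw [rank, ξ.get_table_succ (Num.lt_add_one s), rankStep, if_neg hs]

/-- All values of the `n`-th rank function lie below the `n`-th bound. -/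
def RankBelow (n : M.Num) : Prop :=
  (L.mem (ξ.bound n) ∧ L.lt (ξ.bound n) (ξ.map (bot (ξ.bound n)))) ∧
    (∀ s, L.lt (ξ.rank n s) (ξ.bound n)) ∧ (∀ s, L.mem (ξ.rank n s)) ∧
    ∀ s t, D.InTree n s → D.InTree n t → Ext s t → L.lt (ξ.rank n t) (ξ.rank n s)

theorem mem_bot {x : M.Num} (hx : L.mem x) : L.mem (ξ.map (bot x)) :=
  ξ.mem _ (tMem_bot _ _ hx)

theorem bot_lt_bot {x y : M.Num} (hx : L.mem x) (hy : L.mem y) (h : L.lt x y) :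
    L.lt (ξ.map (bot x)) (ξ.map (bot y)) :=
  ξ.lt _ _ (tMem_bot _ _ hx) (tMem_bot _ _ hy) (tLt_bot_of_node h)

/-- Starting from `0 < bot (ξ.map 0)`, two uses of monotonicity give the first bound `b` with `b <
ξ.map (bot b)`. The rank function may be constant because the 0-th tree has only its root. -/
theorem rankBelow_zero : ξ.RankBelow 0 := by
  have h0 : L.mem (ξ.map 0) := ξ.mem 0 (.inl rfl)
  have h1 : L.lt (ξ.map 0) (ξ.map (bot (ξ.map 0))) :=
    ξ.lt _ _ (.inl rfl) (tMem_bot _ _ h0) (.inl ⟨rfl, node_ne_zero _ _ _⟩)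
  refine ⟨?_, fun s => ?_, fun s => ?_, fun s t _ ht hst => ?_⟩
  · rw [bound_zero]
    exact ⟨ξ.mem_bot h0, ξ.bot_lt_bot h0 (ξ.mem_bot h0) h1⟩
  · rwa [rank_zero, bound_zero]
  · rwa [rank_zero]
  · have h := (zero_le (a := len s)).trans_lt hst.1
    exact absurd (ht.2 0 0 h h) (D.not_S_zero _ _ _ _)

/-- The bound can serve as base point because it exceeds all ranks, and the previous rank function
satisfies the demands of `W`. -/
theorem RankBelow.isNode {n s : M.Num} (h : ξ.RankBelow n) (hs : D.InTree (n + 1) s) :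
    D.spec.IsNode L.mem L.lt (ξ.bound n) (n + 1)
      (mkSeq (fun i => pair (get s i) (ξ.rank n i)) (len s)) := by
  have hF : Arith M fun i => pair (get s i) (ξ.rank n i) := by fun_prop
  have hget : ∀ i < len s, get (mkSeq (fun i => pair (get s i) (ξ.rank n i)) (len s)) i =
      pair (get s i) (ξ.rank n i) := fun i hi => get_mkSeq hF hi
  refine ⟨h.1.1, ⟨?_, ?_⟩, ?_, ?_⟩ <;> rw [len_mkSeq hF]
  · exact isSeq_mkSeq hF _
  · intro i hi
    rw [hget i hi]
    exact ⟨by simp, by simpa using h.2.2.1 i⟩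
  · intro i hi
    rw [hget i hi, psnd_pair]
    exact h.2.1 i
  · intro i j hi hj
    rw [hget i hi, hget j hj, pfst_pair, pfst_pair, psnd_pair, psnd_pair]
    refine ⟨hs.2 i j hi hj, ?_⟩
    rintro ⟨d, hd, h1, h2, h3⟩
    obtain rfl := add_right_cancel hd
    exact h.2.2.2 i j h1 h2 h3

/-- Write `b` for the old bound. The new ranks are images of nodes with base point `b < ξ.map (bot
b)`, so they lie below the image of `bot (ξ.map (bot b))`, which explains the two applications of
`ξ` in the bound. The inequality `b < ξ.map (bot b)` is carried along because it does not hold for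
arbitrary elements of the order. -/
theorem RankBelow.succ {n : M.Num} (h : ξ.RankBelow n) : ξ.RankBelow (n + 1) := by
  have m1 := ξ.mem_bot h.1.1
  have m2 := ξ.mem_bot m1
  have l1 := ξ.bot_lt_bot h.1.1 m1 h.1.2
  have l2 := ξ.bot_lt_bot m1 m2 l1
  have hT : ∀ {s}, D.InTree (n + 1) s → D.spec.TMem L.mem L.lt (node (ξ.bound n) (n + 1)
      (mkSeq (fun i => pair (get s i) (ξ.rank n i)) (len s))) := fun hs =>
    .inr ⟨_, _, _, rfl, RankBelow.isNode ξ h hs⟩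
  refine ⟨?_, fun s => ?_, fun s => ?_, fun s t hs ht hst => ?_⟩
  · rw [bound_succ]
    exact ⟨m2, l2⟩
  · rw [bound_succ]
    by_cases hs : D.InTree (n + 1) s
    · rw [ξ.rank_succ_of_inTree hs]
      exact ξ.lt _ _ (hT hs) (tMem_bot _ _ m1) (tLt_bot_of_node h.1.2)
    -- The default value outside the tree only has to stay below the new bound.
    · rw [ξ.rank_succ_of_not_inTree hs]
      exact L.trans h.1.1 m1 m2 h.1.2 l1
  · by_cases hs : D.InTree (n + 1) s
    · rw [ξ.rank_succ_of_inTree hs]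
      exact ξ.mem _ (hT hs)
    · rw [ξ.rank_succ_of_not_inTree hs]
      exact h.1.1
  · rw [ξ.rank_succ_of_inTree hs, ξ.rank_succ_of_inTree ht]
    -- The two nodes share base point and index, and the sequence from `t` properly extends that
    -- from `s`; the deciding place is `len s`.
    refine ξ.lt _ _ (hT ht) (hT hs)
      (.inr ⟨_, _, _, _, _, _, rfl, rfl, .inr ⟨rfl, .inr ⟨rfl, len s, ?_, fun j hj => ?_, ?_⟩⟩⟩)
    · rw [len_mkSeq (by fun_prop)]
      exact hst.1
    · rw [get_mkSeq (by fun_prop) (hj.trans hst.1), get_mkSeq (by fun_prop) hj, hst.2 j hj]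
    · rw [len_mkSeq (by fun_prop)]
      exact .inl rfl

include ξ in
-- Unlike `NoPath`, the statement `RankBelow` is arithmetical, so induction is available for it.
theorem noPath (hL : WFOn L.mem L.lt) (n : M.Num) : D.NoPath n := by
  have h : ξ.RankBelow n := by
    refine arith_induction (P := fun n => ξ.RankBelow n) ?_ ξ.rankBelow_zero
      (fun n h => RankBelow.succ ξ h) n
    unfold RankBelow
    fun_prop
  exact TreeFamily.IsRank.noPath (R := fun s => ξ.rank n s) h.2.2 (by fun_prop) hL

end Collapse

/-- If normal dilators have well-founded fixed points, then the absence of infinite branches in a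
family of trees can be proved by induction. -/
theorem NormalDilatorsHaveFixedPoints.noPath (hfix : M.NormalDilatorsHaveFixedPoints)
    (D : TreeFamily M) (hstep : ∀ d, D.NoPath d → D.NoPath (d + 1)) (n : M.Num) : D.NoPath n := by
  obtain ⟨X, ξ, hξ, hX, hwf⟩ := hfix D.spec.data _ Spec.normalFamily_mem
    (TreeFamily.isDilator hstep) D.spec.isNormal
  obtain ⟨ξ'⟩ := exists_collapse D hξ hX
  exact ξ'.noPath hwf.wfOn n

/-- The family of trees with a trivial first member and the given family as the remaining
members. -/
def TreeFamily.shift (S : M.Num → M.Num → M.Num → M.Num → M.Num → Prop)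
    (hS : Arith M fun z : M.Num × M.Num × M.Num × M.Num × M.Num =>
      S z.1 z.2.1 z.2.2.1 z.2.2.2.1 z.2.2.2.2) : TreeFamily M where
  S c i j x y := ∃ d, c = d + 1 ∧ S d i j x y
  arith_S := by
    have : Arith M fun z : (M.Num × M.Num × M.Num × M.Num × M.Num) × M.Num =>
        S z.2 z.1.2.1 z.1.2.2.1 z.1.2.2.2.1 z.1.2.2.2.2 :=
      hS.comp (g := fun z : (M.Num × M.Num × M.Num × M.Num × M.Num) × M.Num =>
        (z.2, z.1.2.1, z.1.2.2.1, z.1.2.2.2.1, z.1.2.2.2.2)) (by fun_prop)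
    fun_prop
  not_S_zero := by
    rintro i j x y ⟨d, hd, -⟩
    exact hM.models.succ_ne_zero d hd.symm

end

end L2Structure

/-! ### Derivation of Π¹₁-induction -/

theorem mainTheorem2 (M : L2Structure.{u}) (hM : M.ModelsACA0)
    (hfix : M.NormalDilatorsHaveFixedPoints) :
    ∀ (φ : L2Formula) (i : ℕ), φ.IsPi11 → M.SatisfiesInduction φ i := by
  rintro _ i ⟨X, θ, hθ, rfl⟩ v V h0 hs
  have : M.ACA := ⟨hM, ⟨V 0⟩⟩
  obtain ⟨S, hS, hSF⟩ := L2Structure.exists_normal_form hθ X i v V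
  let D : L2Structure.TreeFamily M := .shift S hS
  -- The index is shifted by one because the tree with index 0 is the trivial one.
  have key : ∀ n, M.Sat (.allSet X θ) (Function.update v i n) V ↔ D.NoPath (n + 1) := by
    intro n
    have h1 : M.Sat (.allSet X θ) (Function.update v i n) V ↔
        ¬ ∃ A : M.sets, ¬ M.Sat θ (Function.update v i n) (Function.update V X A) := by
      rw [not_exists]
      exact forall_congr' fun A => not_not.symm
    have h2 : ∀ j k x y, D.S (n + 1) j k x y ↔ S n j k x y := fun j k x y =>
      ⟨fun ⟨d, hd, h⟩ => add_right_cancel hd ▸ h, fun h => ⟨n, rfl, h⟩⟩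
    rw [h1, hSF]
    simp only [L2Structure.TreeFamily.NoPath, L2Structure.TreeFamily.IsPath, h2, not_exists,
      not_and]
  intro n
  rw [key]
  refine hfix.noPath D (fun d hd => ?_) (n + 1)
  -- The step from the trivial tree to the next one is the base case of the induction; the other
  -- steps are its induction step.
  obtain rfl | ⟨e, rfl⟩ := L2Structure.Num.eq_zero_or_exists_succ d
  · rw [← key]
    exact h0
  · rw [← key] at hd ⊢
    exact hs e hd
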